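/- **Model.** Let $x_1=0$, $x_{t+1}=Ax_t+Bu_t+w_t$ for $t\ge 1$, with $x_t\in\mathbb R^n$, $u_t\in\mathbb R^m$, $w_t$ i.i.d. $\mathcal N(0,\sigma_w^2I)$, $\sigma_w>0$, and per-step cost $c(x,u)=x^\top Qx+u^\top Ru$ with $Q,R$ positive definite. Write $\theta^\top=[A_\theta,B_\theta]$, $\theta\in\mathbb R^{(n+m)\times n}$, with columns $\theta(i)$. Let $J(\theta)$ be the minimum over all (possibly randomized, history-dependent) policies of $\limsup_{T}\frac1T\mathbb E\sum_{t\le T}c(x_t,u_t)$, let $S(\theta)$ be the positive semidefinite solution of the Riccati equation $S=Q+A^\top SA-A^\top SB(R+B^\top SB)^{-1}B^\top SA$ (with $A=A_\theta$, $B=B_\theta$), and let $G(\theta)=-(R+B^\top SB)^{-1}B^\top SA$. **Prior (Assumption 1).** $\Omega_1$ is a compact set of parameters and the true parameter $\theta_1$ has law $\mu_1=\bar\mu_1|_{\Omega_1}$ (normalized), where under $\bar\mu_1$ the columns are independent, $\theta(i)\sim\mathcal N(\hat\theta_1(i),\Sigma_1)$, with $\Sigma_1$ positive definite and $\bar\mu_1(\Omega_1)>0$.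 **Assumption 2.** There is $\delta\in(0,1)$ such that $\rho(A_\theta+B_\theta G(\phi))\le\delta$ for all $\theta,\phi\in\Omega_1$ ($\rho$ the spectral radius). **TSDE with minimum episode length $T_{\min}\in\mathbb N$.** With $z_t=(x_t,u_t)$, put $\Sigma_{t+1}^{-1}=\Sigma_t^{-1}+\sigma_w^{-2}z_tz_t^\top$ and $\hat\theta_{t+1}(i)=\hat\theta_t(i)+\Sigma_tz_t\,(x_{t+1}(i)-\hat\theta_t(i)^\top z_t)/(\sigma_w^2+z_t^\top\Sigma_tz_t)$, and let $\mu_t$ be $\prod_i\mathcal N(\hat\theta_t(i),\Sigma_t)$ truncated to $\Omega_1$. Episodes start at $t_1=1$ and $t_{k+1}=\min\{t>t_k+T_{\min}: t-t_k>T_{k-1}\text{ or }\det\Sigma_t<\frac12\det\Sigma_{t_k}\}$, where $T_k=t_{k+1}-t_k$ and $T_0=T_{\min}+1$. At time $t_k$ sample $\bar\theta_k\sim\mu_{t_k}$, and use $u_t=G(\bar\theta_k)x_t$ for $t_k\le t<t_{k+1}$. The Bayesian regret is $R(T)=\mathbb E[\sum_{t=1}^Tc(x_t,u_t)-TJ(\theta_1)]$.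 **Theorem.** Under Assumptions 1 and 2: (a) For every $\varepsilon\in(0,1-\delta)$ there is $\alpha\ge1$ with $$\|(A_\theta+B_\theta G(\phi))^t\|\le\alpha(\varepsilon+\delta)^t\qquad\text{for all }\theta,\phi\in\Omega_1,\ t\ge1.\tag{$*$}$$ (b) For every $\varepsilon\in(0,1-\delta)$, every $\alpha\ge1$ satisfying $(*)$, and every $T_{\min}\ge T^*_{\min}:=\bigl\lceil\frac{\log\alpha}{-\log(\varepsilon+\delta)}\bigr\rceil$, the regret of TSDE is well defined (the random variable is integrable) and $R(T)\le\tilde O(\sigma_w^2(n+m)\sqrt{nT})$; that is, for all $T\ge1$ and $\sigma_w>0$, $$R(T)\le C\,\sigma_w^2\,(n+m)\sqrt{nT}\,(1+\log T)^p .$$ Here $C$ and $p$ depend only on the numbers $\alpha$, $\varepsilon+\delta$, $T_{\min}$, $\sup_{\phi\in\Omega_1}\|G(\phi)\|$, $\sup_{\phi\in\Omega_1}\|S(\phi)\|$, $\|\Sigma_1\|$ and $\bar\mu_1(\Omega_1)$; they do not depend on $T$ or $\sigma_w$, and on $n$, $m$ and the rest of the data only through these numbers. (All matrix norms are spectral norms.)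 -/

import Mathlib

open MeasureTheory ProbabilityTheory Filter Matrix
open scoped ENNReal Matrix.Norms.L2Operator

namespace LQ

/-- Parameters `θ ∈ ℝ^{(n+m) × n}` with `θᵀ = [A, B]`, stored by columns:
`θ i ∈ ℝ^{n+m}` is the `i`-th column of `θ`, i.e. the `i`-th row of `[A, B]`. -/
abbrev Param (n m : ℕ) : Type := Fin n → EuclideanSpace ℝ (Fin n ⊕ Fin m)

/-- The block `A_θ`. -/
def matA {n m : ℕ} (θ : Param n m) : Matrix (Fin n) (Fin n) ℝ :=
  Matrix.of fun i j => θ i (Sum.inl j)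

/-- The block `B_θ`. -/
def matB {n m : ℕ} (θ : Param n m) : Matrix (Fin n) (Fin m) ℝ :=
  Matrix.of fun i j => θ i (Sum.inr j)

/-- `S` is a positive semidefinite solution of the discrete algebraic Riccati equation of `θ`. -/
def IsRiccati {n m : ℕ} (Q : Matrix (Fin n) (Fin n) ℝ) (R : Matrix (Fin m) (Fin m) ℝ)
    (θ : Param n m) (S : Matrix (Fin n) (Fin n) ℝ) : Prop :=
  S.PosSemidef ∧
    S = Q + (matA θ)ᵀ * S * matA θ
      - (matA θ)ᵀ * S * matB θ * (R + (matB θ)ᵀ * S * matB θ)⁻¹ * (matB θ)ᵀ * S * matA θ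

open Classical in
/-- `S(θ)`: the positive semidefinite solution of the Riccati equation. For positive definite
`Q`, `R` it exists exactly when `(A_θ, B_θ)` is stabilizable, and is then unique
(value `0` when there is none). -/
noncomputable def ricS {n m : ℕ} (Q : Matrix (Fin n) (Fin n) ℝ) (R : Matrix (Fin m) (Fin m) ℝ)
    (θ : Param n m) : Matrix (Fin n) (Fin n) ℝ :=
  if h : ∃ S, IsRiccati Q R θ S then h.choose else 0

/-- The gain `G(θ) = -(R + Bᵀ S(θ) B)⁻¹ Bᵀ S(θ) A`. -/
noncomputable def gain {n m : ℕ} (Q : Matrix (Fin n) (Fin n) ℝ) (R : Matrix (Fin m) (Fin m) ℝ)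
    (θ : Param n m) : Matrix (Fin m) (Fin n) ℝ :=
  -((R + (matB θ)ᵀ * ricS Q R θ * matB θ)⁻¹ * (matB θ)ᵀ * ricS Q R θ * matA θ)

/-- The per-step cost `xᵀ Q x + uᵀ R u`. -/
def cost {n m : ℕ} (Q : Matrix (Fin n) (Fin n) ℝ) (R : Matrix (Fin m) (Fin m) ℝ)
    (x : Fin n → ℝ) (u : Fin m → ℝ) : ℝ :=
  x ⬝ᵥ (Q *ᵥ x) + u ⬝ᵥ (R *ᵥ u)

/-- The noise law `N(0, σ² I)` on `ℝⁿ`. -/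
noncomputable abbrev noise (n : ℕ) (σ : ℝ) : Measure (Fin n → ℝ) :=
  Measure.pi fun _ => gaussianReal 0 (Real.toNNReal (σ ^ 2))

/-! ### Optimal long-term average cost of a known system -/

/-- A (possibly randomized, history dependent) policy. At time `t + 1` it maps a random seed and
the states `x_1, …, x_{t+1}` to the control `u_{t+1}`; past controls are functions of these. -/
structure Policy (n m : ℕ) where
  act : (t : ℕ) → unitInterval × (Fin (t + 1) → Fin n → ℝ) → (Fin m → ℝ)
  measurable_act : ∀ t, Measurable (act t)

/-- The state history `x_1, …, x_{t+1}` of system `θ` under policy `π`, seed `v`, and noise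
sequence `w` (the noise `w_{t+1}` acts between the times `t+1` and `t+2`); `x_1 = 0`. -/
noncomputable def history {n m : ℕ} (θ : Param n m) (π : Policy n m) (v : unitInterval)
    (w : ℕ → Fin n → ℝ) : (t : ℕ) → (Fin (t + 1) → Fin n → ℝ)
  | 0 => fun _ => 0
  | t + 1 =>
      let h := history θ π v w t
      Fin.snoc (α := fun _ => Fin n → ℝ) h
        (matA θ *ᵥ h (Fin.last t) + matB θ *ᵥ π.act t (v, h) + w (t + 1))

/-- `J(π; θ)`: the upper limit of the expected average cost, as an extended nonnegative real
(all costs are nonnegative). -/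
noncomputable def avgCost {n m : ℕ} (Q : Matrix (Fin n) (Fin n) ℝ) (R : Matrix (Fin m) (Fin m) ℝ)
    (σ : ℝ) (θ : Param n m) (π : Policy n m) : ℝ≥0∞ :=
  limsup (fun T : ℕ =>
    (∫⁻ ω, ∑ t ∈ Finset.range T,
      ENNReal.ofReal (cost Q R (history θ π ω.1 ω.2 t (Fin.last t))
        (π.act t (ω.1, history θ π ω.1 ω.2 t)))
      ∂((volume : Measure unitInterval).prod (Measure.infinitePi fun _ : ℕ => noise n σ)))
    / (T : ℝ≥0∞)) atTop

/-- `J(θ)`: the optimal long-term average cost over all policies. -/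
noncomputable def optCost {n m : ℕ} (Q : Matrix (Fin n) (Fin n) ℝ) (R : Matrix (Fin m) (Fin m) ℝ)
    (σ : ℝ) (θ : Param n m) : ℝ :=
  (⨅ π : Policy n m, avgCost Q R σ θ π).toReal

/-! ### Prior and problem data -/

/-- The Gaussian law on parameters with independent columns `θ(i) ∼ N(μ(i), Σ)`. -/
noncomputable def gaussParam {n m : ℕ} (μ : Param n m)
    (Sig : Matrix (Fin n ⊕ Fin m) (Fin n ⊕ Fin m) ℝ) : Measure (Param n m) :=
  Measure.pi fun i => multivariateGaussian (μ i) Sig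

/-- Cost matrices, compact parameter set `Ω₁`, and truncated Gaussian prior data. The last field
says that the truncation (conditioning on `Ω₁`) makes sense. -/
structure Problem (n m : ℕ) where
  Q : Matrix (Fin n) (Fin n) ℝ
  R : Matrix (Fin m) (Fin m) ℝ
  posDef_Q : Q.PosDef
  posDef_R : R.PosDef
  supp : Set (Param n m)
  isCompact_supp : IsCompact supp
  mean : Param n m
  cov : Matrix (Fin n ⊕ Fin m) (Fin n ⊕ Fin m) ℝ
  posDef_cov : cov.PosDef
  mass_ne_zero : gaussParam mean cov supp ≠ 0

namespace Problem

variable {n m : ℕ}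

/-- The Gaussian `∏ N(μ(i), Σ)` truncated to `Ω₁` (and normalized). -/
noncomputable def trunc (pb : Problem n m) (μ : Param n m)
    (Sig : Matrix (Fin n ⊕ Fin m) (Fin n ⊕ Fin m) ℝ) : Measure (Param n m) :=
  ProbabilityTheory.cond (gaussParam μ Sig) pb.supp

/-- The prior `μ₁`. -/
noncomputable def prior (pb : Problem n m) : Measure (Param n m) := pb.trunc pb.mean pb.cov

/-- The closed loop matrix `A_θ + B_θ G(φ)`. -/
noncomputable def closedLoop (pb : Problem n m) (θ φ : Param n m) : Matrix (Fin n) (Fin n) ℝ :=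
  matA θ + matB θ * gain pb.Q pb.R φ

/-- `ρ(A_θ + B_θ G(φ)) ≤ δ` for all `θ, φ ∈ Ω₁`, with `ρ` the spectral radius over `ℂ`. -/
def SpectralRadiusLE (pb : Problem n m) (δ : ℝ) : Prop :=
  ∀ θ ∈ pb.supp, ∀ φ ∈ pb.supp,
    spectralRadius ℂ ((pb.closedLoop θ φ).map Complex.ofReal) ≤ ENNReal.ofReal δ

/-- `‖(A_θ + B_θ G(φ))^t‖ ≤ α r^t` for all `θ, φ ∈ Ω₁` and `t ≥ 1` (operator norm). -/
def PowerBound (pb : Problem n m) (r α : ℝ) : Prop :=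
  ∀ θ ∈ pb.supp, ∀ φ ∈ pb.supp, ∀ t : ℕ, 1 ≤ t → ‖pb.closedLoop θ φ ^ t‖ ≤ α * r ^ t

end Problem

/-- `T*_min = ⌈log α / (-log r)⌉`, where `r = ε + δ`. -/
noncomputable def tMinStar (r α : ℝ) : ℕ := ⌈Real.log α / (-Real.log r)⌉₊

/-! ### The TSDE algorithm with minimum episode length -/

/-- The test made at time `t` when the current episode started at `s.1 = t_k` and the previous
one had length `s.2 = T_{k-1}`; `D t` stands for `det Σ_t`. -/
def EndsAt (Tmin : ℕ) (D : ℕ → ℝ) (s : ℤ × ℤ) (t : ℕ) : Prop :=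
  (t : ℤ) - s.1 > Tmin ∧ ((t : ℤ) - s.1 > s.2 ∨ D t < 1 / 2 * D s.1.toNat)

open Classical in
/-- The pair `(t_k, T_{k-1})` after the test of time `t`, for the episode `k` running at time `t`.
Initially `t_0 = -T_min` and `T_{-1} = T_min`, so that the first test always succeeds. -/
noncomputable def clock (Tmin : ℕ) (D : ℕ → ℝ) : ℕ → ℤ × ℤ
  | 0 => (-(Tmin : ℤ), (Tmin : ℤ))
  | t + 1 =>
      let s := clock Tmin D t
      if EndsAt Tmin D s (t + 1) then ((t : ℤ) + 1, (t : ℤ) + 1 - s.1) else s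

/-- A new episode starts at time `t ≥ 1`. -/
def StartsAt (Tmin : ℕ) (D : ℕ → ℝ) (t : ℕ) : Prop :=
  EndsAt Tmin D (clock Tmin D (t - 1)) t

/-- A run of TSDE on a probability space `(Ω, P)`; times are `t ≥ 1` (the values at time `0` are
irrelevant). `θ` is the true parameter, `w` the noise, `θbar t` the sampled parameter in use at
time `t`, `x`, `u` states and controls, and `θhat t`, `Sig t` the parameters of the posterior. -/
structure Run {n m : ℕ} (pb : Problem n m) (σ : ℝ) (Tmin : ℕ)
    {Ω : Type*} [MeasurableSpace Ω] (P : Measure Ω) where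
  θ : Ω → Param n m
  w : ℕ → Ω → Fin n → ℝ
  θbar : ℕ → Ω → Param n m
  x : ℕ → Ω → Fin n → ℝ
  u : ℕ → Ω → Fin m → ℝ
  θhat : ℕ → Ω → Param n m
  Sig : ℕ → Ω → Matrix (Fin n ⊕ Fin m) (Fin n ⊕ Fin m) ℝ
  measurable_θ : Measurable θ
  measurable_w : ∀ t, Measurable (w t)
  measurable_θbar : ∀ t, Measurable (θbar t)
  /-- System dynamics. -/
  x_one : ∀ ω, x 1 ω = 0
  x_succ : ∀ t, 1 ≤ t → ∀ ω,
    x (t + 1) ω = matA (θ ω) *ᵥ x t ω + matB (θ ω) *ᵥ u t ω + w t ω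
  /-- The control `u_t = G(θbar_t) x_t`. -/
  u_eq : ∀ t, 1 ≤ t → ∀ ω, u t ω = gain pb.Q pb.R (θbar t ω) *ᵥ x t ω
  /-- Posterior updates, with `z_t = (x_t, u_t)`. -/
  θhat_one : ∀ ω, θhat 1 ω = pb.mean
  Sig_one : ∀ ω, Sig 1 ω = pb.cov
  θhat_succ : ∀ t, 1 ≤ t → ∀ ω i,
    θhat (t + 1) ω i = θhat t ω i +
      ((x (t + 1) ω i - (θhat t ω i).ofLp ⬝ᵥ Sum.elim (x t ω) (u t ω)) /
        (σ ^ 2 + Sum.elim (x t ω) (u t ω) ⬝ᵥ (Sig t ω *ᵥ Sum.elim (x t ω) (u t ω)))) •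
      WithLp.toLp 2 (Sig t ω *ᵥ Sum.elim (x t ω) (u t ω))
  Sig_succ : ∀ t, 1 ≤ t → ∀ ω,
    Sig (t + 1) ω = ((Sig t ω)⁻¹ + (1 / σ ^ 2) •
      vecMulVec (Sum.elim (x t ω) (u t ω)) (Sum.elim (x t ω) (u t ω)))⁻¹
  /-- The true parameter is drawn from the prior. -/
  law_θ : P.map θ = pb.prior
  /-- Within an episode the sampled parameter is kept. -/
  keep : ∀ t, 1 ≤ t → ∀ ω,
    ¬ StartsAt Tmin (fun s => (Sig s ω).det) t → θbar t ω = θbar (t - 1) ω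
  /-- When an episode starts at `t`, the parameter is sampled from the posterior `μ_t`: this is
  its conditional law given the true parameter, the past noise and the past samples (hence
  given the observed history too). -/
  sample : ∀ t, 1 ≤ t → ∀ E : Set (Param n m), MeasurableSet E →
    ∀ᵐ ω ∂P, StartsAt Tmin (fun s => (Sig s ω).det) t →
      (P⟦θbar t ⁻¹' E |
        MeasurableSpace.comap θ inferInstance ⊔
        ⨆ s ∈ Finset.Ico 1 t,
          (MeasurableSpace.comap (w s) inferInstance ⊔
            MeasurableSpace.comap (θbar s) inferInstance)⟧) ω
      = (pb.trunc (θhat t ω) (Sig t ω)).real E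
  /-- The noise is Gaussian, and `w_t` is independent of the true parameter, the past noise,
  and the samples up to time `t`; in particular the noise is i.i.d. -/
  law_w : ∀ t, 1 ≤ t → P.map (w t) = noise n σ
  indep_w : ∀ t, 1 ≤ t → Indep (MeasurableSpace.comap (w t) inferInstance)
    (MeasurableSpace.comap θ inferInstance ⊔
      (⨆ s ∈ Finset.Ico 1 t, MeasurableSpace.comap (w s) inferInstance) ⊔
      ⨆ s ∈ Finset.Icc 1 t, MeasurableSpace.comap (θbar s) inferInstance) P

namespace Run

variable {n m : ℕ} {pb : Problem n m} {σ : ℝ} {Tmin : ℕ} {Ω : Type*} [MeasurableSpace Ω]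
  {P : Measure Ω}

/-- `∑_{t=1}^T c(x_t, u_t) - T J(θ₁)`, whose expectation is the Bayesian regret. -/
noncomputable def excess (r : Run pb σ Tmin P) (T : ℕ) (ω : Ω) : ℝ :=
  ∑ t ∈ Finset.Icc 1 T, cost pb.Q pb.R (r.x t ω) (r.u t ω) - T * optCost pb.Q pb.R σ (r.θ ω)

/-- The Bayesian regret `R(T; TSDE)`. -/
noncomputable def regret (r : Run pb σ Tmin P) (T : ℕ) : ℝ := ∫ ω, r.excess T ω ∂P

end Run

/-! ### The quantities on which the hidden constants depend -/

/-- The scalars on which the constants hidden by the `Õ` notation may depend. -/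
structure Scalars where
  α : ℝ
  r : ℝ
  Tmin : ℕ
  /-- Supremum of the norms of the gains `G(φ)`, `φ ∈ Ω₁`. -/
  gainBound : ℝ
  /-- Supremum of the norms of the Riccati solutions `S(φ)`, `φ ∈ Ω₁`. -/
  ricBound : ℝ
  /-- The norm of the prior covariance `Σ₁`. -/
  covNorm : ℝ
  /-- The probability of `Ω₁` under the untruncated Gaussian prior. -/
  mass : ℝ

/-- The scalars of a given problem. The suprema are over a compact set. -/
noncomputable def Problem.scalars {n m : ℕ} (pb : Problem n m) (r α : ℝ) (Tmin : ℕ) : Scalars where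
  α := α
  r := r
  Tmin := Tmin
  gainBound := sSup ((fun φ => ‖gain pb.Q pb.R φ‖) '' pb.supp)
  ricBound := sSup ((fun φ => ‖ricS pb.Q pb.R φ‖) '' pb.supp)
  covNorm := ‖pb.cov‖
  mass := (gaussParam pb.mean pb.cov).real pb.supp

end LQ

/-! Let S_t be the Riccati matrix of the parameter in use at time t, and let y_t = θᵀz_t and ȳ_t =
θ̄_tᵀz_t be the one-step predictions made with the true and with the sampled parameter. The Riccati
equation gives c(x_t, u_t) = x_tᵀS_t x_t - ȳ_tᵀS_t ȳ_t, and J(θ) = σ² tr S(θ) (`optCost_eq`). The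
noise w_t is independent of (S_t, y_t), so E x_{t+1}ᵀS_t x_{t+1} = E y_tᵀS_t y_t + σ² E tr S_t.
Hence the regret is the expectation of three sums: the drift ∑ (x_tᵀS_t x_t - x_{t+1}ᵀS_t x_{t+1}),
the prediction error ∑ (y_tᵀS_t y_t - ȳ_tᵀS_t ȳ_t), and the sampling term σ² ∑ (tr S_t - tr S(θ)).

The drift telescopes inside each episode, so it is at most the number K of episodes times a bound on
xᵀSx. The states are bounded by a constant times the largest noise vector (`norm_x_le`): powers of a
closed loop decay geometrically, and the minimum episode length absorbs the factor α lost at each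
change of gain. K is controlled by a potential argument (`numStarts_le`), because an episode ends
only after it outlasts its predecessor or after det Σ has halved.

In the prediction error, y_t - ȳ_t is at most the deviation of θ and θ̄ from the posterior mean, in
units of the posterior covariance, times the predictive standard deviation (`norm_obs_sub_le`). The
predictive variances add up to log₂(det Σ_1 / det Σ_{T+1}) up to constants, and Cauchy-Schwarz
produces √T. The determinant test compares Σ_t with the covariance at the start of the episode; the
first steps of an episode, where the test is not in force, are bounded crudely.

For the sampling term, at the start of an episode θ̄ and θ have the same conditional law given the
history (`lintegral_start_θbar`), and an episode is at most one step longer than its predecessor,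
whose length is then already known. So ∑ E tr S_t ≤ E[tr S(θ) (T + T_min + K)]
(`sum_integral_trace_le`).

The random inputs are the noise level and the largest deviation. Both are logarithms of sums of
exponential moments. For the deviations the posterior is a truncated Gaussian (`exists_isHistory`);
dropping the truncation costs the inverse posterior mass of Ω₁, whose expectation never exceeds its
initial value (`lintegral_inv_mass_le`). A net of at most 5^n unit vectors replaces a norm in ℝⁿ by
finitely many scalar deviations, which costs only n in the logarithm.

Part (a) follows from Cayley-Hamilton: the product of the factors M - λ over the eigenvalues
vanishes, and peeling off one factor at a time gives geometric decay with a constant depending only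
on n, δ, ε and a bound for ‖M‖. -/

namespace LQ

/-! ### Quadratic forms and the spectral norm. -/

section QuadraticForm

variable {ι κ : Type*} [Fintype ι] [Fintype κ]

/-- The quadratic form `xᵀ S x`. -/
def qf (S : Matrix ι ι ℝ) (x : ι → ℝ) : ℝ := x ⬝ᵥ (S *ᵥ x)

lemma qf_add_matrix (S T : Matrix ι ι ℝ) (x : ι → ℝ) : qf (S + T) x = qf S x + qf T x := by
  simp [qf, add_mulVec, dotProduct_add]

lemma qf_sub_matrix (S T : Matrix ι ι ℝ) (x : ι → ℝ) : qf (S - T) x = qf S x - qf T x := by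
  simp [qf, sub_mulVec, dotProduct_sub]

lemma qf_smul_matrix (a : ℝ) (S : Matrix ι ι ℝ) (x : ι → ℝ) : qf (a • S) x = a * qf S x := by
  simp [qf, smul_mulVec]

@[simp] lemma qf_zero_matrix (x : ι → ℝ) : qf (0 : Matrix ι ι ℝ) x = 0 := by simp [qf]

@[simp] lemma qf_zero_vec (S : Matrix ι ι ℝ) : qf S 0 = 0 := by simp [qf]

lemma qf_nonneg {S : Matrix ι ι ℝ} (hS : S.PosSemidef) (x : ι → ℝ) : 0 ≤ qf S x := by
  simpa [qf] using hS.dotProduct_mulVec_nonneg x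

lemma posSemidef_of_qf {S : Matrix ι ι ℝ} (hS : Sᵀ = S) (h : ∀ x, 0 ≤ qf S x) :
    S.PosSemidef :=
  .of_dotProduct_mulVec_nonneg (by simpa [Matrix.IsHermitian] using hS)
    (fun x => by simpa [qf] using h x)

lemma transpose_eq_of_posSemidef {ι : Type*} {S : Matrix ι ι ℝ} (hS : S.PosSemidef) : Sᵀ = S := by
  simpa [Matrix.IsHermitian] using hS.1

lemma dotProduct_mulVec_comm_of_symm {S : Matrix ι ι ℝ} (hS : Sᵀ = S) (x y : ι → ℝ) :
    x ⬝ᵥ (S *ᵥ y) = y ⬝ᵥ (S *ᵥ x) := by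
  rw [dotProduct_mulVec, ← mulVec_transpose, hS, dotProduct_comm]

lemma qf_add_vec {S : Matrix ι ι ℝ} (hS : Sᵀ = S) (x y : ι → ℝ) :
    qf S (x + y) = qf S x + 2 * (x ⬝ᵥ (S *ᵥ y)) + qf S y := by
  simp only [qf, mulVec_add, dotProduct_add, add_dotProduct]
  rw [dotProduct_mulVec_comm_of_symm hS y x]; ring

lemma dotProduct_transpose_mulVec (M : Matrix κ ι ℝ) (x : ι → ℝ) (y : κ → ℝ) :
    x ⬝ᵥ (Mᵀ *ᵥ y) = (M *ᵥ x) ⬝ᵥ y := by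
  rw [dotProduct_mulVec, vecMul_transpose]

lemma qf_transpose_mul_mul (M : Matrix κ ι ℝ) (S : Matrix κ κ ℝ) (x : ι → ℝ) :
    qf (Mᵀ * S * M) x = qf S (M *ᵥ x) := by
  simp only [qf, ← mulVec_mulVec, dotProduct_transpose_mulVec]

lemma qf_smul_vec (S : Matrix ι ι ℝ) (a : ℝ) (x : ι → ℝ) : qf S (a • x) = a ^ 2 * qf S x := by
  simp [qf, mulVec_smul]; ring

lemma apply_eq_qf [DecidableEq ι] {S : Matrix ι ι ℝ} (hS : Sᵀ = S) (i j : ι) :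
    S i j = (qf S (Pi.single i 1 + Pi.single j 1) - qf S (Pi.single i 1)
      - qf S (Pi.single j 1)) / 2 := by
  rw [qf_add_vec hS]
  simp only [single_one_dotProduct, mulVec_single_one, col_apply]
  ring

lemma eq_of_qf_eq {S T : Matrix ι ι ℝ} (hS : Sᵀ = S) (hT : Tᵀ = T)
    (h : ∀ x, qf S x = qf T x) : S = T := by
  classical
  ext i j
  rw [apply_eq_qf hS, apply_eq_qf hT]; simp [h]

lemma norm_toLp_sq (x : ι → ℝ) : ‖WithLp.toLp 2 x‖ ^ 2 = x ⬝ᵥ x := by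
  rw [EuclideanSpace.real_norm_sq_eq]; simp [dotProduct, sq]

lemma norm_toLp_mulVec_le [DecidableEq ι] (M : Matrix κ ι ℝ) (x : ι → ℝ) :
    ‖WithLp.toLp 2 (M *ᵥ x)‖ ≤ ‖M‖ * ‖WithLp.toLp 2 x‖ :=
  Matrix.l2_opNorm_mulVec M (WithLp.toLp 2 x)

lemma abs_dotProduct_le (x y : ι → ℝ) :
    |x ⬝ᵥ y| ≤ ‖WithLp.toLp 2 x‖ * ‖WithLp.toLp 2 y‖ := by
  have := abs_real_inner_le_norm (WithLp.toLp 2 y) (WithLp.toLp 2 x)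
  rw [EuclideanSpace.inner_eq_star_dotProduct] at this
  simpa [mul_comm] using this

lemma abs_dotProduct_mulVec_le [DecidableEq ι] (S : Matrix κ ι ℝ) (x : κ → ℝ) (y : ι → ℝ) :
    |x ⬝ᵥ (S *ᵥ y)| ≤ ‖S‖ * ‖WithLp.toLp 2 x‖ * ‖WithLp.toLp 2 y‖ := by
  refine (abs_dotProduct_le x _).trans ?_
  have := norm_toLp_mulVec_le S y
  calc _ ≤ ‖WithLp.toLp 2 x‖ * (‖S‖ * ‖WithLp.toLp 2 y‖) := by gcongr
    _ = _ := by ring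

lemma qf_le_norm [DecidableEq ι] (S : Matrix ι ι ℝ) (x : ι → ℝ) :
    qf S x ≤ ‖S‖ * ‖WithLp.toLp 2 x‖ ^ 2 := by
  have := (le_abs_self _).trans (abs_dotProduct_mulVec_le S x x)
  rw [qf]; linarith [this]

/-- Cauchy-Schwarz inequality for a positive semidefinite form. -/
lemma dotProduct_mulVec_sq_le {S : Matrix ι ι ℝ} (hS : S.PosSemidef) (x y : ι → ℝ) :
    (x ⬝ᵥ (S *ᵥ y)) ^ 2 ≤ qf S x * qf S y := by
  have hsym := transpose_eq_of_posSemidef hS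
  have h := discrim_le_zero (a := qf S y) (b := 2 * (x ⬝ᵥ (S *ᵥ y))) (c := qf S x) fun t => by
    have := qf_nonneg hS (x + t • y)
    rw [qf_add_vec hsym, mulVec_smul, dotProduct_smul, qf_smul_vec, smul_eq_mul] at this
    nlinarith [this]
  rw [discrim] at h; nlinarith

/-- An upper bound for a positive semidefinite form bounds the operator norm. -/
lemma norm_le_of_qf_le [DecidableEq ι] {S : Matrix ι ι ℝ} (hS : S.PosSemidef) {b : ℝ}
    (hb : 0 ≤ b) (h : ∀ x, qf S x ≤ b * ‖WithLp.toLp 2 x‖ ^ 2) : ‖S‖ ≤ b := by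
  rw [Matrix.l2_opNorm_def]
  refine ContinuousLinearMap.opNorm_le_bound _ hb fun x => ?_
  change ‖WithLp.toLp 2 (S *ᵥ x.ofLp)‖ ≤ b * ‖x‖
  set y := S *ᵥ x.ofLp with hy
  have h1 := dotProduct_mulVec_sq_le hS y x.ofLp
  rw [← hy, ← norm_toLp_sq] at h1
  have h2 := h y
  have h3 := h x.ofLp
  have h4 := qf_nonneg hS y
  have h5 := qf_nonneg hS x.ofLp
  set Y := ‖WithLp.toLp 2 y‖
  have hY : 0 ≤ Y := norm_nonneg _
  have hX : 0 ≤ ‖x‖ := norm_nonneg _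
  -- Cauchy-Schwarz for the form S, applied to y = Sx and x, gives |y|⁴ ≤ (yᵀSy)(xᵀSx).
  have h6 : (Y ^ 2) ^ 2 ≤ (b * Y ^ 2) * (b * ‖x‖ ^ 2) := h1.trans (mul_le_mul h2 h3 h5 (by positivity))
  by_cases hY0 : Y = 0
  · rw [hY0]; positivity
  have : Y ^ 2 ≤ (b * ‖x‖) ^ 2 := by
    have : 0 < Y ^ 2 := by positivity
    nlinarith
  exact (sq_le_sq₀ hY (by positivity)).1 this

lemma continuous_qf_matrix (x : ι → ℝ) : Continuous fun S : Matrix ι ι ℝ => qf S x := by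
  unfold qf; fun_prop

/-- Cauchy-Schwarz for the form S⁻¹, applied to x and Sx, gives |x|⁴ ≤ (xᵀS⁻¹x)(xᵀSx) ≤ ‖S⁻¹‖ |x|²
(xᵀSx). The added 1 keeps the constant finite when `‖S⁻¹‖` is zero. -/
lemma exists_pos_mul_le_qf [DecidableEq ι] {S : Matrix ι ι ℝ} (hS : S.PosDef) :
    ∃ c, 0 < c ∧ ∀ x, c * ‖WithLp.toLp 2 x‖ ^ 2 ≤ qf S x := by
  refine ⟨(1 + ‖S⁻¹‖)⁻¹, by positivity, fun x => ?_⟩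
  have hSi := hS.inv
  have hdet : IsUnit S.det := (Matrix.isUnit_iff_isUnit_det _).1 hS.isUnit
  have h1 := dotProduct_mulVec_sq_le hSi.posSemidef x (S *ᵥ x)
  rw [mulVec_mulVec, nonsing_inv_mul _ hdet, one_mulVec, ← norm_toLp_sq] at h1
  have h2 : qf S⁻¹ (S *ᵥ x) = qf S x := by
    rw [qf, mulVec_mulVec, nonsing_inv_mul _ hdet, one_mulVec, dotProduct_comm, qf]
  have h3 := qf_le_norm S⁻¹ x
  have h4 := qf_nonneg hS.posSemidef x
  rw [h2] at h1
  set X := ‖WithLp.toLp 2 x‖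
  have hN : 0 ≤ ‖S⁻¹‖ := norm_nonneg _
  rw [inv_mul_le_iff₀ (by positivity)]
  by_cases hX : X = 0
  · rw [hX]; simp; positivity
  have hX2 : 0 < X ^ 2 := by positivity
  nlinarith [mul_le_mul_of_nonneg_right h3 h4]

end QuadraticForm

/-! ### The Riccati equation and value iteration. -/

section Riccati

variable {n m : ℕ}

/-- The Riccati operator `P ↦ Q + AᵀPA - AᵀPB(R + BᵀPB)⁻¹BᵀPA`. -/
noncomputable def ricMap (Q : Matrix (Fin n) (Fin n) ℝ) (R : Matrix (Fin m) (Fin m) ℝ)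
    (A : Matrix (Fin n) (Fin n) ℝ) (B : Matrix (Fin n) (Fin m) ℝ) (P : Matrix (Fin n) (Fin n) ℝ) :
    Matrix (Fin n) (Fin n) ℝ :=
  Q + Aᵀ * P * A - Aᵀ * P * B * (R + Bᵀ * P * B)⁻¹ * Bᵀ * P * A

/-- The gain `-(R + BᵀPB)⁻¹BᵀPA` that is optimal for the terminal cost `P`. -/
noncomputable def ricGain (R : Matrix (Fin m) (Fin m) ℝ)
    (A : Matrix (Fin n) (Fin n) ℝ) (B : Matrix (Fin n) (Fin m) ℝ) (P : Matrix (Fin n) (Fin n) ℝ) :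
    Matrix (Fin m) (Fin n) ℝ :=
  -((R + Bᵀ * P * B)⁻¹ * Bᵀ * P * A)

variable {Q : Matrix (Fin n) (Fin n) ℝ} {R : Matrix (Fin m) (Fin m) ℝ}
  {A : Matrix (Fin n) (Fin n) ℝ} {B : Matrix (Fin n) (Fin m) ℝ} {P P' : Matrix (Fin n) (Fin n) ℝ}

lemma posDef_add_transpose_mul_mul (hR : R.PosDef) (hP : P.PosSemidef) :
    (R + Bᵀ * P * B).PosDef := by
  refine hR.add_posSemidef ?_
  simpa using hP.conjTranspose_mul_mul_same B

/-- Completion of squares in the one step dynamic programming operator. -/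
lemma cost_add_qf_eq (hR : R.PosDef) (hP : P.PosSemidef) (x : Fin n → ℝ) (u : Fin m → ℝ) :
    cost Q R x u + qf P (A *ᵥ x + B *ᵥ u) =
      qf (ricMap Q R A B P) x + qf (R + Bᵀ * P * B) (u - ricGain R A B P *ᵥ x) := by
  have hH := posDef_add_transpose_mul_mul (B := B) hR hP
  have hdet : IsUnit (R + Bᵀ * P * B).det := (Matrix.isUnit_iff_isUnit_det _).1 hH.isUnit
  have hPs := transpose_eq_of_posSemidef hP
  have hHs := transpose_eq_of_posSemidef hH.posSemidef
  set H := R + Bᵀ * P * B with hHdef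
  set y := Bᵀ *ᵥ (P *ᵥ (A *ᵥ x)) with hy
  -- The minimizing control is `-h`; the square is completed around it.
  set h := H⁻¹ *ᵥ y with hh
  have hHh : H *ᵥ h = y := by rw [hh, mulVec_mulVec, mul_nonsing_inv _ hdet, one_mulVec]
  have hg : u - ricGain R A B P *ᵥ x = u + h := by
    simp only [ricGain, neg_mulVec, sub_neg_eq_add, ← mulVec_mulVec, hh, hy, ← hHdef]
  have h1 : qf (Aᵀ * P * B * H⁻¹ * Bᵀ * P * A) x = y ⬝ᵥ h := by
    simp only [qf, ← mulVec_mulVec]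
    rw [dotProduct_transpose_mulVec, dotProduct_mulVec_comm_of_symm hPs, ← dotProduct_transpose_mulVec,
      dotProduct_comm]
  rw [hg, qf_add_vec hHs, hHh, ricMap, qf_sub_matrix, qf_add_matrix, ← hHdef, h1,
    qf_add_vec hPs, qf_transpose_mul_mul]
  have h2 : qf H h = y ⬝ᵥ h := by rw [qf, hHh, dotProduct_comm]
  have h3 : qf H u = qf R u + qf P (B *ᵥ u) := by
    rw [hHdef, qf_add_matrix, qf_transpose_mul_mul]
  have h4 : (A *ᵥ x) ⬝ᵥ P *ᵥ B *ᵥ u = u ⬝ᵥ y := by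
    rw [hy, dotProduct_transpose_mulVec, dotProduct_mulVec_comm_of_symm hPs]
  rw [h2, h3, h4]
  simp only [cost, qf]
  ring

lemma qf_ricMap_eq (hR : R.PosDef) (hP : P.PosSemidef) (x : Fin n → ℝ) :
    qf (ricMap Q R A B P) x = cost Q R x (ricGain R A B P *ᵥ x) +
      qf P ((A + B * ricGain R A B P) *ᵥ x) := by
  have := cost_add_qf_eq (Q := Q) (A := A) (B := B) hR hP x (ricGain R A B P *ᵥ x)
  simp only [sub_self, qf_zero_vec, add_zero] at this
  rw [← this, add_mulVec, mulVec_mulVec]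

lemma qf_ricMap_le (hR : R.PosDef) (hP : P.PosSemidef) (x : Fin n → ℝ) (u : Fin m → ℝ) :
    qf (ricMap Q R A B P) x ≤ cost Q R x u + qf P (A *ᵥ x + B *ᵥ u) := by
  rw [cost_add_qf_eq hR hP]
  linarith [qf_nonneg (posDef_add_transpose_mul_mul (B := B) hR hP).posSemidef
    (u - ricGain R A B P *ᵥ x)]

lemma cost_nonneg (hQ : Q.PosDef) (hR : R.PosDef) (x : Fin n → ℝ) (u : Fin m → ℝ) :
    0 ≤ cost Q R x u :=
  add_nonneg (qf_nonneg hQ.posSemidef x) (qf_nonneg hR.posSemidef u)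

lemma qf_le_cost (hR : R.PosDef) (x : Fin n → ℝ) (u : Fin m → ℝ) :
    qf Q x ≤ cost Q R x u :=
  le_add_of_nonneg_right (qf_nonneg hR.posSemidef u)

lemma posSemidef_ricMap (hQ : Q.PosDef) (hR : R.PosDef) (hP : P.PosSemidef) :
    (ricMap Q R A B P).PosSemidef := by
  have hPs := transpose_eq_of_posSemidef hP
  have hQs := transpose_eq_of_posSemidef hQ.posSemidef
  have hHs := transpose_eq_of_posSemidef (posDef_add_transpose_mul_mul (B := B) hR hP).posSemidef
  refine posSemidef_of_qf ?_ fun x => ?_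
  · rw [ricMap, transpose_sub, transpose_add, hQs]
    simp only [transpose_mul, transpose_transpose, hPs, transpose_nonsing_inv, hHs]
    simp only [Matrix.mul_assoc]
  · rw [qf_ricMap_eq hR hP]
    exact add_nonneg (cost_nonneg hQ hR _ _) (qf_nonneg hP _)

/-- The Riccati operator is a minimum over controls, attained for `P'` at its own gain; that gain is
used as a competitor for `P`. -/
lemma qf_ricMap_mono (hR : R.PosDef) (hP : P.PosSemidef) (hP' : P'.PosSemidef)
    (h : ∀ x, qf P x ≤ qf P' x) (x : Fin n → ℝ) :
    qf (ricMap Q R A B P) x ≤ qf (ricMap Q R A B P') x := by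
  rw [qf_ricMap_eq hR hP' x]
  refine (qf_ricMap_le hR hP x (ricGain R A B P' *ᵥ x)).trans ?_
  rw [add_mulVec, ← mulVec_mulVec]
  gcongr
  exact h _

/-- Value iteration for the linear quadratic problem, started at `0`. -/
noncomputable def valIter (Q : Matrix (Fin n) (Fin n) ℝ) (R : Matrix (Fin m) (Fin m) ℝ)
    (A : Matrix (Fin n) (Fin n) ℝ) (B : Matrix (Fin n) (Fin m) ℝ) : ℕ → Matrix (Fin n) (Fin n) ℝ
  | 0 => 0
  | k + 1 => ricMap Q R A B (valIter Q R A B k)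

lemma posSemidef_valIter (hQ : Q.PosDef) (hR : R.PosDef) (k : ℕ) :
    (valIter Q R A B k).PosSemidef := by
  induction k with
  | zero => exact .zero
  | succ k ih => exact posSemidef_ricMap hQ hR ih

lemma monotone_qf_valIter (hQ : Q.PosDef) (hR : R.PosDef) (x : Fin n → ℝ) :
    Monotone fun k => qf (valIter Q R A B k) x := by
  refine monotone_nat_of_le_succ fun k => ?_
  induction k generalizing x with
  | zero => simpa [valIter] using qf_nonneg (posSemidef_valIter (A := A) (B := B) hQ hR 1) x
  | succ k ih =>
    exact qf_ricMap_mono hR (posSemidef_valIter hQ hR _) (posSemidef_valIter hQ hR _) ih x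

lemma qf_valIter_le_of_fixed (hQ : Q.PosDef) (hR : R.PosDef) (hP : P.PosSemidef)
    (hfix : P = ricMap Q R A B P) (k : ℕ) (x : Fin n → ℝ) :
    qf (valIter Q R A B k) x ≤ qf P x := by
  induction k generalizing x with
  | zero => simpa [valIter] using qf_nonneg hP x
  | succ k ih =>
    rw [hfix]
    exact qf_ricMap_mono hR (posSemidef_valIter hQ hR _) hP ih x

lemma continuousAt_matrix_inv {ι : Type*} [Fintype ι] [DecidableEq ι] {H : Matrix ι ι ℝ}
    (hH : IsUnit H.det) : ContinuousAt (fun M : Matrix ι ι ℝ => M⁻¹) H := by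
  simp only [Matrix.inv_def, Ring.inverse_eq_inv']
  have h1 : ContinuousAt (fun M : Matrix ι ι ℝ => M.det) H :=
    (continuous_id.matrix_det).continuousAt
  exact (h1.inv₀ hH.ne_zero).smul (continuous_id.matrix_adjugate).continuousAt

/-- Continuity holds only at semidefinite points, where `R + BᵀPB` is invertible; this suffices
because limits of value iteration are semidefinite. -/
lemma continuousAt_ricMap (hR : R.PosDef) (hP : P.PosSemidef) :
    ContinuousAt (ricMap Q R A B) P := by
  have hdet : IsUnit (R + Bᵀ * P * B).det :=
    (Matrix.isUnit_iff_isUnit_det _).1 (posDef_add_transpose_mul_mul hR hP).isUnit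
  have h1 : ContinuousAt (fun P => (R + Bᵀ * P * B)⁻¹) P :=
    ContinuousAt.comp (f := fun P => R + Bᵀ * P * B) (continuousAt_matrix_inv hdet)
      (by fun_prop)
  unfold ricMap
  have hi : ContinuousAt (fun P : Matrix (Fin n) (Fin n) ℝ => P) P := continuousAt_id
  have hc {k l : ℕ} (M : Matrix (Fin k) (Fin l) ℝ) :
    ContinuousAt (fun _ : Matrix (Fin n) (Fin n) ℝ => M) P := continuousAt_const
  have hmul {k l j : ℕ} {f : Matrix (Fin n) (Fin n) ℝ → Matrix (Fin k) (Fin l) ℝ}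
      {g : Matrix (Fin n) (Fin n) ℝ → Matrix (Fin l) (Fin j) ℝ}
      (hf : ContinuousAt f P) (hg : ContinuousAt g P) : ContinuousAt (fun P => f P * g P) P :=
    ContinuousAt.comp (g := fun p : Matrix (Fin k) (Fin l) ℝ × Matrix (Fin l) (Fin j) ℝ => p.1 * p.2)
      (f := fun P => (f P, g P)) (by fun_prop) (hf.prodMk hg)
  exact ((hc _).add (hmul (hmul (hc _) hi) (hc _))).sub
    (hmul (hmul (hmul (hmul (hmul (hmul (hc _) hi) (hc _)) h1) (hc _)) hi) (hc _))

/-- If value iteration is bounded, it converges to a fixed point. -/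
lemma exists_tendsto_valIter (hQ : Q.PosDef) (hR : R.PosDef)
    (hb : ∀ x, ∃ c, ∀ k, qf (valIter Q R A B k) x ≤ c) :
    ∃ S, Tendsto (valIter Q R A B) atTop (nhds S) := by
  choose c hc using hb
  have hlim : ∀ x, Tendsto (fun k => qf (valIter Q R A B k) x) atTop
      (nhds (⨆ k, qf (valIter Q R A B k) x)) := fun x =>
    tendsto_atTop_ciSup (monotone_qf_valIter hQ hR x) ⟨c x, by rintro _ ⟨k, rfl⟩; exact hc x k⟩
  set L : (Fin n → ℝ) → ℝ := fun x => ⨆ k, qf (valIter Q R A B k) x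
  refine ⟨Matrix.of fun i j => (L (Pi.single i 1 + Pi.single j 1) - L (Pi.single i 1)
      - L (Pi.single j 1)) / 2, ?_⟩
  refine tendsto_pi_nhds.2 fun i => tendsto_pi_nhds.2 fun j => ?_
  have h : ∀ k, valIter Q R A B k i j = _ := fun k =>
    apply_eq_qf (transpose_eq_of_posSemidef (posSemidef_valIter hQ hR k)) i j
  simp only [h]
  exact (((hlim _).sub (hlim _)).sub (hlim _)).div_const 2

lemma isFixed_of_tendsto_valIter (hQ : Q.PosDef) (hR : R.PosDef) {S : Matrix (Fin n) (Fin n) ℝ}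
    (h : Tendsto (valIter Q R A B) atTop (nhds S)) :
    S.PosSemidef ∧ S = ricMap Q R A B S := by
  have hS : S.PosSemidef := by
    refine posSemidef_of_qf ?_ fun x => ?_
    · have h1 : Tendsto (fun k => (valIter Q R A B k)ᵀ) atTop (nhds Sᵀ) :=
        (continuous_id.matrix_transpose.tendsto S).comp h
      have h2 : ∀ k, (valIter Q R A B k)ᵀ = valIter Q R A B k := fun k =>
        transpose_eq_of_posSemidef (posSemidef_valIter hQ hR k)
      simp only [h2] at h1
      exact tendsto_nhds_unique h1 h
    · exact ge_of_tendsto' (((continuous_qf_matrix x).tendsto S).comp h) fun k =>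
        qf_nonneg (posSemidef_valIter hQ hR k) x
  refine ⟨hS, tendsto_nhds_unique (h.comp (tendsto_add_atTop_nat 1)) ?_⟩
  exact (continuousAt_ricMap hR hS).tendsto.comp h

lemma qf_fixed_eq (hR : R.PosDef) (hP : P.PosSemidef) (hfix : P = ricMap Q R A B P)
    (x : Fin n → ℝ) : qf P x = cost Q R x (ricGain R A B P *ᵥ x) +
      qf P ((A + B * ricGain R A B P) *ᵥ x) := by
  conv_lhs => rw [hfix]
  exact qf_ricMap_eq hR hP x

/-- The closed loop of a positive semidefinite fixed point is a contraction for it. -/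
lemma exists_contraction_of_fixed (hQ : Q.PosDef) (hR : R.PosDef) (hP : P.PosSemidef)
    (hfix : P = ricMap Q R A B P) :
    ∃ c, 0 ≤ c ∧ c < 1 ∧ ∀ x, qf P ((A + B * ricGain R A B P) *ᵥ x) ≤ c * qf P x := by
  obtain ⟨q, hq, hqQ⟩ := exists_pos_mul_le_qf hQ
  -- One step lowers the form by at least the running cost, hence by q|x|². This is at least the
  -- fraction q/s of the form, because the form is at most s|x|².
  set s := ‖P‖ + q
  have hs : 0 < s := by positivity
  refine ⟨1 - q / s, ?_, by linarith [div_pos hq hs], fun x => ?_⟩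
  · rw [sub_nonneg, div_le_one hs]; exact le_add_of_nonneg_left (norm_nonneg _)
  · have h1 := qf_fixed_eq hR hP hfix x
    have h2 := (hqQ x).trans (qf_le_cost (Q := Q) hR x (ricGain R A B P *ᵥ x))
    have h3 : qf P x ≤ s * ‖WithLp.toLp 2 x‖ ^ 2 := (qf_le_norm P x).trans (by
      gcongr; exact le_add_of_nonneg_right hq.le)
    have h4 : q / s * qf P x ≤ q * ‖WithLp.toLp 2 x‖ ^ 2 := by
      rw [div_mul_eq_mul_div, div_le_iff₀ hs]; nlinarith
    linarith

/-- Positive semidefinite solutions of the Riccati equation are unique. -/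
lemma fixed_unique (hQ : Q.PosDef) (hR : R.PosDef) (hP : P.PosSemidef)
    (hfix : P = ricMap Q R A B P) (hP' : P'.PosSemidef) (hfix' : P' = ricMap Q R A B P') :
    P = P' := by
  suffices H : ∀ {P P' : Matrix (Fin n) (Fin n) ℝ}, P.PosSemidef → P = ricMap Q R A B P →
      P'.PosSemidef → P' = ricMap Q R A B P' → ∀ x, qf P x ≤ qf P' x from
    eq_of_qf_eq (transpose_eq_of_posSemidef hP) (transpose_eq_of_posSemidef hP') fun x =>
      le_antisymm (H hP hfix hP' hfix' x) (H hP' hfix' hP hfix x)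
  intro P P' hP hfix hP' hfix' x
  obtain ⟨c, hc0, hc1, hc⟩ := exists_contraction_of_fixed hQ hR hP' hfix'
  obtain ⟨q, hq, hqQ⟩ := exists_pos_mul_le_qf hQ
  set M := A + B * ricGain R A B P' with hM
  -- Under the gain of `P'` the form of `P'` equals running cost plus its next value, while that of
  -- `P` is at most this. The running cost cancels, so the gap does not shrink along the closed loop
  -- of `P'`.
  have hstep : ∀ y, qf P y - qf P' y ≤ qf P (M *ᵥ y) - qf P' (M *ᵥ y) := fun y => by
    have h1 := qf_fixed_eq hR hP' hfix' y
    have h2 := qf_ricMap_le (Q := Q) (A := A) (B := B) hR hP y (ricGain R A B P' *ᵥ y)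
    rw [← hfix, mulVec_mulVec, ← add_mulVec, ← hM] at h2
    rw [← hM] at h1
    linarith
  have hiter : ∀ k, qf P x - qf P' x ≤ qf P ((M ^ k) *ᵥ x) - qf P' ((M ^ k) *ᵥ x) := fun k => by
    induction k with
    | zero => simp
    | succ k ih => rw [pow_succ', ← mulVec_mulVec]; exact ih.trans (hstep _)
  have hdec : ∀ k, qf P' ((M ^ k) *ᵥ x) ≤ c ^ k * qf P' x := fun k => by
    induction k with
    | zero => simp
    | succ k ih =>
      rw [pow_succ' M, ← mulVec_mulVec]
      calc _ ≤ c * qf P' ((M ^ k) *ᵥ x) := hc _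
        _ ≤ c * (c ^ k * qf P' x) := by gcongr
        _ = _ := by ring
  -- `P'` dominates Q, hence q times the identity, so `P` is at most a multiple of `P'`. As `P'`
  -- decays geometrically along its closed loop, the gap is at most a null sequence.
  have hcomp : ∀ y, qf P y ≤ ‖P‖ / q * qf P' y := fun y => by
    have h1 := qf_fixed_eq hR hP' hfix' y
    have h2 := (hqQ y).trans (qf_le_cost (Q := Q) hR y (ricGain R A B P' *ᵥ y))
    have h3 := qf_nonneg hP' ((A + B * ricGain R A B P') *ᵥ y)
    refine (qf_le_norm P y).trans ?_
    rw [div_mul_eq_mul_div, le_div_iff₀ hq, mul_assoc]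
    gcongr
    linarith
  have hle : ∀ k, qf P x - qf P' x ≤ c ^ k * (‖P‖ / q * qf P' x) := fun k => by
    have h1 := hiter k
    have h2 := hcomp ((M ^ k) *ᵥ x)
    have h3 := mul_le_mul_of_nonneg_left (hdec k) (by positivity : 0 ≤ ‖P‖ / q)
    have h4 := qf_nonneg hP' ((M ^ k) *ᵥ x)
    linarith
  have := ge_of_tendsto' (((tendsto_pow_atTop_nhds_zero_of_lt_one hc0 hc1).mul_const
    (‖P‖ / q * qf P' x))) hle
  linarith

lemma isRiccati_ricS {θ : Param n m} (h : ∃ S, IsRiccati Q R θ S) :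
    IsRiccati Q R θ (ricS Q R θ) := by
  rw [ricS, dif_pos h]; exact h.choose_spec

lemma posSemidef_ricS (θ : Param n m) : (ricS Q R θ).PosSemidef := by
  by_cases h : ∃ S, IsRiccati Q R θ S
  · exact (isRiccati_ricS h).1
  · rw [ricS, dif_neg h]; exact .zero

/-- A solution bounds the monotone value iteration from above; conversely a limit of value iteration
is a solution. Convergence is a measurable condition on θ, whereas solvability is not visibly one.
-/
lemma exists_isRiccati_iff (hQ : Q.PosDef) (hR : R.PosDef) (θ : Param n m) :
    (∃ S, IsRiccati Q R θ S) ↔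
      ∃ S, Tendsto (valIter Q R (matA θ) (matB θ)) atTop (nhds S) := by
  constructor
  · rintro ⟨S, hS, hfix⟩
    exact exists_tendsto_valIter hQ hR fun x =>
      ⟨qf S x, fun k => qf_valIter_le_of_fixed hQ hR hS hfix k x⟩
  · rintro ⟨S, hS⟩
    exact ⟨S, isFixed_of_tendsto_valIter hQ hR hS⟩

lemma tendsto_valIter_ricS (hQ : Q.PosDef) (hR : R.PosDef) {θ : Param n m}
    (h : ∃ S, IsRiccati Q R θ S) :
    Tendsto (valIter Q R (matA θ) (matB θ)) atTop (nhds (ricS Q R θ)) := by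
  obtain ⟨S, hS⟩ := (exists_isRiccati_iff hQ hR θ).1 h
  have h1 := isFixed_of_tendsto_valIter hQ hR hS
  have h2 := isRiccati_ricS h
  rwa [fixed_unique hQ hR h2.1 h2.2 h1.1 h1.2]

end Riccati

/-! ### Measurability of matrix operations, of the Riccati solution and of the gain. -/

section Measurability

instance {ι κ : Type*} : MeasurableSpace (Matrix ι κ ℝ) := MeasurableSpace.pi

instance {ι κ : Type*} [Finite ι] [Finite κ] : BorelSpace (Matrix ι κ ℝ) :=
  inferInstanceAs (BorelSpace (ι → κ → ℝ))

instance {ι κ : Type*} [Finite ι] [Finite κ] : SecondCountableTopology (Matrix ι κ ℝ) :=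
  inferInstanceAs (SecondCountableTopology (ι → κ → ℝ))

instance {ι κ : Type*} [Finite ι] [Finite κ] : PolishSpace (Matrix ι κ ℝ) :=
  inferInstanceAs (PolishSpace (ι → κ → ℝ))

variable {X : Type*} [MeasurableSpace X] {ι κ l : Type*}

lemma measurable_matrix_iff {f : X → Matrix ι κ ℝ} :
    Measurable f ↔ ∀ i j, Measurable fun x => f x i j :=
  measurable_pi_iff.trans (forall_congr' fun _ => measurable_pi_iff)

variable [Fintype ι] [Fintype κ] [Fintype l]

lemma measurable_matrix_mul {f : X → Matrix ι κ ℝ} {g : X → Matrix κ l ℝ}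
    (hf : Measurable f) (hg : Measurable g) : Measurable fun x => f x * g x :=
  (show Continuous fun p : Matrix ι κ ℝ × Matrix κ l ℝ => p.1 * p.2 by fun_prop).measurable.comp
    (hf.prodMk hg)

lemma measurable_matrix_add {f g : X → Matrix ι κ ℝ}
    (hf : Measurable f) (hg : Measurable g) : Measurable fun x => f x + g x :=
  (show Continuous fun p : Matrix ι κ ℝ × Matrix ι κ ℝ => p.1 + p.2 by fun_prop).measurable.comp
    (hf.prodMk hg)

lemma measurable_matrix_sub {f g : X → Matrix ι κ ℝ}
    (hf : Measurable f) (hg : Measurable g) : Measurable fun x => f x - g x :=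
  (show Continuous fun p : Matrix ι κ ℝ × Matrix ι κ ℝ => p.1 - p.2 by fun_prop).measurable.comp
    (hf.prodMk hg)

lemma measurable_matrix_neg {f : X → Matrix ι κ ℝ}
    (hf : Measurable f) : Measurable fun x => - f x :=
  (show Continuous fun p : Matrix ι κ ℝ => -p by fun_prop).measurable.comp hf

lemma measurable_matrix_transpose {f : X → Matrix ι κ ℝ}
    (hf : Measurable f) : Measurable fun x => (f x)ᵀ :=
  (show Continuous fun p : Matrix ι κ ℝ => pᵀ by fun_prop).measurable.comp hf

lemma measurable_matrix_det [DecidableEq ι] {f : X → Matrix ι ι ℝ}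
    (hf : Measurable f) : Measurable fun x => (f x).det :=
  (continuous_id.matrix_det (X := Matrix ι ι ℝ)).measurable.comp hf

lemma measurable_matrix_inv [DecidableEq ι] {f : X → Matrix ι ι ℝ}
    (hf : Measurable f) : Measurable fun x => (f x)⁻¹ := by
  simp only [Matrix.inv_def, Ring.inverse_eq_inv']
  refine measurable_matrix_iff.2 fun i j => ?_
  have h := (continuous_id.matrix_adjugate (X := Matrix ι ι ℝ)).measurable.comp hf
  simp only [Matrix.smul_apply, smul_eq_mul]
  exact (measurable_matrix_det hf).inv.mul (measurable_matrix_iff.1 h i j)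

lemma measurable_mulVec {f : X → Matrix ι κ ℝ} {g : X → κ → ℝ}
    (hf : Measurable f) (hg : Measurable g) : Measurable fun x => f x *ᵥ g x :=
  (show Continuous fun p : Matrix ι κ ℝ × (κ → ℝ) => p.1 *ᵥ p.2 by fun_prop).measurable.comp
    (hf.prodMk hg)

lemma measurable_dotProduct {f g : X → ι → ℝ}
    (hf : Measurable f) (hg : Measurable g) : Measurable fun x => f x ⬝ᵥ g x :=
  (show Continuous fun p : (ι → ℝ) × (ι → ℝ) => p.1 ⬝ᵥ p.2 by fun_prop).measurable.comp
    (hf.prodMk hg)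

lemma measurable_qf {f : X → Matrix ι ι ℝ} {g : X → ι → ℝ}
    (hf : Measurable f) (hg : Measurable g) : Measurable fun x => qf (f x) (g x) :=
  measurable_dotProduct hg (measurable_mulVec hf hg)

variable {n m : ℕ} {Q : Matrix (Fin n) (Fin n) ℝ} {R : Matrix (Fin m) (Fin m) ℝ}

lemma measurable_matA : Measurable (matA : Param n m → _) :=
  measurable_matrix_iff.2 fun i j => by simp only [matA, Matrix.of_apply]; fun_prop

lemma measurable_matB : Measurable (matB : Param n m → _) :=
  measurable_matrix_iff.2 fun i j => by simp only [matB, Matrix.of_apply]; fun_prop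

lemma measurable_ricMap {A : X → Matrix (Fin n) (Fin n) ℝ} {B : X → Matrix (Fin n) (Fin m) ℝ}
    {P : X → Matrix (Fin n) (Fin n) ℝ} (hA : Measurable A) (hB : Measurable B)
    (hP : Measurable P) : Measurable fun x => ricMap Q R (A x) (B x) (P x) := by
  unfold ricMap
  have hAt := measurable_matrix_transpose hA
  have hBt := measurable_matrix_transpose hB
  have hinv := measurable_matrix_inv (measurable_matrix_add (measurable_const (a := R))
    (measurable_matrix_mul (measurable_matrix_mul hBt hP) hB))
  have := measurable_matrix_mul (measurable_matrix_mul (measurable_matrix_mul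
    (measurable_matrix_mul (measurable_matrix_mul (measurable_matrix_mul hAt hP) hB) hinv) hBt) hP) hA
  exact measurable_matrix_sub (measurable_matrix_add measurable_const
    (measurable_matrix_mul (measurable_matrix_mul hAt hP) hA)) this

lemma measurable_valIter (k : ℕ) :
    Measurable fun θ : Param n m => valIter Q R (matA θ) (matB θ) k := by
  induction k with
  | zero => exact measurable_const
  | succ k ih => exact measurable_ricMap measurable_matA measurable_matB ih

lemma measurable_ricS (hQ : Q.PosDef) (hR : R.PosDef) :
    Measurable fun θ : Param n m => ricS Q R θ := by
  -- On this set the Riccati solution is a pointwise limit of measurable functions; off it no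
  -- solution exists and `ricS` has the default value 0.
  set E := {θ : Param n m | ∃ S, Tendsto (fun k => valIter Q R (matA θ) (matB θ) k) atTop (nhds S)}
  have hE : MeasurableSet E := measurableSet_exists_tendsto measurable_valIter
  refine measurable_of_restrict_of_restrict_compl hE ?_ ?_
  · refine measurable_of_tendsto_metrizable
      (f := fun k (θ : E) => valIter Q R (matA θ.1) (matB θ.1) k)
      (fun k => (measurable_valIter k).comp measurable_subtype_coe) (tendsto_pi_nhds.2 fun θ => ?_)
    exact tendsto_valIter_ricS hQ hR ((exists_isRiccati_iff hQ hR θ.1).2 θ.2)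
  · have : (Eᶜ.domRestrict fun θ : Param n m => ricS Q R θ) = fun _ => 0 := by
      ext1 ⟨θ, hθ⟩
      have : ¬ ∃ S, IsRiccati Q R θ S := fun h => hθ ((exists_isRiccati_iff hQ hR θ).1 h)
      simp [Set.domRestrict, ricS, this]
    rw [this]; exact measurable_const

lemma measurable_gain (hQ : Q.PosDef) (hR : R.PosDef) :
    Measurable fun θ : Param n m => gain Q R θ := by
  have hA := measurable_matA (n := n) (m := m)
  have hB := measurable_matB (n := n) (m := m)
  have hBt := measurable_matrix_transpose hB
  have hS := measurable_ricS (n := n) (m := m) hQ hR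
  have hinv := measurable_matrix_inv (measurable_matrix_add (measurable_const (a := R))
    (measurable_matrix_mul (measurable_matrix_mul hBt hS) hB))
  exact measurable_matrix_neg (measurable_matrix_mul (measurable_matrix_mul
    (measurable_matrix_mul hinv hBt) hS) hA)

end Measurability

/-! ### Uniform geometric decay of powers from the spectral radius. -/

section PowerBound

/-- If `P` is annihilated by a product of factors `M - a` with `‖a‖ ≤ δ`, then `P * M ^ t` decays
like `(ε + δ) ^ t`, with a constant that depends only on the number of factors and on `‖M‖`. -/
lemma exists_norm_mul_pow_le (k : ℕ) {b δ ε : ℝ} (hb : 0 ≤ b) (hδ : 0 ≤ δ) (hε : 0 < ε) :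
    ∃ D : ℝ, 1 ≤ D ∧ ∀ {𝔸 : Type} [NormedRing 𝔸] [NormedAlgebra ℂ 𝔸] (M P : 𝔸) (l : List ℂ),
      l.length = k → ‖M‖ ≤ b → (∀ a ∈ l, ‖a‖ ≤ δ) →
      P * (l.map fun a => M - algebraMap ℂ 𝔸 a).prod = 0 →
      ∀ t : ℕ, ‖P * M ^ t‖ ≤ D * ‖P‖ * (ε + δ) ^ t := by
  induction k with
  | zero =>
    refine ⟨1, le_rfl, fun M P l hl _ _ hP t => ?_⟩
    rw [List.length_eq_zero_iff] at hl
    simp only [hl, List.map_nil, List.prod_nil, mul_one] at hP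
    simp [hP]
  | succ k ih =>
    obtain ⟨D', hD', h'⟩ := ih
    -- With D this constant, D'(b+δ) = (D-1)ε, so the recursion closes: D'(b+δ) + δD ≤ (ε+δ)D.
    refine ⟨1 + D' * (b + δ) / ε, le_add_of_nonneg_right (by positivity),
      fun M P l hl hM hla hP t => ?_⟩
    obtain ⟨a, l, rfl⟩ := List.exists_cons_of_length_eq_add_one hl
    have ha : ‖a‖ ≤ δ := hla a (by simp)
    simp only [List.map_cons, List.prod_cons, ← mul_assoc] at hP
    have h1 := h' M _ l (by simpa using hl) hM (fun c hc => hla c (by simp [hc])) hP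
    have hsm : P * algebraMap ℂ _ a = a • P := by
      rw [← Algebra.commutes, ← Algebra.smul_def]
    have h2 : ‖P * (M - algebraMap ℂ _ a)‖ ≤ ‖P‖ * (b + δ) := by
      rw [mul_sub, hsm]
      calc _ ≤ ‖P * M‖ + ‖a • P‖ := norm_sub_le _ _
        _ ≤ ‖P‖ * ‖M‖ + ‖a‖ * ‖P‖ := add_le_add (norm_mul_le _ _) (norm_smul_le _ _)
        _ ≤ ‖P‖ * b + δ * ‖P‖ := by gcongr
        _ = _ := by ring
    induction t with
    | zero =>
      simp only [pow_zero, mul_one]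
      exact le_mul_of_one_le_left (norm_nonneg _) (le_add_of_nonneg_right (by positivity))
    | succ t iht =>
      -- One factor is peeled off: `P * (M - a)` is annihilated by one factor fewer, and the
      -- remainder is a times the bound for exponent t.
      have h3 : P * M ^ (t + 1) = P * (M - algebraMap ℂ _ a) * M ^ t + a • (P * M ^ t) := by
        rw [mul_sub, hsm, sub_mul, pow_succ', ← mul_assoc, smul_mul_assoc]; abel
      have h4 : D' * (b + δ) = (D' * (b + δ) / ε) * ε := by field_simp
      calc ‖P * M ^ (t + 1)‖ ≤ ‖P * (M - algebraMap ℂ _ a) * M ^ t‖ + ‖a • (P * M ^ t)‖ := by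
            rw [h3]; exact norm_add_le _ _
        _ ≤ D' * ‖P * (M - algebraMap ℂ _ a)‖ * (ε + δ) ^ t + ‖a‖ * ‖P * M ^ t‖ :=
            add_le_add (h1 t) (norm_smul_le _ _)
        _ ≤ D' * (‖P‖ * (b + δ)) * (ε + δ) ^ t
            + δ * ((1 + D' * (b + δ) / ε) * ‖P‖ * (ε + δ) ^ t) := by gcongr
        _ = ((D' * (b + δ) / ε) * ε + δ * (1 + D' * (b + δ) / ε)) * ‖P‖ * (ε + δ) ^ t := by
            rw [← h4]; ring
        _ ≤ ((1 + D' * (b + δ) / ε) * (ε + δ)) * ‖P‖ * (ε + δ) ^ t := by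
            gcongr; nlinarith
        _ = _ := by ring

variable {n m : ℕ}

lemma norm_le_norm_map_ofReal (M : Matrix (Fin n) (Fin n) ℝ) :
    ‖M‖ ≤ ‖M.map Complex.ofReal‖ := by
  have hnorm : ∀ y : Fin n → ℝ, ‖WithLp.toLp 2 (fun i => (y i : ℂ))‖ = ‖WithLp.toLp 2 y‖ := by
    intro y; simp [EuclideanSpace.norm_eq]
  rw [Matrix.l2_opNorm_def]
  refine ContinuousLinearMap.opNorm_le_bound _ (norm_nonneg _) fun x => ?_
  change ‖WithLp.toLp 2 (M *ᵥ x.ofLp)‖ ≤ _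
  have h := Matrix.l2_opNorm_mulVec (M.map Complex.ofReal) (WithLp.toLp 2 fun i => (x.ofLp i : ℂ))
  change ‖WithLp.toLp 2 _‖ ≤ _ at h
  have hmap : (M.map Complex.ofReal) *ᵥ (fun i => (x.ofLp i : ℂ))
      = fun i => ((M *ᵥ x.ofLp) i : ℂ) := by
    ext i; simp [mulVec, dotProduct]
  change ‖WithLp.toLp 2 ((M.map Complex.ofReal) *ᵥ (fun i => (x.ofLp i : ℂ)))‖ ≤ _ at h
  rw [hmap, hnorm, hnorm] at h
  exact h

lemma exists_norm_map_ofReal_le (n : ℕ) :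
    ∃ c : ℝ, 0 ≤ c ∧ ∀ M : Matrix (Fin n) (Fin n) ℝ, ‖M.map Complex.ofReal‖ ≤ c * ‖M‖ := by
  let f : Matrix (Fin n) (Fin n) ℝ →ₗ[ℝ] Matrix (Fin n) (Fin n) ℂ :=
    (Complex.ofRealAm.toLinearMap).mapMatrix
  exact ⟨‖f.toContinuousLinearMap‖, ContinuousLinearMap.opNorm_nonneg _, fun M => f.toContinuousLinearMap.le_opNorm M⟩

/-- Matrices of bounded norm with spectral radius at most `δ` have uniformly geometrically
decaying powers. -/
lemma exists_uniform_power_bound (n : ℕ) {b δ ε : ℝ} (hb : 0 ≤ b) (hδ : 0 ≤ δ) (hε : 0 < ε) :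
    ∃ D : ℝ, 1 ≤ D ∧ ∀ M : Matrix (Fin n) (Fin n) ℝ, ‖M‖ ≤ b →
      spectralRadius ℂ (M.map Complex.ofReal) ≤ ENNReal.ofReal δ →
      ∀ t : ℕ, ‖M ^ t‖ ≤ D * (ε + δ) ^ t := by
  obtain ⟨c, hc, hcM⟩ := exists_norm_map_ofReal_le n
  obtain ⟨D, hD, h⟩ := exists_norm_mul_pow_le n (mul_nonneg hc hb) hδ hε
  refine ⟨D * (1 + ‖(1 : Matrix (Fin n) (Fin n) ℂ)‖),
    one_le_mul_of_one_le_of_one_le hD (le_add_of_nonneg_right (norm_nonneg _)),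
    fun M hM hsp t => ?_⟩
  set M' := M.map Complex.ofReal with hM'
  have hcard : M'.charpoly.roots.card = n := by
    rw [← (IsAlgClosed.splits _).natDegree_eq_card_roots]
    simp
  have hmem : ∀ a ∈ M'.charpoly.roots.toList, ‖a‖ ≤ δ := fun a ha => by
    rw [Multiset.mem_toList, Polynomial.mem_roots (Matrix.charpoly_monic _).ne_zero] at ha
    have h1 : a ∈ spectrum ℂ M' := Matrix.mem_spectrum_iff_isRoot_charpoly.2 ha
    have h2 : (‖a‖₊ : ℝ≥0∞) ≤ ENNReal.ofReal δ :=
      (le_iSup₂ (f := fun k (_ : k ∈ spectrum ℂ M') => (‖k‖₊ : ℝ≥0∞)) a h1).trans hsp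
    have h3 := ENNReal.toReal_mono ENNReal.ofReal_ne_top h2
    rwa [ENNReal.toReal_ofReal hδ, ENNReal.coe_toReal, coe_nnnorm] at h3
  -- Cayley-Hamilton over ℂ, with the characteristic polynomial split into the n factors belonging
  -- to its roots.
  have hprod : (1 : Matrix (Fin n) (Fin n) ℂ) *
      (M'.charpoly.roots.toList.map fun a => M' - algebraMap ℂ _ a).prod = 0 := by
    have h1 := Matrix.aeval_self_charpoly M'
    rw [(IsAlgClosed.splits M'.charpoly).eq_prod_roots_of_monic (Matrix.charpoly_monic _),
      ← Multiset.coe_toList M'.charpoly.roots, Multiset.map_coe, Multiset.prod_coe,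
      map_list_prod, List.map_map] at h1
    rw [one_mul, ← h1]
    congr 1
    refine List.map_congr_left fun a _ => ?_
    simp
  have h1 := h M' 1 M'.charpoly.roots.toList (by rw [Multiset.length_toList, hcard])
    ((hcM M).trans (by gcongr)) hmem hprod t
  rw [one_mul] at h1
  have h2 : (M ^ t).map Complex.ofReal = M' ^ t := by
    exact map_pow (Complex.ofRealHom.mapMatrix) M t
  have h3 := norm_le_norm_map_ofReal (M ^ t)
  rw [h2] at h3
  refine h3.trans (h1.trans ?_)
  gcongr
  exact le_add_of_nonneg_left zero_le_one

end PowerBound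

/-! ### Value iteration of a system with a stabilizing gain. -/

section Stabilizable

variable {n m : ℕ} {Q : Matrix (Fin n) (Fin n) ℝ} {R : Matrix (Fin m) (Fin m) ℝ}
  {A : Matrix (Fin n) (Fin n) ℝ} {B : Matrix (Fin n) (Fin m) ℝ}

/-- Value iteration minimizes the k-step cost, so every fixed feedback `K` is a competitor. -/
lemma qf_valIter_le_sum (hQ : Q.PosDef) (hR : R.PosDef) (K : Matrix (Fin m) (Fin n) ℝ) (k : ℕ)
    (x : Fin n → ℝ) : qf (valIter Q R A B k) x ≤
      ∑ j ∈ Finset.range k, cost Q R (((A + B * K) ^ j) *ᵥ x) (K *ᵥ (((A + B * K) ^ j) *ᵥ x)) := by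
  induction k generalizing x with
  | zero => simp [valIter]
  | succ k ih =>
    rw [Finset.sum_range_succ']
    have h := qf_ricMap_le (Q := Q) (A := A) (B := B) hR
      (posSemidef_valIter (A := A) (B := B) hQ hR k) x (K *ᵥ x)
    rw [mulVec_mulVec, ← add_mulVec] at h
    refine h.trans ?_
    have h1 := ih ((A + B * K) *ᵥ x)
    simp only [mulVec_mulVec, ← pow_succ] at h1 ⊢
    simp only [pow_zero, Matrix.mul_one, one_mulVec] at h1 ⊢
    linarith

lemma cost_mulVec_le (K : Matrix (Fin m) (Fin n) ℝ) (x : Fin n → ℝ) :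
    cost Q R x (K *ᵥ x) ≤ (‖Q‖ + ‖R‖ * ‖K‖ ^ 2) * ‖WithLp.toLp 2 x‖ ^ 2 := by
  have h1 := qf_le_norm Q x
  have h2 := qf_le_norm R (K *ᵥ x)
  have h3 : ‖WithLp.toLp 2 (K *ᵥ x)‖ ^ 2 ≤ (‖K‖ * ‖WithLp.toLp 2 x‖) ^ 2 := by
    gcongr; exact norm_toLp_mulVec_le K x
  have h4 := mul_le_mul_of_nonneg_left h3 (norm_nonneg R)
  change qf Q x + qf R (K *ᵥ x) ≤ _
  nlinarith

lemma qf_valIter_le_of_powerBound (hQ : Q.PosDef) (hR : R.PosDef) {K : Matrix (Fin m) (Fin n) ℝ}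
    {D r : ℝ} (hr0 : 0 ≤ r) (hr1 : r < 1)
    (h : ∀ t : ℕ, ‖(A + B * K) ^ t‖ ≤ D * r ^ t) (k : ℕ) (x : Fin n → ℝ) :
    qf (valIter Q R A B k) x ≤
      (‖Q‖ + ‖R‖ * ‖K‖ ^ 2) * D ^ 2 * (1 - r)⁻¹ * ‖WithLp.toLp 2 x‖ ^ 2 := by
  refine (qf_valIter_le_sum hQ hR K k x).trans ?_
  set X := ‖WithLp.toLp 2 x‖
  set C := ‖Q‖ + ‖R‖ * ‖K‖ ^ 2
  have hC : 0 ≤ C := by positivity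
  have hterm : ∀ j, cost Q R (((A + B * K) ^ j) *ᵥ x) (K *ᵥ (((A + B * K) ^ j) *ᵥ x)) ≤
      C * D ^ 2 * X ^ 2 * r ^ j := fun j => by
    refine (cost_mulVec_le K _).trans ?_
    have h1 : ‖WithLp.toLp 2 (((A + B * K) ^ j) *ᵥ x)‖ ≤ D * r ^ j * X :=
      (norm_toLp_mulVec_le _ x).trans (by gcongr; exact h j)
    have h2 : ‖WithLp.toLp 2 (((A + B * K) ^ j) *ᵥ x)‖ ^ 2 ≤ (D * r ^ j * X) ^ 2 := by gcongr
    have h3 : (r ^ j) ^ 2 ≤ r ^ j := by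
      have : r ^ j ≤ 1 := pow_le_one₀ hr0 hr1.le
      have : 0 ≤ r ^ j := by positivity
      nlinarith
    calc _ ≤ C * (D * r ^ j * X) ^ 2 := by gcongr
      _ = C * D ^ 2 * X ^ 2 * (r ^ j) ^ 2 := by ring
      _ ≤ _ := by gcongr
  calc _ ≤ ∑ j ∈ Finset.range k, C * D ^ 2 * X ^ 2 * r ^ j := Finset.sum_le_sum fun j _ => hterm j
    _ = C * D ^ 2 * X ^ 2 * ∑ j ∈ Finset.range k, r ^ j := by rw [Finset.mul_sum]
    _ ≤ C * D ^ 2 * X ^ 2 * (1 - r)⁻¹ := by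
      gcongr
      rw [← tsum_geometric_of_lt_one hr0 hr1]
      exact (summable_geometric_of_lt_one hr0 hr1).sum_le_tsum _ fun _ _ => by positivity
    _ = _ := by ring

end Stabilizable

/-! ### Uniform bounds over the support of the prior, and part (a). -/

namespace Problem

variable {n m : ℕ} (pb : Problem n m)

lemma exists_norm_matA_matB_le :
    ∃ b, 0 ≤ b ∧ ∀ θ ∈ pb.supp, ‖matA θ‖ ≤ b ∧ ‖matB θ‖ ≤ b := by
  have hA : Continuous (matA : Param n m → _) := by
    refine continuous_matrix fun i j => ?_
    simp only [matA, Matrix.of_apply]; fun_prop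
  have hB : Continuous (matB : Param n m → _) := by
    refine continuous_matrix fun i j => ?_
    simp only [matB, Matrix.of_apply]; fun_prop
  obtain ⟨a, ha⟩ := (pb.isCompact_supp.image hA.norm).bddAbove
  obtain ⟨b, hb⟩ := (pb.isCompact_supp.image hB.norm).bddAbove
  exact ⟨max 0 (max a b), le_max_left _ _, fun θ hθ =>
    ⟨(ha ⟨θ, hθ, rfl⟩).trans ((le_max_left _ _).trans (le_max_right _ _)),
      (hb ⟨θ, hθ, rfl⟩).trans ((le_max_right _ _).trans (le_max_right _ _))⟩⟩

lemma supp_nonempty : pb.supp.Nonempty := by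
  by_contra h
  rw [Set.not_nonempty_iff_eq_empty] at h
  exact pb.mass_ne_zero (by simp [h])

variable {pb} {δ : ℝ}

lemma norm_closedLoop_le {θ φ : Param n m} {b g : ℝ} (hb : 0 ≤ b) (hA : ‖matA θ‖ ≤ b)
    (hB : ‖matB θ‖ ≤ b) (hg : ‖gain pb.Q pb.R φ‖ ≤ g) : ‖pb.closedLoop θ φ‖ ≤ b + b * g := by
  refine (norm_add_le _ _).trans (add_le_add hA ((Matrix.l2_opNorm_mul _ _).trans ?_))
  gcongr

/-- A single gain `gain φ`, with φ chosen once in the support, stabilizes every θ in the support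
with a common decay rate. Its cost therefore bounds value iteration uniformly, without any prior
bound on the other gains. -/
lemma exists_qf_valIter_le (hδ : 0 < δ) (hδ1 : δ < 1) (h : pb.SpectralRadiusLE δ) :
    ∃ C, 0 ≤ C ∧ ∀ θ ∈ pb.supp, ∀ k x, qf (valIter pb.Q pb.R (matA θ) (matB θ) k) x ≤
      C * ‖WithLp.toLp 2 x‖ ^ 2 := by
  obtain ⟨b, hb, hAB⟩ := pb.exists_norm_matA_matB_le
  obtain ⟨φ, hφ⟩ := pb.supp_nonempty
  set K := gain pb.Q pb.R φ with hK
  obtain ⟨D, hD, hpow⟩ := exists_uniform_power_bound n (b := b + b * ‖K‖) (δ := δ)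
    (ε := (1 - δ) / 2) (by positivity) hδ.le (by linarith)
  have hr1 : (1 - δ) / 2 + δ < 1 := by linarith
  refine ⟨(‖pb.Q‖ + ‖pb.R‖ * ‖K‖ ^ 2) * D ^ 2 * (1 - ((1 - δ) / 2 + δ))⁻¹, ?_,
    fun θ hθ k x => ?_⟩
  · have : 0 ≤ (1 - ((1 - δ) / 2 + δ))⁻¹ := inv_nonneg.2 (by linarith)
    positivity
  · refine qf_valIter_le_of_powerBound pb.posDef_Q pb.posDef_R (by linarith) hr1
      (fun t => ?_) k x
    exact hpow _ (norm_closedLoop_le hb (hAB θ hθ).1 (hAB θ hθ).2 le_rfl) (h θ hθ φ hφ) t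

lemma exists_isRiccati (hδ : 0 < δ) (hδ1 : δ < 1) (h : pb.SpectralRadiusLE δ) {θ : Param n m}
    (hθ : θ ∈ pb.supp) : ∃ S, IsRiccati pb.Q pb.R θ S := by
  obtain ⟨C, -, hC⟩ := exists_qf_valIter_le hδ hδ1 h
  exact (exists_isRiccati_iff pb.posDef_Q pb.posDef_R θ).2
    (exists_tendsto_valIter pb.posDef_Q pb.posDef_R fun x => ⟨_, fun k => hC θ hθ k x⟩)

lemma bddAbove_norm_ricS (hδ : 0 < δ) (hδ1 : δ < 1) (h : pb.SpectralRadiusLE δ) :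
    BddAbove ((fun φ => ‖ricS pb.Q pb.R φ‖) '' pb.supp) := by
  obtain ⟨C, hC0, hC⟩ := exists_qf_valIter_le hδ hδ1 h
  refine ⟨C, ?_⟩
  rintro _ ⟨θ, hθ, rfl⟩
  refine norm_le_of_qf_le (posSemidef_ricS θ) hC0 fun x => ?_
  exact le_of_tendsto' (((continuous_qf_matrix x).tendsto _).comp
    (tendsto_valIter_ricS pb.posDef_Q pb.posDef_R (exists_isRiccati hδ hδ1 h hθ)))
    fun k => hC θ hθ k x

/-- The Bellman equation of the Riccati solution. -/
lemma qf_ricS_eq (hδ : 0 < δ) (hδ1 : δ < 1) (h : pb.SpectralRadiusLE δ) {θ : Param n m}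
    (hθ : θ ∈ pb.supp) (x : Fin n → ℝ) :
    qf (ricS pb.Q pb.R θ) x = cost pb.Q pb.R x (gain pb.Q pb.R θ *ᵥ x) +
      qf (ricS pb.Q pb.R θ) (pb.closedLoop θ θ *ᵥ x) := by
  have hS := isRiccati_ricS (exists_isRiccati hδ hδ1 h hθ)
  exact qf_fixed_eq pb.posDef_R hS.1 hS.2 x

/-- The control cost of the optimal action is part of the optimal cost: (Gx)ᵀR(Gx) ≤ xᵀSx, where R
is bounded below and S is uniformly bounded above. -/
lemma bddAbove_norm_gain (hδ : 0 < δ) (hδ1 : δ < 1) (h : pb.SpectralRadiusLE δ) :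
    BddAbove ((fun φ => ‖gain pb.Q pb.R φ‖) '' pb.supp) := by
  obtain ⟨C, hC⟩ := bddAbove_norm_ricS hδ hδ1 h
  obtain ⟨c, hc, hcR⟩ := exists_pos_mul_le_qf pb.posDef_R
  refine ⟨√(C / c), ?_⟩
  rintro _ ⟨θ, hθ, rfl⟩
  simp only
  rw [Matrix.l2_opNorm_def]
  refine ContinuousLinearMap.opNorm_le_bound _ (Real.sqrt_nonneg _) fun x => ?_
  change ‖WithLp.toLp 2 (gain pb.Q pb.R θ *ᵥ x.ofLp)‖ ≤ _
  set y := gain pb.Q pb.R θ *ᵥ x.ofLp with hy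
  have h1 := qf_ricS_eq hδ hδ1 h hθ x.ofLp
  have h2 := qf_nonneg (posSemidef_ricS (Q := pb.Q) (R := pb.R) θ) (pb.closedLoop θ θ *ᵥ x.ofLp)
  have h3 := hcR y
  have h4 : 0 ≤ qf pb.Q x.ofLp := qf_nonneg pb.posDef_Q.posSemidef _
  have h5 := qf_le_norm (ricS pb.Q pb.R θ) x.ofLp
  have h6 : ‖ricS pb.Q pb.R θ‖ ≤ C := hC ⟨θ, hθ, rfl⟩
  have h7 : cost pb.Q pb.R x.ofLp y = qf pb.Q x.ofLp + qf pb.R y := rfl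
  rw [← hy, h7] at h1
  have h8 : ‖ricS pb.Q pb.R θ‖ * ‖WithLp.toLp 2 x.ofLp‖ ^ 2 ≤ C * ‖x‖ ^ 2 := by
    rw [WithLp.toLp_ofLp]; gcongr
  have hC0 : 0 ≤ C := (norm_nonneg _).trans h6
  have h9 : ‖WithLp.toLp 2 y‖ ^ 2 ≤ C / c * ‖x‖ ^ 2 := by
    rw [div_mul_eq_mul_div, le_div_iff₀ hc]; linarith
  refine abs_le_of_sq_le_sq' ?_ (by positivity) |>.2
  rw [mul_pow, Real.sq_sqrt (by positivity)]
  exact h9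

/-- Assumption on the spectral radius gives uniform geometric decay of the closed loops. -/
theorem exists_powerBound {ε : ℝ} (hδ : 0 < δ) (hδ1 : δ < 1) (h : pb.SpectralRadiusLE δ)
    (hε : 0 < ε) : ∃ α : ℝ, 1 ≤ α ∧ pb.PowerBound (ε + δ) α := by
  obtain ⟨b, hb, hAB⟩ := pb.exists_norm_matA_matB_le
  obtain ⟨g, hg⟩ := bddAbove_norm_gain hδ hδ1 h
  have hg0 : 0 ≤ g := by
    obtain ⟨φ, hφ⟩ := pb.supp_nonempty
    exact (norm_nonneg _).trans (hg ⟨φ, hφ, rfl⟩)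
  obtain ⟨D, hD, hpow⟩ := exists_uniform_power_bound n (b := b + b * g) (δ := δ)
    (ε := ε) (by positivity) hδ.le hε
  exact ⟨D, hD, fun θ hθ φ hφ t _ => hpow _
    (norm_closedLoop_le hb (hAB θ hθ).1 (hAB θ hθ).2 (hg ⟨φ, hφ, rfl⟩)) (h θ hθ φ hφ) t⟩

end Problem

/-! ### Second moments of the noise. -/

section Noise

variable {n : ℕ} {σ : ℝ}

lemma memLp_eval_noise (i : Fin n) : MemLp (fun y : Fin n → ℝ => y i) 2 (noise n σ) :=
  MemLp.comp_measurePreserving (g := fun y : ℝ => y)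
    (memLp_id_gaussianReal (μ := 0) (v := Real.toNNReal (σ ^ 2)) 2)
    (measurePreserving_eval (fun _ : Fin n => gaussianReal 0 (Real.toNNReal (σ ^ 2))) i)

lemma integrable_eval_noise (i : Fin n) : Integrable (fun y : Fin n → ℝ => y i) (noise n σ) :=
  (memLp_eval_noise i).integrable one_le_two

lemma integral_eval_noise (i : Fin n) : ∫ y, y i ∂(noise n σ) = 0 := by
  have h2 := integral_map (μ := noise n σ) (φ := fun y => y i) (measurable_pi_apply i).aemeasurable
    (f := fun x : ℝ => x) measurable_id.aestronglyMeasurable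
  change _ = ∫ y, y i ∂(noise n σ) at h2
  rw [← h2]
  have h3 : (noise n σ).map (fun y => y i) = gaussianReal 0 (Real.toNNReal (σ ^ 2)) := by
    exact (measurePreserving_eval (fun _ : Fin n => gaussianReal 0 (Real.toNNReal (σ ^ 2))) i).map_eq
  rw [h3, integral_id_gaussianReal]

lemma integrable_mul_noise (i j : Fin n) :
    Integrable (fun y : Fin n → ℝ => y i * y j) (noise n σ) :=
  (memLp_eval_noise i).integrable_mul (memLp_eval_noise j)

lemma integral_mul_noise (i j : Fin n) :
    ∫ y, y i * y j ∂(noise n σ) = if i = j then σ ^ 2 else 0 := by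
  split_ifs with h
  · subst h
    have h3 : (noise n σ).map (fun y => y i) = gaussianReal 0 (Real.toNNReal (σ ^ 2)) :=
      (measurePreserving_eval (fun _ : Fin n => gaussianReal 0 (Real.toNNReal (σ ^ 2))) i).map_eq
    have h2 := integral_map (μ := noise n σ) (φ := fun y => y i) (measurable_pi_apply i).aemeasurable
      (f := fun x : ℝ => x * x) (by fun_prop)
    rw [← h2, h3]
    have h4 := variance_id_gaussianReal (μ := 0) (v := Real.toNNReal (σ ^ 2))
    rw [variance_eq_integral measurable_id.aemeasurable] at h4
    simp only [id, integral_id_gaussianReal, sub_zero] at h4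
    simp only [← sq]
    rw [h4, Real.coe_toNNReal _ (sq_nonneg _)]
  · have hind : iIndepFun (fun i (y : Fin n → ℝ) => y i) (noise n σ) :=
      iIndepFun_pi (X := fun _ x => x) fun _ => aemeasurable_id
    have := (hind.indepFun h).integral_fun_mul_eq_mul_integral
      (measurable_pi_apply i).aestronglyMeasurable (measurable_pi_apply j).aestronglyMeasurable
    rw [this, integral_eval_noise, zero_mul]

lemma qf_eq_sum {ι : Type*} [Fintype ι] (S : Matrix ι ι ℝ) (y : ι → ℝ) :
    qf S y = ∑ i, ∑ j, S i j * (y i * y j) := by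
  simp only [qf, dotProduct, mulVec, Finset.mul_sum]
  exact Finset.sum_congr rfl fun i _ => Finset.sum_congr rfl fun j _ => by ring

lemma integrable_qf_noise (S : Matrix (Fin n) (Fin n) ℝ) :
    Integrable (fun y => qf S y) (noise n σ) := by
  simp only [qf_eq_sum]
  exact integrable_finsetSum _ fun i _ => integrable_finsetSum _ fun j _ =>
    (integrable_mul_noise i j).const_mul _

lemma integral_qf_noise (S : Matrix (Fin n) (Fin n) ℝ) :
    ∫ y, qf S y ∂(noise n σ) = σ ^ 2 * S.trace := by
  simp only [qf_eq_sum]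
  refine (integral_finsetSum _ fun i _ => integrable_finsetSum _ fun j _ =>
    (integrable_mul_noise i j).const_mul _).trans ?_
  have h : ∀ i, ∫ y, ∑ j, S i j * (y i * y j) ∂(noise n σ) = σ ^ 2 * S i i := fun i => by
    refine (integral_finsetSum _ fun j _ => (integrable_mul_noise i j).const_mul _).trans ?_
    simp only [integral_const_mul, integral_mul_noise]
    simp [mul_comm]
  simp only [h, Matrix.trace, Finset.mul_sum, Matrix.diag_apply]

lemma integrable_dotProduct_noise (a : Fin n → ℝ) :
    Integrable (fun y => a ⬝ᵥ y) (noise n σ) :=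
  integrable_finsetSum _ fun i _ => (integrable_eval_noise i).const_mul _

lemma integral_dotProduct_noise (a : Fin n → ℝ) : ∫ y, a ⬝ᵥ y ∂(noise n σ) = 0 := by
  simp only [dotProduct]
  rw [integral_finsetSum _ fun i _ => (integrable_eval_noise i).const_mul _]
  simp [integral_const_mul, integral_eval_noise]

lemma qf_add_vec' {ι : Type*} [Fintype ι] {S : Matrix ι ι ℝ} (hS : Sᵀ = S) (x y : ι → ℝ) :
    qf S (x + y) = qf S x + 2 * ((S *ᵥ x) ⬝ᵥ y) + qf S y := by
  rw [qf_add_vec hS, dotProduct_mulVec_comm_of_symm hS, dotProduct_comm]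

lemma integrable_qf_add_noise {S : Matrix (Fin n) (Fin n) ℝ} (hS : Sᵀ = S) (a : Fin n → ℝ) :
    Integrable (fun y => qf S (a + y)) (noise n σ) := by
  simp only [qf_add_vec' hS]
  exact ((integrable_const _).add ((integrable_dotProduct_noise _).const_mul 2)).add
    (integrable_qf_noise S)

lemma integral_qf_add_noise {S : Matrix (Fin n) (Fin n) ℝ} (hS : Sᵀ = S) (a : Fin n → ℝ) :
    ∫ y, qf S (a + y) ∂(noise n σ) = qf S a + σ ^ 2 * S.trace := by
  simp only [qf_add_vec' hS]
  have h1 : Integrable (fun y => qf S a + 2 * ((S *ᵥ a) ⬝ᵥ y)) (noise n σ) :=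
    (integrable_const _).add ((integrable_dotProduct_noise _).const_mul 2)
  rw [integral_add h1 (integrable_qf_noise S),
    integral_add (integrable_const _) ((integrable_dotProduct_noise _).const_mul 2),
    integral_const_mul, integral_dotProduct_noise, integral_qf_noise]
  simp

lemma lintegral_qf_add_noise {S : Matrix (Fin n) (Fin n) ℝ} (hS : S.PosSemidef) (a : Fin n → ℝ) :
    ∫⁻ y, ENNReal.ofReal (qf S (a + y)) ∂(noise n σ) =
      ENNReal.ofReal (qf S a) + ENNReal.ofReal (σ ^ 2 * S.trace) := by
  have hs := transpose_eq_of_posSemidef hS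
  rw [← ofReal_integral_eq_lintegral_ofReal (integrable_qf_add_noise hs a)
    (Eventually.of_forall fun y => qf_nonneg hS _), integral_qf_add_noise hs,
    ENNReal.ofReal_add (qf_nonneg hS _) (mul_nonneg (sq_nonneg _) hS.trace_nonneg)]

end Noise

/-! ### The optimal average cost equals σ² tr S. -/

section OptimalCost

variable {n m : ℕ} {Q : Matrix (Fin n) (Fin n) ℝ} {R : Matrix (Fin m) (Fin m) ℝ} {σ : ℝ}
  {θ : Param n m}

lemma history_congr (π : Policy n m) (v : unitInterval) {w w' : ℕ → Fin n → ℝ} (t : ℕ)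
    (h : ∀ j ≤ t, w j = w' j) : history θ π v w t = history θ π v w' t := by
  induction t with
  | zero => rfl
  | succ t ih =>
    simp only [history, ih fun j hj => h j (hj.trans t.le_succ), h (t + 1) le_rfl]

lemma measurable_history (π : Policy n m) (t : ℕ) :
    Measurable fun p : unitInterval × (ℕ → Fin n → ℝ) => history θ π p.1 p.2 t := by
  induction t with
  | zero => exact measurable_const
  | succ t ih =>
    refine measurable_pi_lambda _ fun i => ?_
    refine Fin.lastCases ?_ (fun i => ?_) i
    · simp only [history, Fin.snoc_last]
      refine ((measurable_mulVec measurable_const ((measurable_pi_apply _).comp ih)).add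
        (measurable_mulVec measurable_const ((π.measurable_act t).comp
          (measurable_fst.prodMk ih)))).add ?_
      exact (measurable_pi_apply _).comp measurable_snd
    · simp only [history, Fin.snoc_castSucc]
      exact (measurable_pi_apply i).comp ih

/-- The law of the seed and the noise sequence. -/
noncomputable abbrev seedNoise (n : ℕ) (σ : ℝ) : Measure (unitInterval × (ℕ → Fin n → ℝ)) :=
  (volume : Measure unitInterval).prod (Measure.infinitePi fun _ : ℕ => noise n σ)

/-- The next noise vector can be integrated out first. -/
lemma lintegral_history_noise (π : Policy n m) (t : ℕ)
    {F : (unitInterval × (Fin (t + 1) → Fin n → ℝ)) × (Fin n → ℝ) → ℝ≥0∞} (hF : Measurable F) :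
    ∫⁻ p, F ((p.1, history θ π p.1 p.2 t), p.2 (t + 1)) ∂(seedNoise n σ) =
      ∫⁻ p, ∫⁻ y, F ((p.1, history θ π p.1 p.2 t), y) ∂(noise n σ) ∂(seedNoise n σ) := by
  have hh := measurable_history (θ := θ) π t
  have hG : Measurable fun q : unitInterval × (Fin (t + 1) → Fin n → ℝ) =>
      ∫⁻ y, F (q, y) ∂(noise n σ) := hF.lintegral_prod_right'
  rw [lintegral_prod _ (by fun_prop), lintegral_prod _ (by fun_prop)]
  refine lintegral_congr fun v => ?_
  set μ : Measure (ℕ → Fin n → ℝ) := Measure.infinitePi fun _ : ℕ => noise n σ with hμ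
  have hind : iIndepFun (fun j (w : ℕ → Fin n → ℝ) => w j) μ :=
    iIndepFun_infinitePi (P := fun _ : ℕ => noise n σ) (X := fun _ x => x)
      fun _ => measurable_id
  have hind2 := hind.indepFun_finset (Finset.range (t + 1)) {t + 1} (by simp)
    fun j => measurable_pi_apply j
  -- Padding by zeros: the history up to t does not read the noise beyond time t, so it is a
  -- function of finitely many coordinates, all independent of coordinate t + 1.
  let e : ((j : Finset.range (t + 1)) → Fin n → ℝ) → (ℕ → Fin n → ℝ) := fun a j =>
    if hj : j ∈ Finset.range (t + 1) then a ⟨j, hj⟩ else 0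
  have he : Measurable e := measurable_pi_lambda _ fun j => by
    simp only [e]; split_ifs
    · exact measurable_pi_apply _
    · exact measurable_const
  have hψ : Measurable fun b : (({t + 1} : Finset ℕ) → Fin n → ℝ) =>
      b ⟨t + 1, Finset.mem_singleton_self _⟩ := measurable_pi_apply _
  have hind3 := hind2.comp (φ := fun a => history θ π v (e a) t)
    (hh.comp (measurable_const.prodMk he)) hψ
  have heq : ((fun a => history θ π v (e a) t) ∘
      fun (w : ℕ → Fin n → ℝ) (i : Finset.range (t + 1)) => w i) =
      fun w => history θ π v w t := by
    ext1 w
    refine history_congr π v t fun j hj => ?_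
    have : j ∈ Finset.range (t + 1) := Finset.mem_range.2 (by omega)
    simp only [e, dif_pos this]
  rw [heq] at hind3
  have hm1 : Measurable fun w => history θ π v w t := hh.comp measurable_prodMk_left
  have hm2 : Measurable fun w : ℕ → Fin n → ℝ => w (t + 1) := measurable_pi_apply _
  have hprod := (indepFun_iff_map_prod_eq_prod_map_map hm1.aemeasurable hm2.aemeasurable).1 hind3
  have hlaw : μ.map (fun w => w (t + 1)) = noise n σ :=
    Measure.infinitePi_map_eval (fun _ : ℕ => noise n σ) (t + 1)
  rw [hlaw] at hprod
  have hFv : Measurable fun p : (Fin (t + 1) → Fin n → ℝ) × (Fin n → ℝ) => F ((v, p.1), p.2) := by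
    fun_prop
  calc ∫⁻ w, F ((v, history θ π v w t), w (t + 1)) ∂μ
      = ∫⁻ p, F ((v, p.1), p.2) ∂(μ.map fun w => (history θ π v w t, w (t + 1))) :=
        (lintegral_map hFv (hm1.prodMk hm2)).symm
    _ = ∫⁻ h, ∫⁻ y, F ((v, h), y) ∂(noise n σ) ∂(μ.map fun w => history θ π v w t) := by
        rw [← lintegral_prod _ hFv.aemeasurable]; exact congrArg (fun ν => ∫⁻ p, F ((v, p.1), p.2) ∂ν) hprod
    _ = _ := by
        rw [lintegral_map hFv.lintegral_prod_right' hm1]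

lemma measurable_cost {X : Type*} [MeasurableSpace X] {x : X → Fin n → ℝ} {u : X → Fin m → ℝ}
    (hx : Measurable x) (hu : Measurable u) : Measurable fun ω => cost Q R (x ω) (u ω) :=
  (measurable_qf measurable_const hx).add (measurable_qf measurable_const hu)

/-- Expected cost of the first `T` steps, plus a terminal cost. -/
noncomputable def finiteCost (Q : Matrix (Fin n) (Fin n) ℝ) (R : Matrix (Fin m) (Fin m) ℝ)
    (σ : ℝ) (θ : Param n m) (π : Policy n m) (P : Matrix (Fin n) (Fin n) ℝ) (T : ℕ) : ℝ≥0∞ :=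
  ∫⁻ ω, (∑ t ∈ Finset.range T,
      ENNReal.ofReal (cost Q R (history θ π ω.1 ω.2 t (Fin.last t))
        (π.act t (ω.1, history θ π ω.1 ω.2 t)))) +
      ENNReal.ofReal (qf P (history θ π ω.1 ω.2 T (Fin.last T))) ∂(seedNoise n σ)

/-- The last noise vector is centred and independent of the history, so it adds exactly σ² tr P to
the expected terminal cost. -/
lemma finiteCost_succ (hQ : Q.PosDef) (hR : R.PosDef) (π : Policy n m)
    {P : Matrix (Fin n) (Fin n) ℝ} (hP : P.PosSemidef) (T : ℕ) :
    finiteCost Q R σ θ π P (T + 1) = (∫⁻ ω, (∑ t ∈ Finset.range T,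
      ENNReal.ofReal (cost Q R (history θ π ω.1 ω.2 t (Fin.last t))
        (π.act t (ω.1, history θ π ω.1 ω.2 t)))) +
      ENNReal.ofReal (cost Q R (history θ π ω.1 ω.2 T (Fin.last T))
        (π.act T (ω.1, history θ π ω.1 ω.2 T)) +
        qf P (matA θ *ᵥ (history θ π ω.1 ω.2 T (Fin.last T)) +
          matB θ *ᵥ π.act T (ω.1, history θ π ω.1 ω.2 T))) ∂(seedNoise n σ)) +
      ENNReal.ofReal (σ ^ 2 * P.trace) := by
  have hlast : ∀ t, Measurable fun p : unitInterval × (ℕ → Fin n → ℝ) =>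
      history θ π p.1 p.2 t (Fin.last t) := fun t =>
    (measurable_pi_apply _).comp (measurable_history π t)
  have hact : ∀ t, Measurable fun p : unitInterval × (ℕ → Fin n → ℝ) =>
      π.act t (p.1, history θ π p.1 p.2 t) := fun t =>
    (π.measurable_act t).comp (measurable_fst.prodMk (measurable_history π t))
  have hcost : ∀ t, Measurable fun ω : unitInterval × (ℕ → Fin n → ℝ) =>
      ENNReal.ofReal (cost Q R (history θ π ω.1 ω.2 t (Fin.last t))
        (π.act t (ω.1, history θ π ω.1 ω.2 t))) := fun t =>
    (measurable_cost (hlast t) (hact t)).ennreal_ofReal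
  have hsum : ∀ T, Measurable fun ω : unitInterval × (ℕ → Fin n → ℝ) => ∑ t ∈ Finset.range T,
      ENNReal.ofReal (cost Q R (history θ π ω.1 ω.2 t (Fin.last t))
        (π.act t (ω.1, history θ π ω.1 ω.2 t))) := fun T =>
    Finset.measurable_sum _ fun t _ => hcost t
  let a : unitInterval × (Fin (T + 1) → Fin n → ℝ) → Fin n → ℝ := fun q =>
    matA θ *ᵥ q.2 (Fin.last T) + matB θ *ᵥ π.act T q
  have ha : Measurable a := (measurable_mulVec measurable_const
    ((measurable_pi_apply _).comp measurable_snd)).add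
      (measurable_mulVec measurable_const (π.measurable_act T))
  have hterm : ∫⁻ ω, ENNReal.ofReal (qf P (history θ π ω.1 ω.2 (T + 1) (Fin.last (T + 1))))
      ∂(seedNoise n σ) = (∫⁻ ω, ENNReal.ofReal (qf P (a (ω.1, history θ π ω.1 ω.2 T)))
      ∂(seedNoise n σ)) + ENNReal.ofReal (σ ^ 2 * P.trace) := by
    have := lintegral_history_noise (σ := σ) (θ := θ) π T
      (F := fun p => ENNReal.ofReal (qf P (a p.1 + p.2)))
      (measurable_qf measurable_const ((ha.comp measurable_fst).add measurable_snd)).ennreal_ofReal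
    simp only [history, Fin.snoc_last]
    refine this.trans ?_
    simp only [lintegral_qf_add_noise hP]
    rw [lintegral_add_right _ measurable_const]
    simp
  have hqfa : Measurable fun ω : unitInterval × (ℕ → Fin n → ℝ) =>
      ENNReal.ofReal (qf P (a (ω.1, history θ π ω.1 ω.2 T))) :=
    (measurable_qf measurable_const
      (ha.comp (measurable_fst.prodMk (measurable_history π T)))).ennreal_ofReal
  rw [finiteCost, lintegral_add_left (hsum _), hterm, ← add_assoc, ← lintegral_add_left (hsum _)]
  congr 1
  refine lintegral_congr fun ω => ?_
  rw [Finset.sum_range_succ, add_assoc, ENNReal.ofReal_add (cost_nonneg hQ hR _ _) (qf_nonneg hP _)]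

/-- One backward step of dynamic programming: the last running cost and the terminal cost are
replaced by their minimum over controls. -/
lemma finiteCost_valIter_ge (hQ : Q.PosDef) (hR : R.PosDef) (π : Policy n m) (k T : ℕ) :
    finiteCost Q R σ θ π (valIter Q R (matA θ) (matB θ) (k + 1)) T +
      ENNReal.ofReal (σ ^ 2 * (valIter Q R (matA θ) (matB θ) k).trace) ≤
    finiteCost Q R σ θ π (valIter Q R (matA θ) (matB θ) k) (T + 1) := by
  rw [finiteCost_succ hQ hR π (posSemidef_valIter hQ hR k), finiteCost]
  gcongr with ω
  exact qf_ricMap_le hR (posSemidef_valIter hQ hR k) _ _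

/-- Iterating the backward step removes all T controls; each step leaves behind the contribution of
one noise vector. For k = 0 there is no terminal cost. -/
lemma sum_trace_le_finiteCost (hQ : Q.PosDef) (hR : R.PosDef) (π : Policy n m) (k T : ℕ) :
    ∑ j ∈ Finset.range T, ENNReal.ofReal (σ ^ 2 * (valIter Q R (matA θ) (matB θ) (k + j)).trace) ≤
    finiteCost Q R σ θ π (valIter Q R (matA θ) (matB θ) k) T := by
  induction T generalizing k with
  | zero => simp
  | succ T ih =>
    rw [Finset.sum_range_succ']
    refine le_trans ?_ (finiteCost_valIter_ge hQ hR π k T)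
    gcongr
    · refine le_trans (le_of_eq ?_) (ih (k + 1))
      exact Finset.sum_congr rfl fun j _ => by rw [add_assoc, add_comm 1 j]
    · simp

/-- The lower bound for the T-step cost is a sum of σ² tr V_j, with V_j from value iteration. Since
V_j tends to S, its averages tend to σ² tr S. -/
lemma le_avgCost (hQ : Q.PosDef) (hR : R.PosDef) (h : ∃ S, IsRiccati Q R θ S) (π : Policy n m) :
    ENNReal.ofReal (σ ^ 2 * (ricS Q R θ).trace) ≤ avgCost Q R σ θ π := by
  have htr : Tendsto (fun k => σ ^ 2 * (valIter Q R (matA θ) (matB θ) k).trace) atTop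
      (nhds (σ ^ 2 * (ricS Q R θ).trace)) :=
    (((continuous_id.matrix_trace (X := Matrix (Fin n) (Fin n) ℝ)).tendsto _).comp
      (tendsto_valIter_ricS hQ hR h)).const_mul _
  have h1 := ENNReal.tendsto_ofReal htr.cesaro
  rw [← h1.limsup_eq, avgCost]
  refine limsup_le_limsup ?_ (by isBoundedDefault) (by isBoundedDefault)
  filter_upwards [eventually_gt_atTop 0] with T hT
  have hT' : (0 : ℝ) < T := by exact_mod_cast hT
  rw [inv_mul_eq_div, ENNReal.ofReal_div_of_pos hT', ENNReal.ofReal_natCast]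
  gcongr
  rw [ENNReal.ofReal_sum_of_nonneg fun k _ =>
    mul_nonneg (sq_nonneg _) (posSemidef_valIter hQ hR k).trace_nonneg]
  have h2 := sum_trace_le_finiteCost (σ := σ) (θ := θ) hQ hR π 0 T
  simpa [finiteCost, valIter] using h2

/-- The linear state feedback policy `u = K x`. -/
noncomputable def linearPolicy (K : Matrix (Fin m) (Fin n) ℝ) : Policy n m where
  act t p := K *ᵥ p.2 (Fin.last t)
  measurable_act _ := measurable_mulVec measurable_const
    ((measurable_pi_apply _).comp measurable_snd)

/-- With terminal cost S the optimal linear feedback has T-step cost exactly Tσ² tr S, by the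
Bellman equation; dropping the terminal cost only decreases it. -/
lemma avgCost_linearPolicy_le (hQ : Q.PosDef) (hR : R.PosDef) (h : ∃ S, IsRiccati Q R θ S) :
    avgCost Q R σ θ (linearPolicy (gain Q R θ)) ≤ ENNReal.ofReal (σ ^ 2 * (ricS Q R θ).trace) := by
  have hS := isRiccati_ricS h
  have hfin : ∀ T : ℕ, finiteCost Q R σ θ (linearPolicy (gain Q R θ)) (ricS Q R θ) T =
      T * ENNReal.ofReal (σ ^ 2 * (ricS Q R θ).trace) := fun T => by
    induction T with
    | zero => simp [finiteCost, history]
    | succ T ih =>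
      rw [finiteCost_succ hQ hR _ hS.1]
      push_cast
      rw [add_mul, ← ih, one_mul, finiteCost]
      congr 1
      refine lintegral_congr fun ω => ?_
      congr 2
      have := qf_fixed_eq hR hS.1 hS.2 (history θ (linearPolicy (gain Q R θ)) ω.1 ω.2 T (Fin.last T))
      rw [this, add_mulVec, ← mulVec_mulVec]
      rfl
  refine limsup_le_of_le (by isBoundedDefault) ?_
  filter_upwards [eventually_gt_atTop 0] with T hT
  refine ENNReal.div_le_of_le_mul ?_
  rw [mul_comm, ← hfin]
  exact lintegral_mono fun ω => le_self_add

/-- The optimal average cost of a stabilizable system. -/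
theorem optCost_eq (hQ : Q.PosDef) (hR : R.PosDef) (h : ∃ S, IsRiccati Q R θ S) :
    optCost Q R σ θ = σ ^ 2 * (ricS Q R θ).trace := by
  rw [optCost, le_antisymm ((iInf_le _ _).trans (avgCost_linearPolicy_le hQ hR h))
    (le_iInf fun π => le_avgCost hQ hR h π), ENNReal.toReal_ofReal]
  exact mul_nonneg (sq_nonneg _) (posSemidef_ricS θ).trace_nonneg

end OptimalCost

/-! ### The matrix square root. -/

section SquareRoot

open scoped MatrixOrder

variable {ι : Type*} [Fintype ι] [DecidableEq ι]

omit [DecidableEq ι] in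
lemma isClosed_posSemidef : IsClosed {S : Matrix ι ι ℝ | S.PosSemidef} := by
  have : {S : Matrix ι ι ℝ | S.PosSemidef} = {S | Sᵀ = S} ∩ ⋂ x, {S | 0 ≤ qf S x} := by
    ext S
    simp only [Set.mem_ofPred_eq, Set.mem_inter_iff, Set.mem_iInter]
    exact ⟨fun h => ⟨transpose_eq_of_posSemidef h, qf_nonneg h⟩, fun h => posSemidef_of_qf h.1 h.2⟩
  rw [this]
  exact (isClosed_eq continuous_id.matrix_transpose continuous_id).inter
    (isClosed_iInter fun x => isClosed_le continuous_const (continuous_qf_matrix x))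

lemma measurable_matrix_sqrt : Measurable fun S : Matrix ι ι ℝ => CFC.sqrt S := by
  have hE : MeasurableSet {S : Matrix ι ι ℝ | S.PosSemidef} := isClosed_posSemidef.measurableSet
  refine measurable_of_restrict_of_restrict_compl hE ?_ ?_
  · have h : ContinuousOn (fun S : Matrix ι ι ℝ => CFC.sqrt S) {S | S.PosSemidef} :=
      (CFC.continuousOn_sqrt (A := Matrix ι ι ℝ)).mono fun S hS => Matrix.PosSemidef.nonneg hS
    exact h.domRestrict.measurable
  -- Outside the semidefinite cone the functional calculus returns its default value 0.
  · have : ({S : Matrix ι ι ℝ | S.PosSemidef}ᶜ.domRestrict fun S => CFC.sqrt S) = fun _ => 0 := by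
      ext1 ⟨S, hS⟩
      simp only [Set.domRestrict]
      rw [CFC.sqrt, cfcₙ_apply_of_not_predicate]
      change ¬ (S - 0).PosSemidef
      simpa using hS
    rw [this]; exact measurable_const

lemma sqrt_mul_inv_mul_sqrt {S : Matrix ι ι ℝ} (hS : S.PosDef) :
    (CFC.sqrt S)ᵀ * S⁻¹ * CFC.sqrt S = 1 := by
  have h1 : CFC.sqrt S * CFC.sqrt S = S := CFC.sqrt_mul_sqrt_self S hS.posSemidef.nonneg
  have h2 : (CFC.sqrt S)ᵀ = CFC.sqrt S :=
    transpose_eq_of_posSemidef (Matrix.nonneg_iff_posSemidef.1 (CFC.sqrt_nonneg S))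
  have hdet : IsUnit S.det := (Matrix.isUnit_iff_isUnit_det _).1 hS.isUnit
  have hdet' : IsUnit (CFC.sqrt S).det := by
    rw [← h1, det_mul] at hdet; exact isUnit_of_mul_isUnit_left hdet
  have h3 : S⁻¹ = (CFC.sqrt S)⁻¹ * (CFC.sqrt S)⁻¹ := by
    conv_lhs => rw [← h1]
    rw [Matrix.mul_inv_rev]
  rw [h2, h3, ← Matrix.mul_assoc, mul_nonsing_inv _ hdet', Matrix.one_mul, nonsing_inv_mul _ hdet']

end SquareRoot

/-! ### Gaussian laws on parameters, measurably in mean and covariance. -/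

section GaussParam

open scoped MatrixOrder

variable {n m : ℕ}

/-- The law of independent standard Gaussian columns. -/
noncomputable abbrev stdParam (n m : ℕ) : Measure (Param n m) :=
  Measure.pi fun _ => stdGaussian (EuclideanSpace ℝ (Fin n ⊕ Fin m))

instance (μ : Param n m) (S : Matrix (Fin n ⊕ Fin m) (Fin n ⊕ Fin m) ℝ) :
    IsProbabilityMeasure (gaussParam μ S) := by
  unfold gaussParam; infer_instance

/-- Writing every Gaussian as the image of one fixed law moves mean and covariance into the map,
from which their measurable dependence can be read off. -/
lemma gaussParam_eq_map (μ : Param n m) (S : Matrix (Fin n ⊕ Fin m) (Fin n ⊕ Fin m) ℝ) :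
    gaussParam μ S = (stdParam n m).map fun g i =>
      μ i + WithLp.toLp 2 (CFC.sqrt S *ᵥ (g i).ofLp) := by
  let f : Fin n → EuclideanSpace ℝ (Fin n ⊕ Fin m) → EuclideanSpace ℝ (Fin n ⊕ Fin m) := fun i x =>
    μ i + toEuclideanCLM (𝕜 := ℝ) (CFC.sqrt S) x
  have hm : ∀ i, Measurable (f i) := fun i =>
    measurable_const.add (toEuclideanCLM (𝕜 := ℝ) (CFC.sqrt S)).continuous.measurable
  have : ∀ i, IsProbabilityMeasure ((stdGaussian (EuclideanSpace ℝ (Fin n ⊕ Fin m))).map (f i)) :=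
    fun i => Measure.isProbabilityMeasure_map (hm i).aemeasurable
  have h := Measure.pi_map_pi (μ := fun _ : Fin n => stdGaussian (EuclideanSpace ℝ (Fin n ⊕ Fin m)))
    (f := f) fun i => (hm i).aemeasurable
  have h' : gaussParam μ S = Measure.pi fun i =>
    (stdGaussian (EuclideanSpace ℝ (Fin n ⊕ Fin m))).map (f i) := by
    simp only [gaussParam, multivariateGaussian, f]
  rw [h', ← h]
  rfl

lemma measurable_gaussParam :
    Measurable fun p : Param n m × Matrix (Fin n ⊕ Fin m) (Fin n ⊕ Fin m) ℝ =>
      gaussParam p.1 p.2 := by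
  have hf : Measurable fun q : (Param n m × Matrix (Fin n ⊕ Fin m) (Fin n ⊕ Fin m) ℝ) × Param n m =>
      fun i => q.1.1 i + WithLp.toLp 2 (CFC.sqrt q.1.2 *ᵥ (q.2 i).ofLp) := by
    refine measurable_pi_lambda _ fun i => Measurable.add (by fun_prop) ?_
    refine (WithLp.measurable_toLp _ _).comp (measurable_mulVec ?_ ?_)
    · exact measurable_matrix_sqrt.comp (measurable_snd.comp measurable_fst)
    · fun_prop
  refine Measure.measurable_measure.2 fun s hs => ?_
  have : ∀ p : Param n m × Matrix (Fin n ⊕ Fin m) (Fin n ⊕ Fin m) ℝ, gaussParam p.1 p.2 s =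
      stdParam n m (Prod.mk p ⁻¹' ((fun q : (Param n m × Matrix (Fin n ⊕ Fin m) (Fin n ⊕ Fin m) ℝ)
        × Param n m => fun i => q.1.1 i + WithLp.toLp 2 (CFC.sqrt q.1.2 *ᵥ (q.2 i).ofLp)) ⁻¹' s)) := by
    intro p
    rw [gaussParam_eq_map]
    exact Measure.map_apply (hf.comp measurable_prodMk_left) hs
  simp only [this]
  exact measurable_measure_prodMk_left (hf hs)

lemma measurable_trunc (pb : Problem n m) :
    Measurable fun p : Param n m × Matrix (Fin n ⊕ Fin m) (Fin n ⊕ Fin m) ℝ =>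
      pb.trunc p.1 p.2 := by
  have hs := pb.isCompact_supp.measurableSet
  refine Measure.measurable_measure.2 fun s hms => ?_
  simp only [Problem.trunc, ProbabilityTheory.cond_apply hs]
  exact ((Measure.measurable_coe hs).comp measurable_gaussParam).inv.mul
    ((Measure.measurable_coe (hs.inter hms)).comp measurable_gaussParam)

lemma measurable_trunc_comp (pb : Problem n m) {X : Type*} [MeasurableSpace X] {f : X → Param n m}
    {g : X → Matrix (Fin n ⊕ Fin m) (Fin n ⊕ Fin m) ℝ} (hf : Measurable f) (hg : Measurable g) :
    Measurable fun x => pb.trunc (f x) (g x) := by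
  have := (measurable_trunc pb).comp (hf.prodMk hg)
  simpa only [Function.comp_def] using this

lemma measurable_gaussParam_comp {X : Type*} [MeasurableSpace X] {f : X → Param n m}
    {g : X → Matrix (Fin n ⊕ Fin m) (Fin n ⊕ Fin m) ℝ} (hf : Measurable f) (hg : Measurable g) :
    Measurable fun x => gaussParam (f x) (g x) := by
  have := measurable_gaussParam.comp (hf.prodMk hg)
  simpa only [Function.comp_def] using this

end GaussParam

/-! ### Conjugacy for one column. -/

section Conjugate

variable {ι : Type*} [Fintype ι] [DecidableEq ι]

/-- Covariance after observing `z`-projections with noise variance `σ²`. -/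
noncomputable def postCov (S : Matrix ι ι ℝ) (z : ι → ℝ) (σ : ℝ) : Matrix ι ι ℝ :=
  (S⁻¹ + (1 / σ ^ 2) • vecMulVec z z)⁻¹

omit [DecidableEq ι] in
lemma qf_vecMulVec (z x : ι → ℝ) : qf (vecMulVec z z) x = (x ⬝ᵥ z) ^ 2 := by
  rw [qf, vecMulVec_mulVec, dotProduct_smul]
  simp only [MulOpposite.smul_eq_mul_unop, MulOpposite.unop_op]
  rw [dotProduct_comm z x]; ring

lemma posDef_inv_add {S : Matrix ι ι ℝ} (hS : S.PosDef) (z : ι → ℝ) (σ : ℝ) :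
    (S⁻¹ + (1 / σ ^ 2) • vecMulVec z z).PosDef := by
  refine hS.inv.add_posSemidef (posSemidef_of_qf ?_ fun x => ?_)
  · rw [transpose_smul, transpose_vecMulVec]
  · rw [qf_smul_matrix, qf_vecMulVec]; positivity

lemma posDef_postCov {S : Matrix ι ι ℝ} (hS : S.PosDef) (z : ι → ℝ) (σ : ℝ) :
    (postCov S z σ).PosDef := (posDef_inv_add hS z σ).inv

/-- The Sherman-Morrison formula: the inverse of a rank one perturbation of S⁻¹. -/
lemma postCov_eq {S : Matrix ι ι ℝ} (hS : S.PosDef) (z : ι → ℝ) {σ : ℝ} (hσ : 0 < σ) :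
    postCov S z σ = S - (σ ^ 2 + qf S z)⁻¹ • vecMulVec (S *ᵥ z) (S *ᵥ z) := by
  have hdet : IsUnit S.det := (Matrix.isUnit_iff_isUnit_det _).1 hS.isUnit
  have hs := transpose_eq_of_posSemidef hS.posSemidef
  have hq : 0 ≤ qf S z := qf_nonneg hS.posSemidef z
  have h2 : (0 : ℝ) < σ ^ 2 + qf S z := by positivity
  refine Matrix.inv_eq_right_inv ?_
  have e1 : S⁻¹ * vecMulVec (S *ᵥ z) (S *ᵥ z) = vecMulVec z (S *ᵥ z) := by
    rw [mul_vecMulVec, mulVec_mulVec, nonsing_inv_mul _ hdet, one_mulVec]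
  have e2 : vecMulVec z z * S = vecMulVec z (S *ᵥ z) := by
    rw [vecMulVec_mul, ← mulVec_transpose, hs]
  have e3 : vecMulVec z z * vecMulVec (S *ᵥ z) (S *ᵥ z) = qf S z • vecMulVec z (S *ᵥ z) := by
    rw [vecMulVec_mul_vecMulVec, vecMulVec_smul, qf]
  rw [add_mul, mul_sub, mul_sub, nonsing_inv_mul _ hdet, mul_smul_comm, e1, smul_mul_assoc, e2,
    smul_mul_assoc, mul_smul_comm, e3, smul_smul, smul_smul, mul_assoc]
  have h3 : (1 / σ ^ 2) - (σ ^ 2 + qf S z)⁻¹ - (1 / σ ^ 2) * ((σ ^ 2 + qf S z)⁻¹ * qf S z) = 0 := by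
    field_simp; ring
  have h4 : (1 : Matrix ι ι ℝ) - (σ ^ 2 + qf S z)⁻¹ • vecMulVec z (S *ᵥ z) +
      ((1 / σ ^ 2) • vecMulVec z (S *ᵥ z) -
        (1 / σ ^ 2 * ((σ ^ 2 + qf S z)⁻¹ * qf S z)) • vecMulVec z (S *ᵥ z)) =
      1 + ((1 / σ ^ 2) - (σ ^ 2 + qf S z)⁻¹ - (1 / σ ^ 2) * ((σ ^ 2 + qf S z)⁻¹ * qf S z)) •
        vecMulVec z (S *ᵥ z) := by
    rw [sub_smul, sub_smul]; abel
  rw [h4, h3, zero_smul, add_zero]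

lemma qf_postCov {S : Matrix ι ι ℝ} (hS : S.PosDef) (z a : ι → ℝ) {σ : ℝ} (hσ : 0 < σ) :
    qf (postCov S z σ) a = qf S a - (a ⬝ᵥ (S *ᵥ z)) ^ 2 / (σ ^ 2 + qf S z) := by
  rw [postCov_eq hS z hσ, qf_sub_matrix, qf_smul_matrix, qf_vecMulVec]; ring

omit [DecidableEq ι] in
lemma inner_eq_dotProduct (x y : EuclideanSpace ℝ ι) : inner ℝ x y = x.ofLp ⬝ᵥ y.ofLp := by
  rw [EuclideanSpace.inner_eq_star_dotProduct]; simp [dotProduct_comm]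

/-- Conjugacy of the Gaussian prior with a noisy linear observation: the observation and the
recentred parameter are independent Gaussians. -/
lemma map_prod_conjugate {S : Matrix ι ι ℝ} (hS : S.PosDef) (μ : EuclideanSpace ℝ ι) (z : ι → ℝ)
    {σ : ℝ} (hσ : 0 < σ) :
    ((multivariateGaussian μ S).prod (gaussianReal 0 (Real.toNNReal (σ ^ 2)))).map (fun p =>
        (p.1 - ((p.1.ofLp ⬝ᵥ z + p.2 - μ.ofLp ⬝ᵥ z) / (σ ^ 2 + qf S z)) • WithLp.toLp 2 (S *ᵥ z),
          p.1.ofLp ⬝ᵥ z + p.2)) =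
      (multivariateGaussian μ (postCov S z σ)).prod
        (gaussianReal (μ.ofLp ⬝ᵥ z) (Real.toNNReal (σ ^ 2 + qf S z))) := by
  have hs := transpose_eq_of_posSemidef hS.posSemidef
  have hq : 0 ≤ qf S z := qf_nonneg hS.posSemidef z
  set s := σ ^ 2 + qf S z with hsdef
  have hs0 : 0 < s := by positivity
  have hdot : Measurable fun x : EuclideanSpace ℝ ι => x.ofLp ⬝ᵥ z :=
    measurable_dotProduct (by fun_prop) measurable_const
  have hφ : Measurable fun p : EuclideanSpace ℝ ι × ℝ =>
      (p.1 - ((p.1.ofLp ⬝ᵥ z + p.2 - μ.ofLp ⬝ᵥ z) / s) • WithLp.toLp 2 (S *ᵥ z),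
          p.1.ofLp ⬝ᵥ z + p.2) := by
    have h1 : Measurable fun p : EuclideanSpace ℝ ι × ℝ => p.1.ofLp ⬝ᵥ z + p.2 :=
      (hdot.comp measurable_fst).add measurable_snd
    exact (measurable_fst.sub (((h1.sub_const _).div_const _).smul_const _)).prodMk h1
  have : IsProbabilityMeasure (((multivariateGaussian μ S).prod
      (gaussianReal 0 (Real.toNNReal (σ ^ 2)))).map (fun p =>
        (p.1 - ((p.1.ofLp ⬝ᵥ z + p.2 - μ.ofLp ⬝ᵥ z) / s) • WithLp.toLp 2 (S *ᵥ z),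
          p.1.ofLp ⬝ᵥ z + p.2))) := Measure.isProbabilityMeasure_map hφ.aemeasurable
  refine Measure.ext_of_charFunDual (funext fun L => ?_)
  set a : EuclideanSpace ℝ ι := (InnerProductSpace.toDual ℝ (EuclideanSpace ℝ ι)).symm
    (L ∘SL ContinuousLinearMap.inl ℝ _ ℝ) with ha
  set b := L (0, 1) with hb
  have hL : ∀ e y, L (e, y) = inner ℝ e a + y * b := fun e y => by
    have h1 : inner ℝ e a = L (e, 0) := by
      rw [real_inner_comm, ha, InnerProductSpace.toDual_symm_apply]; rfl
    rw [h1, hb, ← smul_eq_mul, ← map_smul, ← map_add]; simp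
  -- κ is the regression coefficient of ⟨a, ϑ⟩ on the observation. Subtracting it makes the
  -- functional depend on ϑ through a + βz and on the noise through β, so both characteristic
  -- functions are explicit.
  set κ := a.ofLp ⬝ᵥ (S *ᵥ z) / s with hκ
  have hκs : a.ofLp ⬝ᵥ (S *ᵥ z) = κ * s := by rw [hκ]; field_simp
  set β := b - κ with hβ
  rw [charFunDual_apply, integral_map hφ.aemeasurable (by fun_prop), charFunDual_prod]
  have hpt : ∀ p : EuclideanSpace ℝ ι × ℝ,
      L (p.1 - ((p.1.ofLp ⬝ᵥ z + p.2 - μ.ofLp ⬝ᵥ z) / s) • WithLp.toLp 2 (S *ᵥ z),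
          p.1.ofLp ⬝ᵥ z + p.2) =
        κ * (μ.ofLp ⬝ᵥ z) + inner ℝ p.1 (a + β • WithLp.toLp 2 z) + inner ℝ p.2 β := fun p => by
    rw [hL, inner_sub_left, real_inner_smul_left, inner_add_right, real_inner_smul_right]
    simp only [inner_eq_dotProduct, real_inner_eq_re_inner]
    rw [dotProduct_comm (S *ᵥ z), hκs, hβ]
    simp
    field_simp
    ring
  simp only [hpt]
  have hexp : ∀ p : EuclideanSpace ℝ ι × ℝ,
      Complex.exp (((κ * (μ.ofLp ⬝ᵥ z) + inner ℝ p.1 (a + β • WithLp.toLp 2 z) + inner ℝ p.2 β : ℝ)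
        : ℂ) * Complex.I) = Complex.exp (((κ * (μ.ofLp ⬝ᵥ z) : ℝ) : ℂ) * Complex.I) *
        (Complex.exp ((inner ℝ p.1 (a + β • WithLp.toLp 2 z) : ℝ) * Complex.I) *
          Complex.exp ((inner ℝ p.2 β : ℝ) * Complex.I)) := fun p => by
    rw [← Complex.exp_add, ← Complex.exp_add]; push_cast; ring_nf
  simp only [hexp]
  rw [integral_const_mul, integral_prod_mul (fun x : EuclideanSpace ℝ ι =>
    Complex.exp ((inner ℝ x (a + β • WithLp.toLp 2 z) : ℝ) * Complex.I))
      (fun y : ℝ => Complex.exp ((inner ℝ y β : ℝ) * Complex.I)), ← charFun_apply, ← charFun_apply,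
    charFun_multivariateGaussian hS.posSemidef, charFun_gaussianReal]
  have h1 : charFunDual (multivariateGaussian μ (postCov S z σ))
      (L ∘SL ContinuousLinearMap.inl ℝ (EuclideanSpace ℝ ι) ℝ) =
      charFun (multivariateGaussian μ (postCov S z σ)) a := by
    rw [charFunDual_apply, charFun_apply]
    congr 1; ext e
    congr 3
    have := hL e 0
    simpa using this
  have h2 : charFunDual (gaussianReal (μ.ofLp ⬝ᵥ z) (Real.toNNReal s))
      (L ∘SL ContinuousLinearMap.inr ℝ (EuclideanSpace ℝ ι) ℝ) =
      charFun (gaussianReal (μ.ofLp ⬝ᵥ z) (Real.toNNReal s)) b := by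
    rw [charFunDual_apply, charFun_apply]
    congr 1; ext y
    congr 3
    have := hL 0 y
    simp only [inner_zero_left, zero_add] at this
    simpa [mul_comm] using this
  rw [h1, h2, charFun_multivariateGaussian (posDef_postCov hS z σ).posSemidef, charFun_gaussianReal,
    ← Complex.exp_add, ← Complex.exp_add, ← Complex.exp_add, Real.coe_toNNReal _ hs0.le,
    Real.coe_toNNReal _ (sq_nonneg σ)]
  congr 1
  have hquad : (a + β • WithLp.toLp 2 z).ofLp ⬝ᵥ S *ᵥ (a + β • WithLp.toLp 2 z).ofLp =
      qf S a.ofLp + 2 * β * (κ * s) + β ^ 2 * qf S z := by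
    have := qf_add_vec hs a.ofLp (β • z)
    rw [qf_smul_vec, mulVec_smul, dotProduct_smul, hκs, smul_eq_mul] at this
    change qf S (a.ofLp + β • z) = _
    rw [this]; ring
  have hquad' : a.ofLp ⬝ᵥ postCov S z σ *ᵥ a.ofLp = qf S a.ofLp - κ ^ 2 * s := by
    have := qf_postCov hS z a.ofLp hσ
    rw [hκs] at this
    change qf _ _ = _
    rw [this, ← hsdef]; field_simp
  have hin : inner ℝ (a + β • WithLp.toLp 2 z) μ = inner ℝ a μ + β * (μ.ofLp ⬝ᵥ z) := by
    rw [inner_add_left, real_inner_smul_left, inner_eq_dotProduct (WithLp.toLp 2 z),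
      dotProduct_comm]
  rw [hquad, hquad', hin, hβ]
  have hqs : qf S z = s - σ ^ 2 := by rw [hsdef]; ring
  rw [hqs]
  push_cast
  ring

end Conjugate

/-! ### Bayes' rule for the truncated Gaussian prior. -/

section ConjugateParam

open scoped MatrixOrder

variable {n m : ℕ}

/-- The noiseless observation `θᵀ z`. -/
def obs (θ : Param n m) (z : Fin n ⊕ Fin m → ℝ) : Fin n → ℝ := fun i => (θ i).ofLp ⬝ᵥ z

lemma obs_sumElim (θ : Param n m) (x : Fin n → ℝ) (u : Fin m → ℝ) :
    obs θ (Sum.elim x u) = matA θ *ᵥ x + matB θ *ᵥ u := by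
  ext i
  simp [obs, dotProduct, mulVec, matA, matB]

lemma measurable_obs {X : Type*} [MeasurableSpace X] {θ : X → Param n m}
    {z : X → Fin n ⊕ Fin m → ℝ} (hθ : Measurable θ) (hz : Measurable z) :
    Measurable fun x => obs (θ x) (z x) :=
  measurable_pi_lambda _ fun i => measurable_dotProduct
    ((WithLp.measurable_ofLp _ _).comp ((measurable_pi_apply i).comp hθ)) hz

/-- Posterior mean after observing `y = θᵀ z + w`. -/
noncomputable def postMean (μ : Param n m) (S : Matrix (Fin n ⊕ Fin m) (Fin n ⊕ Fin m) ℝ)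
    (z : Fin n ⊕ Fin m → ℝ) (σ : ℝ) (y : Fin n → ℝ) : Param n m := fun i =>
  μ i + ((y i - (μ i).ofLp ⬝ᵥ z) / (σ ^ 2 + qf S z)) • WithLp.toLp 2 (S *ᵥ z)

lemma gaussParam_add (μ c : Param n m) (S : Matrix (Fin n ⊕ Fin m) (Fin n ⊕ Fin m) ℝ) :
    gaussParam (μ + c) S = (gaussParam μ S).map (fun ϑ => ϑ + c) := by
  have hm : Measurable fun g : Param n m => fun i =>
      μ i + WithLp.toLp 2 (CFC.sqrt S *ᵥ (g i).ofLp) := by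
    refine measurable_pi_lambda _ fun i => measurable_const.add
      ((WithLp.measurable_toLp _ _).comp (measurable_mulVec measurable_const (by fun_prop)))
  rw [gaussParam_eq_map, gaussParam_eq_map, Measure.map_map (measurable_add_const c) hm]
  congr 1
  ext1 g
  ext1 i
  simp only [Function.comp, Pi.add_apply]
  abel

variable {μ : Param n m} {S : Matrix (Fin n ⊕ Fin m) (Fin n ⊕ Fin m) ℝ} {σ : ℝ}

/-- The predictive law of the next observation. -/
noncomputable abbrev predLaw (μ : Param n m) (S : Matrix (Fin n ⊕ Fin m) (Fin n ⊕ Fin m) ℝ)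
    (z : Fin n ⊕ Fin m → ℝ) (σ : ℝ) : Measure (Fin n → ℝ) :=
  Measure.pi fun i => gaussianReal ((μ i).ofLp ⬝ᵥ z) (Real.toNNReal (σ ^ 2 + qf S z))

/-- The pairs of a column and its observation are independent over the index, so the statement for
one column applies coordinatewise after regrouping the product. -/
lemma map_prod_conjugate_param (hS : S.PosDef) (z : Fin n ⊕ Fin m → ℝ) (hσ : 0 < σ) :
    ((gaussParam μ S).prod (noise n σ)).map (fun p =>
      ((fun i => p.1 i - ((obs p.1 z i + p.2 i - (μ i).ofLp ⬝ᵥ z) / (σ ^ 2 + qf S z)) •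
        WithLp.toLp 2 (S *ᵥ z) : Param n m), obs p.1 z + p.2)) =
      (gaussParam μ (postCov S z σ)).prod (predLaw μ S z σ) := by
  let E := EuclideanSpace ℝ (Fin n ⊕ Fin m)
  let φ : Fin n → E × ℝ → E × ℝ := fun i p =>
    (p.1 - ((p.1.ofLp ⬝ᵥ z + p.2 - (μ i).ofLp ⬝ᵥ z) / (σ ^ 2 + qf S z)) • WithLp.toLp 2 (S *ᵥ z),
          p.1.ofLp ⬝ᵥ z + p.2)
  have hφ : ∀ i, Measurable (φ i) := fun i => by
    have h0 : Measurable fun x : E => x.ofLp ⬝ᵥ z :=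
      measurable_dotProduct (WithLp.measurable_ofLp _ _) measurable_const
    have h1 : Measurable fun p : E × ℝ => p.1.ofLp ⬝ᵥ z + p.2 :=
      (h0.comp measurable_fst).add measurable_snd
    exact (measurable_fst.sub (((h1.sub_const _).div_const _).smul_const _)).prodMk h1
  let e := MeasurableEquiv.arrowProdEquivProdArrow E ℝ (Fin n)
  have he := measurePreserving_arrowProdEquivProdArrow E ℝ (Fin n)
    (fun i => multivariateGaussian (μ i) S) (fun _ => gaussianReal 0 (Real.toNNReal (σ ^ 2)))
  have he' := measurePreserving_arrowProdEquivProdArrow E ℝ (Fin n)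
    (fun i => multivariateGaussian (μ i) (postCov S z σ))
    (fun i => gaussianReal ((μ i).ofLp ⬝ᵥ z) (Real.toNNReal (σ ^ 2 + qf S z)))
  have hφmap : ∀ i, ((multivariateGaussian (μ i) S).prod
      (gaussianReal 0 (Real.toNNReal (σ ^ 2)))).map (φ i) =
      (multivariateGaussian (μ i) (postCov S z σ)).prod
        (gaussianReal ((μ i).ofLp ⬝ᵥ z) (Real.toNNReal (σ ^ 2 + qf S z))) := fun i =>
    map_prod_conjugate hS (μ i) z hσ
  have : ∀ i, IsProbabilityMeasure (((multivariateGaussian (μ i) S).prod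
      (gaussianReal 0 (Real.toNNReal (σ ^ 2)))).map (φ i)) := fun i =>
    Measure.isProbabilityMeasure_map (hφ i).aemeasurable
  have hpi := Measure.pi_map_pi (μ := fun i => (multivariateGaussian (μ i) S).prod
      (gaussianReal 0 (Real.toNNReal (σ ^ 2)))) (f := φ) fun i => (hφ i).aemeasurable
  simp only [hφmap] at hpi
  have hΦ : Measurable fun p : Param n m × (Fin n → ℝ) =>
      ((fun i => p.1 i - ((obs p.1 z i + p.2 i - (μ i).ofLp ⬝ᵥ z) / (σ ^ 2 + qf S z)) •
        WithLp.toLp 2 (S *ᵥ z) : Param n m), obs p.1 z + p.2) := by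
    have ho : Measurable fun p : Param n m × (Fin n → ℝ) => obs p.1 z :=
      measurable_obs measurable_fst measurable_const
    refine Measurable.prodMk (measurable_pi_lambda _ fun i => ?_) (ho.add measurable_snd)
    refine Measurable.sub (by fun_prop) (Measurable.smul_const ?_ _)
    exact ((((measurable_pi_apply i).comp ho).add (by fun_prop)).sub_const _).div_const _
  have hprod : (gaussParam μ S).prod (noise n σ) = Measure.map e (Measure.pi fun i =>
      (multivariateGaussian (μ i) S).prod (gaussianReal 0 (Real.toNNReal (σ ^ 2)))) :=
    he.map_eq.symm
  rw [hprod, Measure.map_map hΦ e.measurable]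
  have hcomp : (fun p : Param n m × (Fin n → ℝ) =>
      ((fun i => p.1 i - ((obs p.1 z i + p.2 i - (μ i).ofLp ⬝ᵥ z) / (σ ^ 2 + qf S z)) •
        WithLp.toLp 2 (S *ᵥ z) : Param n m), obs p.1 z + p.2)) ∘ e =
      e ∘ fun x i => φ i (x i) := rfl
  have hmφ : Measurable fun (x : Fin n → E × ℝ) i => φ i (x i) :=
    measurable_pi_lambda _ fun i => (hφ i).comp (measurable_pi_apply i)
  rw [hcomp, ← Measure.map_map e.measurable hmφ, hpi]
  exact he'.map_eq

lemma measurable_postMean_left (μ : Param n m) (S : Matrix (Fin n ⊕ Fin m) (Fin n ⊕ Fin m) ℝ)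
    (z : Fin n ⊕ Fin m → ℝ) (σ : ℝ) : Measurable (postMean μ S z σ) :=
  measurable_pi_lambda _ fun i => measurable_const.add
    (((((measurable_pi_apply i).sub_const _).div_const _)).smul_const _)

/-- Disintegration of parameter and observation along the observation. -/
lemma lintegral_conjugate (hS : S.PosDef) (z : Fin n ⊕ Fin m → ℝ) (hσ : 0 < σ)
    {F : Param n m × (Fin n → ℝ) → ℝ≥0∞} (hF : Measurable F) :
    ∫⁻ ϑ, ∫⁻ w, F (ϑ, obs ϑ z + w) ∂(noise n σ) ∂(gaussParam μ S) =
      ∫⁻ y, ∫⁻ ϑ, F (ϑ, y) ∂(gaussParam (postMean μ S z σ y) (postCov S z σ))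
        ∂(predLaw μ S z σ) := by
  let c : (Fin n → ℝ) → Param n m := fun y i =>
    ((y i - (μ i).ofLp ⬝ᵥ z) / (σ ^ 2 + qf S z)) • WithLp.toLp 2 (S *ᵥ z)
  have hc : Measurable c := measurable_pi_lambda _ fun i =>
    ((((measurable_pi_apply i).sub_const _).div_const _)).smul_const _
  let Φ : Param n m × (Fin n → ℝ) → Param n m × (Fin n → ℝ) := fun p =>
      ((fun i => p.1 i - ((obs p.1 z i + p.2 i - (μ i).ofLp ⬝ᵥ z) / (σ ^ 2 + qf S z)) •
        WithLp.toLp 2 (S *ᵥ z) : Param n m), obs p.1 z + p.2)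
  have ho : Measurable fun p : Param n m × (Fin n → ℝ) => obs p.1 z :=
      measurable_obs measurable_fst measurable_const
  have hΦ : Measurable Φ := by
    refine Measurable.prodMk (measurable_pi_lambda _ fun i => ?_) (ho.add measurable_snd)
    refine Measurable.sub (by fun_prop) (Measurable.smul_const ?_ _)
    exact ((((measurable_pi_apply i).comp ho).add (by fun_prop)).sub_const _).div_const _
  have hΨ : Measurable fun p : Param n m × (Fin n → ℝ) => F (p.1 + c p.2, p.2) :=
    hF.comp ((measurable_fst.add (hc.comp measurable_snd)).prodMk measurable_snd)
  have h1 : ∫⁻ p, F (p.1, obs p.1 z + p.2) ∂((gaussParam μ S).prod (noise n σ)) =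
      ∫⁻ p, F (p.1 + c p.2, p.2) ∂((gaussParam μ (postCov S z σ)).prod (predLaw μ S z σ)) := by
    rw [← map_prod_conjugate_param hS z hσ, lintegral_map hΨ hΦ]
    refine lintegral_congr fun p => ?_
    congr 2
    ext1 i
    simp [c, Φ]
  have hF1 : Measurable fun p : Param n m × (Fin n → ℝ) => F (p.1, obs p.1 z + p.2) :=
    hF.comp (measurable_fst.prodMk (ho.add measurable_snd))
  rw [lintegral_prod _ hF1.aemeasurable] at h1
  rw [h1, lintegral_prod_symm _ hΨ.aemeasurable]
  refine lintegral_congr fun y => ?_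
  have h2 : postMean μ S z σ y = μ + c y := rfl
  have h3 : Measurable fun ϑ => F (ϑ, y) := hF.comp measurable_prodMk_right
  rw [h2, gaussParam_add, lintegral_map h3 (measurable_add_const _)]

variable (pb : Problem n m)

lemma lintegral_trunc (F : Param n m → ℝ≥0∞) :
    ∫⁻ ϑ, F ϑ ∂(pb.trunc μ S) = (gaussParam μ S pb.supp)⁻¹ *
      ∫⁻ ϑ, pb.supp.indicator F ϑ ∂(gaussParam μ S) := by
  rw [Problem.trunc, ProbabilityTheory.cond, lintegral_smul_measure,
    lintegral_indicator pb.isCompact_supp.measurableSet, smul_eq_mul]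

/-- When the mass of the support is zero both sides vanish, so no positivity of the mass is
required; posterior masses can then be treated without a case distinction. -/
lemma mass_mul_lintegral_trunc (F : Param n m → ℝ≥0∞) :
    gaussParam μ S pb.supp * ∫⁻ ϑ, F ϑ ∂(pb.trunc μ S) =
      ∫⁻ ϑ, pb.supp.indicator F ϑ ∂(gaussParam μ S) := by
  rw [lintegral_trunc pb F, ← mul_assoc]
  by_cases h : gaussParam μ S pb.supp = 0
  · rw [lintegral_indicator pb.isCompact_supp.measurableSet, Measure.restrict_eq_zero.2 h]
    simp
  · rw [ENNReal.mul_inv_cancel h (measure_ne_top _ _), one_mul]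

/-- Truncation restricts the parameter only, so it commutes with disintegration along the
observation; just the normalization of the old law remains in front. -/
lemma lintegral_trunc_obs (hS : S.PosDef) (z : Fin n ⊕ Fin m → ℝ) (hσ : 0 < σ)
    {F : Param n m × (Fin n → ℝ) → ℝ≥0∞} (hF : Measurable F) :
    ∫⁻ ϑ, ∫⁻ w, F (ϑ, obs ϑ z + w) ∂(noise n σ) ∂(pb.trunc μ S) =
      (gaussParam μ S pb.supp)⁻¹ * ∫⁻ y, ∫⁻ ϑ, pb.supp.indicator (fun ϑ => F (ϑ, y)) ϑ
        ∂(gaussParam (postMean μ S z σ y) (postCov S z σ)) ∂(predLaw μ S z σ) := by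
  have hs := pb.isCompact_supp.measurableSet
  have ho : Measurable fun p : Param n m × (Fin n → ℝ) => obs p.1 z :=
      measurable_obs measurable_fst measurable_const
  have hF1 : Measurable fun p : Param n m × (Fin n → ℝ) => F (p.1, obs p.1 z + p.2) :=
    hF.comp (measurable_fst.prodMk (ho.add measurable_snd))
  have hF2 : Measurable fun p : Param n m × (Fin n → ℝ) => pb.supp.indicator (fun ϑ => F (ϑ, p.2)) p.1 := by
    have : (fun p : Param n m × (Fin n → ℝ) => pb.supp.indicator (fun ϑ => F (ϑ, p.2)) p.1) =
      (Prod.fst ⁻¹' pb.supp).indicator F := by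
      ext p
      by_cases h : p.1 ∈ pb.supp <;> simp [h, Set.indicator]
    rw [this]
    exact hF.indicator (measurable_fst hs)
  rw [lintegral_trunc pb, ← lintegral_conjugate hS z hσ hF2]
  congr 1
  refine lintegral_congr fun ϑ => ?_
  by_cases h : ϑ ∈ pb.supp
  · simp [h]
  · simp [h]

lemma trunc_univ_le_one : pb.trunc μ S Set.univ ≤ 1 := by
  rw [Problem.trunc, ProbabilityTheory.cond_apply pb.isCompact_supp.measurableSet, Set.inter_univ]
  exact ENNReal.inv_mul_le_one _

/-- Bayes' rule for the truncated Gaussian prior. -/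
lemma lintegral_trunc_bayes (hS : S.PosDef) (z : Fin n ⊕ Fin m → ℝ) (hσ : 0 < σ)
    {F : Param n m × (Fin n → ℝ) → ℝ≥0∞} (hF : Measurable F) :
    ∫⁻ ϑ, ∫⁻ w, F (ϑ, obs ϑ z + w) ∂(noise n σ) ∂(pb.trunc μ S) =
      ∫⁻ ϑ, ∫⁻ w, ∫⁻ ϑ', F (ϑ', obs ϑ z + w)
        ∂(pb.trunc (postMean μ S z σ (obs ϑ z + w)) (postCov S z σ))
        ∂(noise n σ) ∂(pb.trunc μ S) := by
  have hk : Measurable fun y => pb.trunc (postMean μ S z σ y) (postCov S z σ) :=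
    measurable_trunc_comp pb (measurable_postMean_left μ S z σ) measurable_const
  obtain ⟨κ, hκ⟩ : ∃ κ : Kernel (Fin n → ℝ) (Param n m),
      ∀ y, κ y = pb.trunc (postMean μ S z σ y) (postCov S z σ) := ⟨⟨_, hk⟩, fun _ => rfl⟩
  have : IsFiniteKernel κ := ⟨⟨1, ENNReal.one_lt_top, fun y => by
    rw [hκ]; exact trunc_univ_le_one pb⟩⟩
  obtain ⟨H, hH⟩ : ∃ H : (Fin n → ℝ) → ℝ≥0∞, ∀ y, H y = ∫⁻ ϑ', F (ϑ', y)
      ∂(pb.trunc (postMean μ S z σ y) (postCov S z σ)) := ⟨_, fun _ => rfl⟩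
  have hHm : Measurable H := by
    have h1 : Measurable fun y => ∫⁻ ϑ', F (ϑ', y) ∂(κ y) :=
      Measurable.lintegral_kernel_prod_right' (κ := κ) (f := fun p => F (p.2, p.1))
        (hF.comp measurable_swap)
    simp only [hκ, ← hH] at h1
    exact h1
  simp only [← hH]
  -- The disintegration is applied to F and to its posterior average `H`. For fixed y, restricting
  -- the untruncated posterior and integrating `F` equals its mass times `H y`.
  have e1 := lintegral_trunc_obs (μ := μ) pb hS z hσ hF
  have e2 := lintegral_trunc_obs (μ := μ) pb hS z hσ (F := fun p => H p.2) (hHm.comp measurable_snd)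
  rw [e1]
  refine Eq.trans ?_ e2.symm
  congr 1
  refine lintegral_congr fun y => ?_
  simp only
  rw [lintegral_indicator_const pb.isCompact_supp.measurableSet, mul_comm, hH]
  exact (mass_mul_lintegral_trunc pb fun ϑ => F (ϑ, y)).symm

/-- The expected inverse posterior mass of the support does not increase. -/
lemma lintegral_trunc_inv_mass_le (hS : S.PosDef) (z : Fin n ⊕ Fin m → ℝ) (hσ : 0 < σ) :
    ∫⁻ ϑ, ∫⁻ w, (gaussParam (postMean μ S z σ (obs ϑ z + w)) (postCov S z σ) pb.supp)⁻¹
        ∂(noise n σ) ∂(pb.trunc μ S) ≤ (gaussParam μ S pb.supp)⁻¹ := by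
  have hk : Measurable fun y => (gaussParam (postMean μ S z σ y) (postCov S z σ) pb.supp)⁻¹ :=
    ((Measure.measurable_coe pb.isCompact_supp.measurableSet).comp
      (measurable_gaussParam_comp (measurable_postMean_left μ S z σ) measurable_const)).inv
  refine (lintegral_trunc_obs pb hS z hσ (hk.comp measurable_snd)).le.trans ?_
  refine mul_le_of_le_one_right' ?_
  -- Given y, the restricted posterior has mass equal to the factor being inverted; the product is
  -- at most 1, also when that mass is 0.
  calc _ ≤ ∫⁻ _, 1 ∂(predLaw μ S z σ) := by
        refine lintegral_mono fun y => ?_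
        simp only [Function.comp]
        rw [lintegral_indicator_const pb.isCompact_supp.measurableSet]
        exact ENNReal.inv_mul_le_one _
    _ = 1 := by simp

end ConjugateParam

/-! ### Exponential moments of Gaussian quadratic forms. -/

section ExponentialMoments

open scoped MatrixOrder

/-- The exponent 1/4 is half the critical value 1/2; what remains is an unnormalized Gaussian
density of variance 2, which gives √2. -/
lemma lintegral_exp_sq_gaussianReal :
    ∫⁻ x, ENNReal.ofReal (Real.exp (x ^ 2 / 4)) ∂(gaussianReal 0 1) = ENNReal.ofReal √2 := by
  rw [gaussianReal_of_var_ne_zero 0 one_ne_zero,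
    lintegral_withDensity_eq_lintegral_mul _ (measurable_gaussianPDF 0 1) (by fun_prop)]
  have h1 : ∀ x : ℝ, (gaussianPDF 0 1 * fun x => ENNReal.ofReal (Real.exp (x ^ 2 / 4))) x =
      ENNReal.ofReal ((√(2 * Real.pi))⁻¹ * Real.exp (-(1 / 4) * x ^ 2)) := fun x => by
    simp only [Pi.mul_apply, gaussianPDF, gaussianPDFReal]
    rw [← ENNReal.ofReal_mul (by positivity), mul_assoc, ← Real.exp_add]
    simp only [NNReal.coe_one, mul_one, sub_zero]
    congr 3; ring
  simp only [h1]
  rw [← ofReal_integral_eq_lintegral_ofReal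
    ((integrable_exp_neg_mul_sq (by norm_num)).const_mul _)
    (Eventually.of_forall fun x => by positivity), integral_const_mul, integral_gaussian]
  congr 1
  rw [inv_mul_eq_div, ← Real.sqrt_div' _ (by positivity)]
  congr 1
  field_simp; norm_num

lemma lintegral_exp_sq_pi (ι : Type*) [Fintype ι] :
    ∫⁻ x, ENNReal.ofReal (Real.exp ((x ⬝ᵥ x) / 4))
      ∂(Measure.pi fun _ : ι => gaussianReal 0 1) = ENNReal.ofReal √2 ^ Fintype.card ι := by
  have hm : ∀ i : ι, Measurable fun x : ι → ℝ => ENNReal.ofReal (Real.exp (x i ^ 2 / 4)) :=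
    fun i => by fun_prop
  have hind : iIndepFun (fun i (x : ι → ℝ) => ENNReal.ofReal (Real.exp (x i ^ 2 / 4)))
      (Measure.pi fun _ : ι => gaussianReal 0 1) :=
    iIndepFun_pi (X := fun _ x => ENNReal.ofReal (Real.exp (x ^ 2 / 4))) fun _ => by fun_prop
  have h := lintegral_prod_eq_prod_lintegral_of_indepFun Finset.univ _ hind hm
  have h1 : ∀ x : ι → ℝ, ENNReal.ofReal (Real.exp ((x ⬝ᵥ x) / 4)) =
      ∏ i, ENNReal.ofReal (Real.exp (x i ^ 2 / 4)) := fun x => by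
    rw [← ENNReal.ofReal_prod_of_nonneg fun i _ => (Real.exp_pos _).le, ← Real.exp_sum]
    simp [dotProduct, Finset.sum_div, sq]
  simp only [h1]
  have h2 : ∀ i : ι, ∫⁻ x, ENNReal.ofReal (Real.exp (x i ^ 2 / 4))
      ∂(Measure.pi fun _ : ι => gaussianReal 0 1) = ENNReal.ofReal √2 := fun i => by
    rw [← lintegral_exp_sq_gaussianReal]
    exact (measurePreserving_eval (fun _ : ι => gaussianReal 0 1) i).lintegral_comp
      (f := fun x => ENNReal.ofReal (Real.exp (x ^ 2 / 4))) (by fun_prop)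
  rw [h]
  simp [h2]

lemma lintegral_exp_sq_stdGaussian (ι : Type*) [Fintype ι] :
    ∫⁻ x, ENNReal.ofReal (Real.exp ((x.ofLp ⬝ᵥ x.ofLp) / 4))
      ∂(stdGaussian (EuclideanSpace ℝ ι)) = ENNReal.ofReal √2 ^ Fintype.card ι := by
  have hd : Measurable fun x : EuclideanSpace ℝ ι => x.ofLp ⬝ᵥ x.ofLp :=
    measurable_dotProduct (WithLp.measurable_ofLp _ _) (WithLp.measurable_ofLp _ _)
  rw [← map_pi_eq_stdGaussian, lintegral_map (by fun_prop) (by fun_prop)]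
  exact lintegral_exp_sq_pi ι

lemma lintegral_exp_sq_noise (n : ℕ) {σ : ℝ} (hσ : 0 < σ) :
    ∫⁻ x, ENNReal.ofReal (Real.exp ((x ⬝ᵥ x) / (4 * σ ^ 2))) ∂(noise n σ) =
      ENNReal.ofReal √2 ^ n := by
  have h1 : gaussianReal 0 (Real.toNNReal (σ ^ 2)) = (gaussianReal 0 1).map (fun x => σ * x) := by
    rw [gaussianReal_map_const_mul]
    congr 1
    · simp
    · ext; simp [Real.coe_toNNReal _ (sq_nonneg σ)]
  have : IsProbabilityMeasure ((gaussianReal 0 1).map (fun x => σ * x)) :=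
    Measure.isProbabilityMeasure_map (by fun_prop)
  have h2 : noise n σ = (Measure.pi fun _ : Fin n => gaussianReal 0 1).map
      (fun x i => σ * x i) := by
    rw [noise, h1]
    exact (Measure.pi_map_pi (μ := fun _ : Fin n => gaussianReal 0 1)
      (f := fun _ x => σ * x) fun _ => by fun_prop).symm
  have hd : Measurable fun x : Fin n → ℝ => x ⬝ᵥ x :=
    measurable_dotProduct measurable_id measurable_id
  rw [h2, lintegral_map (by fun_prop) (by fun_prop)]
  have h3 := lintegral_exp_sq_pi (Fin n)
  rw [Fintype.card_fin] at h3
  rw [← h3]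
  refine lintegral_congr fun x => ?_
  congr 2
  have : (fun i => σ * x i) ⬝ᵥ (fun i => σ * x i) = σ ^ 2 * (x ⬝ᵥ x) := by
    simp only [dotProduct, Finset.mul_sum]
    exact Finset.sum_congr rfl fun i _ => by ring
  rw [this]; field_simp

variable {n m : ℕ}

/-- The combination `∑ vᵢ θ(i)` of the columns of a parameter. -/
noncomputable def colComb (v : EuclideanSpace ℝ (Fin n)) (ϑ : Param n m) :
    EuclideanSpace ℝ (Fin n ⊕ Fin m) := ∑ i, v i • ϑ i

@[fun_prop]
lemma measurable_colComb (v : EuclideanSpace ℝ (Fin n)) :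
    Measurable (colComb v : Param n m → _) := by
  unfold colComb; fun_prop

/-- The columns are independent standard Gaussians, so the variances v_i² add up to |v|² = 1. -/
lemma map_colComb_stdParam {v : EuclideanSpace ℝ (Fin n)} (hv : ‖v‖ = 1) :
    (stdParam n m).map (colComb v) = stdGaussian (EuclideanSpace ℝ (Fin n ⊕ Fin m)) := by
  have : IsProbabilityMeasure ((stdParam n m).map (colComb v)) :=
    Measure.isProbabilityMeasure_map (by fun_prop)
  refine Measure.ext_of_charFun (funext fun t => ?_)
  rw [charFun_apply, integral_map (by fun_prop) (by fun_prop), charFun_stdGaussian]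
  have h1 : ∀ g : Param n m, Complex.exp ((inner ℝ (colComb v g) t : ℝ) * Complex.I) =
      ∏ i, Complex.exp ((inner ℝ (g i) (v i • t) : ℝ) * Complex.I) := fun g => by
    rw [← Complex.exp_sum, ← Finset.sum_mul, ← Complex.ofReal_sum, colComb, sum_inner]
    simp only [real_inner_smul_left, real_inner_smul_right]
  simp only [h1]
  rw [integral_fintype_prod_eq_prod (fun i (x : EuclideanSpace ℝ (Fin n ⊕ Fin m)) =>
    Complex.exp ((inner ℝ x (v i • t) : ℝ) * Complex.I))]
  simp only [← charFun_apply, charFun_stdGaussian]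
  rw [← Complex.exp_sum]
  congr 1
  have hv2 : ∑ i, v i ^ 2 = 1 := by rw [← EuclideanSpace.real_norm_sq_eq, hv, one_pow]
  have h2 : ∀ i, (-((‖v i • t‖ : ℝ) : ℂ) ^ 2 / 2) =
      ((v i ^ 2 : ℝ) : ℂ) * (-((‖t‖ : ℝ) : ℂ) ^ 2 / 2) := fun i => by
    rw [norm_smul, ← Complex.ofReal_pow, mul_pow, Real.norm_eq_abs, sq_abs]
    push_cast; ring
  simp only [h2]
  rw [← Finset.sum_mul, ← Complex.ofReal_sum, hv2]
  simp

/-- After standardization by the square root of S, the form is the squared norm of a standard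
Gaussian vector in dimension n + m, whatever S and v are. -/
lemma lintegral_exp_qf_gaussParam {μ : Param n m}
    {S : Matrix (Fin n ⊕ Fin m) (Fin n ⊕ Fin m) ℝ} (hS : S.PosDef)
    {v : EuclideanSpace ℝ (Fin n)} (hv : ‖v‖ = 1) :
    ∫⁻ ϑ, ENNReal.ofReal (Real.exp (qf S⁻¹ (colComb v (ϑ - μ)).ofLp / 4)) ∂(gaussParam μ S) =
      ENNReal.ofReal √2 ^ (n + m) := by
  have hmap : Measurable fun (g : Param n m) i =>
      μ i + WithLp.toLp 2 (CFC.sqrt S *ᵥ (g i).ofLp) := by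
    refine measurable_pi_lambda _ fun i => measurable_const.add
      ((WithLp.measurable_toLp _ _).comp (measurable_mulVec measurable_const (by fun_prop)))
  have hF : Measurable fun ϑ : Param n m =>
      ENNReal.ofReal (Real.exp (qf S⁻¹ (colComb v (ϑ - μ)).ofLp / 4)) := by
    have : Measurable fun ϑ : Param n m => qf S⁻¹ (colComb v (ϑ - μ)).ofLp :=
      measurable_qf measurable_const ((WithLp.measurable_ofLp _ _).comp
        ((measurable_colComb v).comp (by fun_prop)))
    fun_prop
  rw [gaussParam_eq_map, lintegral_map hF hmap]
  have h1 : ∀ g : Param n m, (colComb v ((fun i => μ i +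
      WithLp.toLp 2 (CFC.sqrt S *ᵥ (g i).ofLp)) - μ)).ofLp =
      CFC.sqrt S *ᵥ (colComb v g).ofLp := fun g => by
    simp only [colComb, Pi.sub_apply, add_sub_cancel_left, WithLp.ofLp_sum, WithLp.ofLp_smul,
      mulVec_sum, mulVec_smul]
  simp only [h1, ← qf_transpose_mul_mul, sqrt_mul_inv_mul_sqrt hS]
  have h2 := lintegral_exp_sq_stdGaussian (Fin n ⊕ Fin m)
  have hd : Measurable fun x : EuclideanSpace ℝ (Fin n ⊕ Fin m) => x.ofLp ⬝ᵥ x.ofLp :=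
    measurable_dotProduct (WithLp.measurable_ofLp _ _) (WithLp.measurable_ofLp _ _)
  rw [← map_colComb_stdParam hv, lintegral_map (by fun_prop) (by fun_prop)] at h2
  simp only [qf, one_mulVec]
  rw [h2]
  simp

end ExponentialMoments

/-! ### A norming set of unit vectors. -/

section Net

/-- A finite set of at most `5 ^ n` unit vectors that norms `ℝⁿ` up to a factor `2`. -/
lemma exists_norming_set (n : ℕ) (hn : n ≠ 0) : ∃ N : Finset (EuclideanSpace ℝ (Fin n)),
    N.Nonempty ∧ N.card ≤ 5 ^ n ∧ (∀ v ∈ N, ‖v‖ = 1) ∧ ∀ y, ∃ v ∈ N, ‖y‖ ≤ 2 * inner ℝ v y := by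
  classical
  have : Nonempty (Fin n) := ⟨⟨0, Nat.pos_of_ne_zero hn⟩⟩
  let p : Finset (EuclideanSpace ℝ (Fin n)) → Prop := fun s => (∀ v ∈ s, ‖v‖ = 1) ∧ ∀ v ∈ s, ∀ w ∈ s, v ≠ w → 1 ≤ ‖v - w‖
  have hcard : ∀ s, p s → s.card ≤ 5 ^ n := fun s hs => by
    have := Besicovitch.card_le_of_separated s (fun c hc => by rw [hs.1 c hc]; norm_num) hs.2
    simpa using this
  -- A 1-separated set of unit vectors with the most elements exists because of the bound 5^n; by
  -- maximality each unit vector is within distance 1 of it, so has inner product at least 1/2 with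
  -- some element.
  obtain ⟨N, hN, hmax⟩ : ∃ N, p N ∧ ∀ s, p s → s.card ≤ N.card := by
    have hb : BddAbove (Finset.card '' {s | p s}) :=
      ⟨5 ^ n, by rintro _ ⟨s, hs, rfl⟩; exact hcard s hs⟩
    have hne : (Finset.card '' {s | p s}).Nonempty := ⟨0, ∅, by simp [p], rfl⟩
    obtain ⟨N, hN, hNc⟩ := Nat.sSup_mem hne hb
    exact ⟨N, hN, fun s hs => by rw [hNc]; exact le_csSup hb ⟨s, hs, rfl⟩⟩
  have hcover : ∀ x : EuclideanSpace ℝ (Fin n), ‖x‖ = 1 → ∃ v ∈ N, ‖v - x‖ ≤ 1 := fun x hx => by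
    by_contra! hcon
    have hxN : x ∉ N := fun h => by
      have := hcon x h
      norm_num at this
    have hp : p (insert x N) := by
      refine ⟨fun v hv => ?_, fun v hv w hw hvw => ?_⟩
      · rcases Finset.mem_insert.1 hv with rfl | h
        exacts [hx, hN.1 v h]
      · rcases Finset.mem_insert.1 hv with rfl | h <;> rcases Finset.mem_insert.1 hw with rfl | h'
        · exact absurd rfl hvw
        · rw [norm_sub_rev]; exact (hcon w h').le
        · exact (hcon v h).le
        · exact hN.2 v h w h' hvw
    have := hmax _ hp
    rw [Finset.card_insert_of_notMem hxN] at this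
    omega
  obtain ⟨e, he⟩ : ∃ e : EuclideanSpace ℝ (Fin n), ‖e‖ = 1 := 
    ⟨EuclideanSpace.single ⟨0, Nat.pos_of_ne_zero hn⟩ 1, by simp⟩
  have hNne : N.Nonempty := by obtain ⟨v, hv, -⟩ := hcover e he; exact ⟨v, hv⟩
  refine ⟨N, hNne, hcard N hN, hN.1, fun y => ?_⟩
  by_cases hy : y = 0
  · obtain ⟨v, hv⟩ := hNne
    exact ⟨v, hv, by simp [hy]⟩
  have hy0 : 0 < ‖y‖ := norm_pos_iff.2 hy
  obtain ⟨v, hv, hvx⟩ := hcover (‖y‖⁻¹ • y) (by rw [norm_smul, norm_inv, norm_norm]; field_simp)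
  refine ⟨v, hv, ?_⟩
  have h1 : ‖v - ‖y‖⁻¹ • y‖ ^ 2 = 2 - 2 * (‖y‖⁻¹ * inner ℝ v y) := by
    rw [norm_sub_sq_real, hN.1 v hv, real_inner_smul_right, norm_smul, norm_inv, norm_norm,
      inv_mul_cancel₀ hy0.ne']
    ring
  have h2 : ‖v - ‖y‖⁻¹ • y‖ ^ 2 ≤ 1 := pow_le_one₀ (norm_nonneg _) hvx
  have h3 : 1 ≤ 2 * (‖y‖⁻¹ * inner ℝ v y) := by linarith
  calc ‖y‖ = ‖y‖ * 1 := (mul_one _).symm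
    _ ≤ ‖y‖ * (2 * (‖y‖⁻¹ * inner ℝ v y)) := by gcongr
    _ = 2 * inner ℝ v y := by field_simp

end Net

/-! ### Functions of an observed history. -/

section Known

variable {Ω H : Type*} [MeasurableSpace H]

/-- `f` is a measurable function of `η`. -/
def Known (η : Ω → H) {Y : Type*} [MeasurableSpace Y] (f : Ω → Y) : Prop :=
  ∃ g : H → Y, Measurable g ∧ ∀ ω, f ω = g (η ω)

variable {η : Ω → H} {Y Z : Type*} [MeasurableSpace Y] [MeasurableSpace Z]

lemma Known.comp {f : Ω → Y} (hf : Known η f) {g : Y → Z} (hg : Measurable g) :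
    Known η fun ω => g (f ω) := by
  obtain ⟨k, hk, hfk⟩ := hf
  exact ⟨g ∘ k, hg.comp hk, fun ω => by simp [hfk ω]⟩

lemma Known.prodMk {f : Ω → Y} (hf : Known η f) {g : Ω → Z} (hg : Known η g) :
    Known η fun ω => (f ω, g ω) := by
  obtain ⟨k, hk, hfk⟩ := hf
  obtain ⟨l, hl, hgl⟩ := hg
  exact ⟨fun h => (k h, l h), hk.prodMk hl, fun ω => by simp [hfk ω, hgl ω]⟩

lemma known_pi {ι : Type*} {f : Ω → ι → Y} (hf : ∀ i, Known η fun ω => f ω i) : Known η f := by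
  choose k hk hfk using hf
  exact ⟨fun h i => k i h, measurable_pi_lambda _ hk, fun ω => funext fun i => hfk i ω⟩

lemma known_const (c : Y) : Known η fun _ => c := ⟨fun _ => c, measurable_const, fun _ => rfl⟩

lemma Known.trans {H' : Type*} [MeasurableSpace H'] {η' : Ω → H'} {f : Ω → Y} (hf : Known η f)
    (h : Known η' η) : Known η' f := by
  obtain ⟨k, hk, hfk⟩ := hf
  obtain ⟨l, hl, hfl⟩ := h
  exact ⟨k ∘ l, hk.comp hl, fun ω => by rw [hfk, hfl]; rfl⟩

lemma Known.measurable {mΩ : MeasurableSpace Ω} {f : Ω → Y} (hf : Known η f) (h : Measurable η) :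
    Measurable f := by
  obtain ⟨k, hk, hfk⟩ := hf
  rw [show f = k ∘ η from funext hfk]
  exact hk.comp h

end Known

/-! ### The episode clock. -/

section Clock

variable {Tmin : ℕ}

open Classical in
lemma clock_succ (D : ℕ → ℝ) (t : ℕ) : clock Tmin D (t + 1) =
    if EndsAt Tmin D (clock Tmin D t) (t + 1) then
      ((t : ℤ) + 1, (t : ℤ) + 1 - (clock Tmin D t).1) else clock Tmin D t := rfl

/-- At time 1 the fictitious start `-Tmin` makes both tests succeed; this yields t_1 = 1 and T_0 =
T_min + 1. -/
lemma clock_bounds (D : ℕ → ℝ) : ∀ t : ℕ, 1 ≤ t →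
    1 ≤ (clock Tmin D t).1 ∧ (clock Tmin D t).1 ≤ t ∧ (Tmin : ℤ) + 1 ≤ (clock Tmin D t).2
  | 0, h => by omega
  | 1, _ => by simp [clock, EndsAt]
  | t + 2, _ => by
    obtain ⟨h1, h2, h3⟩ := clock_bounds D (t + 1) (by omega)
    rw [clock_succ]
    split_ifs with h
    · have := h.1
      push_cast at *
      refine ⟨?_, le_rfl, ?_⟩ <;> omega
    · push_cast at *
      exact ⟨h1, by omega, h3⟩

lemma startsAt_one (D : ℕ → ℝ) : StartsAt Tmin D 1 := by
  simp [StartsAt, clock, EndsAt]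

lemma endsAt_congr {D D' : ℕ → ℝ} {t k : ℕ} (hk : 1 ≤ k) (hkt : k ≤ t)
    (h : ∀ s, 1 ≤ s → s ≤ t → D s = D' s) :
    EndsAt Tmin D (clock Tmin D k) t ↔ EndsAt Tmin D' (clock Tmin D k) t := by
  obtain ⟨h1, h2, h3⟩ := clock_bounds (Tmin := Tmin) D k hk
  rw [EndsAt, EndsAt, h t (by omega) le_rfl, h (clock Tmin D k).1.toNat (by omega) (by omega)]

/-- The clock at time t reads the determinants at times 1, …, t only. Later determinants may be
overwritten, which makes the clock a function of the history. -/
lemma clock_congr {D D' : ℕ → ℝ} : ∀ t : ℕ, (∀ s, 1 ≤ s → s ≤ t → D s = D' s) →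
    clock Tmin D t = clock Tmin D' t
  | 0, _ => rfl
  | 1, _ => by simp [clock, EndsAt]
  | t + 2, h => by
    have ih := clock_congr (t + 1) fun s h1 h2 => h s h1 (by omega)
    have key := endsAt_congr (Tmin := Tmin) (k := t + 1) (by omega) (by omega) h
    rw [clock_succ D (t + 1), clock_succ D' (t + 1), ← ih]
    split_ifs with h1 h2 h2 <;> first | rfl | exact absurd (key.1 h1) h2 | exact absurd (key.2 h2) h1

lemma startsAt_congr {D D' : ℕ → ℝ} {t : ℕ} (ht : 1 ≤ t)
    (h : ∀ s, 1 ≤ s → s ≤ t → D s = D' s) : StartsAt Tmin D t ↔ StartsAt Tmin D' t := by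
  rcases Nat.lt_or_ge 1 t with h1 | h1
  · rw [StartsAt, StartsAt, ← clock_congr (t - 1) fun s h1 h2 => h s h1 (by omega),
      endsAt_congr (by omega) (by omega) h]
  · obtain rfl : t = 1 := by omega
    exact iff_of_true (startsAt_one D) (startsAt_one D')

lemma measurableSet_endsAt {X : Type*} [MeasurableSpace X] {D : X → ℕ → ℝ} (hD : Measurable D)
    {s : X → ℤ × ℤ} (hs : Measurable s) (t : ℕ) : MeasurableSet {a | EndsAt Tmin (D a) (s a) t} := by
  have h1 : Measurable fun a => (s a).1 := measurable_fst.comp hs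
  have h2 : Measurable fun a => (s a).2 := measurable_snd.comp hs
  have hD' : Measurable fun a => D a (s a).1.toNat := by
    -- Evaluation at a random index is measurable because the index takes countably many values.
    have : Measurable fun p : ℤ × (ℕ → ℝ) => p.2 p.1.toNat :=
      measurable_from_prod_countable_right fun k =>
        (measurable_pi_apply (X := fun _ : ℕ => ℝ) k.toNat)
    exact this.comp (h1.prodMk hD)
  have hDt : Measurable fun a => D a t := (measurable_pi_apply t).comp hD
  refine MeasurableSet.inter (s₁ := {a | (t : ℤ) - (s a).1 > Tmin}) ?_
    (MeasurableSet.union (s₁ := {a | (t : ℤ) - (s a).1 > (s a).2}) ?_ ?_)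
  · exact measurableSet_lt measurable_const (measurable_const.sub h1)
  · exact measurableSet_lt h2 (measurable_const.sub h1)
  · exact measurableSet_lt hDt (hD'.const_mul _)

open Classical in
lemma measurable_clock : ∀ t : ℕ, Measurable fun D : ℕ → ℝ => clock Tmin D t
  | 0 => measurable_const
  | t + 1 => by
    have ih := measurable_clock t
    simp only [clock]
    refine Measurable.ite (measurableSet_endsAt measurable_id ih _) ?_ ih
    exact measurable_const.prodMk (measurable_const.sub (measurable_fst.comp ih))

lemma measurableSet_startsAt (t : ℕ) : MeasurableSet {D : ℕ → ℝ | StartsAt Tmin D t} :=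
  measurableSet_endsAt measurable_id (measurable_clock _) _

end Clock

/-! ### Histories of a run and the law of the samples. -/

section Posterior

variable {n m : ℕ} {pb : Problem n m} {σ : ℝ} {Tmin : ℕ} {Ω : Type*} [mΩ : MeasurableSpace Ω]
  {P : Measure Ω}

namespace Run

/-- The regressor `z_t = (x_t, u_t)`. -/
def z (r : Run pb σ Tmin P) (t : ℕ) (ω : Ω) : Fin n ⊕ Fin m → ℝ := Sum.elim (r.x t ω) (r.u t ω)

/-- `det Σ_t` along a run. -/
noncomputable def detSig (r : Run pb σ Tmin P) (ω : Ω) (t : ℕ) : ℝ := (r.Sig t ω).det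

/-- The clock of the run. -/
noncomputable def clk (r : Run pb σ Tmin P) (t : ℕ) (ω : Ω) : ℤ × ℤ :=
  clock Tmin (r.detSig ω) t

/-- The event that an episode starts at `t`. -/
def startSet (r : Run pb σ Tmin P) (t : ℕ) : Set Ω := {ω | StartsAt Tmin (r.detSig ω) t}

/-- The information before sampling at time `t`, with the true parameter. -/
abbrev preAlg (r : Run pb σ Tmin P) (t : ℕ) : MeasurableSpace Ω :=
  MeasurableSpace.comap r.θ inferInstance ⊔ ⨆ s ∈ Finset.Ico 1 t,
    (MeasurableSpace.comap (r.w s) inferInstance ⊔ MeasurableSpace.comap (r.θbar s) inferInstance)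

/-- The information after sampling at time `t`, with the true parameter. -/
abbrev postAlg (r : Run pb σ Tmin P) (t : ℕ) : MeasurableSpace Ω :=
  MeasurableSpace.comap r.θ inferInstance ⊔
    (⨆ s ∈ Finset.Ico 1 t, MeasurableSpace.comap (r.w s) inferInstance) ⊔
    ⨆ s ∈ Finset.Icc 1 t, MeasurableSpace.comap (r.θbar s) inferInstance

variable (r : Run pb σ Tmin P)

lemma preAlg_le_postAlg (t : ℕ) : r.preAlg t ≤ r.postAlg t := by
  refine sup_le (le_sup_of_le_left le_sup_left) (iSup₂_le fun s hs => sup_le ?_ ?_)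
  · exact le_sup_of_le_left (le_sup_of_le_right
      (le_iSup₂ (f := fun s _ => MeasurableSpace.comap (r.w s) inferInstance) s hs))
  · refine le_sup_of_le_right
      (le_iSup₂ (f := fun s _ => MeasurableSpace.comap (r.θbar s) inferInstance) s ?_)
    simp only [Finset.mem_Ico, Finset.mem_Icc] at *
    omega

lemma comap_w_le {s t : ℕ} (h1 : 1 ≤ s) (h : s < t) :
    MeasurableSpace.comap (r.w s) inferInstance ≤ r.preAlg t :=
  le_sup_of_le_right (le_trans le_sup_left (le_iSup₂ (f := fun s _ =>
    MeasurableSpace.comap (r.w s) inferInstance ⊔ MeasurableSpace.comap (r.θbar s) inferInstance)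
    s (Finset.mem_Ico.2 ⟨h1, h⟩)))

lemma comap_θbar_le {s t : ℕ} (h1 : 1 ≤ s) (h : s < t) :
    MeasurableSpace.comap (r.θbar s) inferInstance ≤ r.preAlg t :=
  le_sup_of_le_right (le_trans le_sup_right (le_iSup₂ (f := fun s _ =>
    MeasurableSpace.comap (r.w s) inferInstance ⊔ MeasurableSpace.comap (r.θbar s) inferInstance)
    s (Finset.mem_Ico.2 ⟨h1, h⟩)))

lemma postAlg_le_preAlg (t : ℕ) : r.postAlg t ≤ r.preAlg (t + 1) := by
  refine sup_le (sup_le le_sup_left (iSup₂_le fun s hs => ?_)) (iSup₂_le fun s hs => ?_)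
  · rw [Finset.mem_Ico] at hs
    exact r.comap_w_le hs.1 (by omega)
  · rw [Finset.mem_Icc] at hs
    exact r.comap_θbar_le hs.1 (by omega)

lemma preAlg_le (t : ℕ) : r.preAlg t ≤ mΩ :=
  sup_le r.measurable_θ.comap_le
    (iSup₂_le fun s _ => sup_le (r.measurable_w s).comap_le (r.measurable_θbar s).comap_le)

lemma measurable_θ_pre (t : ℕ) : Measurable[r.preAlg t] r.θ :=
  measurable_iff_comap_le.2 le_sup_left

lemma measurable_θbar_post {t : ℕ} (ht : 1 ≤ t) : Measurable[r.postAlg t] (r.θbar t) :=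
  measurable_iff_comap_le.2 (le_sup_of_le_right (le_iSup₂
    (f := fun s _ => MeasurableSpace.comap (r.θbar s) inferInstance) t
      (Finset.mem_Icc.2 ⟨ht, le_rfl⟩)))

lemma posDef_Sig : ∀ t : ℕ, 1 ≤ t → ∀ ω, (r.Sig t ω).PosDef
  | 0, h => by omega
  | 1, _ => fun ω => by rw [r.Sig_one]; exact pb.posDef_cov
  | t + 2, _ => fun ω => by
    rw [r.Sig_succ (t + 1) (by omega)]
    exact posDef_postCov (posDef_Sig (t + 1) (by omega) ω) _ σ

lemma Sig_succ' {t : ℕ} (ht : 1 ≤ t) (ω : Ω) :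
    r.Sig (t + 1) ω = postCov (r.Sig t ω) (r.z t ω) σ := r.Sig_succ t ht ω

lemma θhat_succ' {t : ℕ} (ht : 1 ≤ t) (ω : Ω) : r.θhat (t + 1) ω =
    postMean (r.θhat t ω) (r.Sig t ω) (r.z t ω) σ (r.x (t + 1) ω) :=
  funext fun i => r.θhat_succ t ht ω i

lemma x_succ' {t : ℕ} (ht : 1 ≤ t) (ω : Ω) :
    r.x (t + 1) ω = obs (r.θ ω) (r.z t ω) + r.w t ω := by
  rw [r.x_succ t ht ω, z, obs_sumElim]

/-- `η` is an observed history up to the state `x_t`. -/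
structure IsHistory (r : Run pb σ Tmin P) (t : ℕ) {H : Type} [MeasurableSpace H] (η : Ω → H) :
    Prop where
  measurable : Measurable[r.preAlg t] η
  known_x : Known η (r.x t)
  known_θhat : Known η (r.θhat t)
  known_Sig : ∀ s, 1 ≤ s → s ≤ t → Known η (r.Sig s)
  known_θbar : 2 ≤ t → Known η (r.θbar (t - 1))
  law : ∀ F : H × Param n m → ℝ≥0∞, Measurable F → ∫⁻ ω, F (η ω, r.θ ω) ∂P =
    ∫⁻ ω, ∫⁻ ϑ, F (η ω, ϑ) ∂(pb.trunc (r.θhat t ω) (r.Sig t ω)) ∂P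

variable {r}

open Classical in
lemma IsHistory.known_detSig {t : ℕ} {H : Type} [MeasurableSpace H] {η : Ω → H}
    (h : r.IsHistory t η) : Known η fun ω s => if 1 ≤ s ∧ s ≤ t then r.detSig ω s else 0 := by
  refine known_pi fun s => ?_
  by_cases hs : 1 ≤ s ∧ s ≤ t
  · simp only [hs, and_self, if_true]
    exact (h.known_Sig s hs.1 hs.2).comp (measurable_matrix_det measurable_id)
  · simp only [hs, if_false]
    exact known_const 0

lemma IsHistory.known_clk {t : ℕ} {H : Type} [MeasurableSpace H] {η : Ω → H}
    (h : r.IsHistory t η) : Known η (r.clk t) := by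
  classical
  convert h.known_detSig.comp (measurable_clock (Tmin := Tmin) t) using 2 with ω
  exact clock_congr t fun s h1 h2 => by simp [h1, h2]

lemma IsHistory.exists_startSet {t : ℕ} (ht : 1 ≤ t) {H : Type} [MeasurableSpace H] {η : Ω → H}
    (h : r.IsHistory t η) : ∃ s : Set H, MeasurableSet s ∧ r.startSet t = η ⁻¹' s := by
  classical
  obtain ⟨g, hg, hgη⟩ := h.known_detSig
  refine ⟨g ⁻¹' {D | StartsAt Tmin D t}, hg (measurableSet_startsAt t), ?_⟩
  ext ω
  rw [Set.preimage_preimage, Set.mem_preimage, ← hgη]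
  exact startsAt_congr ht fun s h1 h2 => by simp [h1, h2]

/-- The sampling rule is conditional on all the information in `preAlg`, including the true
parameter. Hence `κ` may contain θ, which later yields the conditional independence of θ and the
sample. -/
lemma lintegral_sample [IsProbabilityMeasure P] {t : ℕ} (ht : 1 ≤ t) {K : Type*}
    [MeasurableSpace K] {κ : Ω → K} (hκ : Measurable[r.preAlg t] κ) {s : Set K}
    (hs : MeasurableSet s) (hst : r.startSet t = κ ⁻¹' s)
    (h1 : Known κ (r.θhat t)) (h2 : Known κ (r.Sig t)) {F : K × Param n m → ℝ≥0∞}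
    (hF : Measurable F) :
    ∫⁻ ω in r.startSet t, F (κ ω, r.θbar t ω) ∂P =
      ∫⁻ ω in r.startSet t, ∫⁻ b, F (κ ω, b) ∂(pb.trunc (r.θhat t ω) (r.Sig t ω)) ∂P := by
  obtain ⟨g1, hg1, e1⟩ := h1
  obtain ⟨g2, hg2, e2⟩ := h2
  have hκ' : Measurable κ := hκ.mono (r.preAlg_le t) le_rfl
  obtain ⟨M, hM⟩ : ∃ M : Kernel K (Param n m), ∀ k, M k = pb.trunc (g1 k) (g2 k) :=
    ⟨⟨_, measurable_trunc_comp pb hg1 hg2⟩, fun _ => rfl⟩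
  have : IsFiniteKernel M := ⟨⟨1, ENNReal.one_lt_top, fun y => by
    rw [hM]; exact trunc_univ_le_one pb⟩⟩
  have htr : ∀ ω, pb.trunc (r.θhat t ω) (r.Sig t ω) = M (κ ω) := fun ω => by rw [hM, e1, e2]
  have hpair : Measurable fun ω => (κ ω, r.θbar t ω) := hκ'.prodMk (r.measurable_θbar t)
  -- Two finite measures agree if they agree on rectangles A × E. There the conditional probability
  -- of the sample is integrated over `κ ⁻¹' A` within the start set, an event known before
  -- sampling.
  have key : (P.restrict (r.startSet t)).map (fun ω => (κ ω, r.θbar t ω)) =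
      ((P.restrict (r.startSet t)).map κ).compProd M := by
    refine Measure.ext_prod fun {A E} hA hE => ?_
    rw [Measure.map_apply hpair (hA.prod hE), Measure.compProd_apply_prod hA hE,
      Measure.restrict_apply (hpair (hA.prod hE)), setLIntegral_map hA (M.measurable_coe hE) hκ',
      Measure.restrict_restrict (hκ' hA)]
    have hB : MeasurableSet[r.preAlg t] (κ ⁻¹' A ∩ r.startSet t) := by
      rw [hst]; exact (hκ hA).inter (hκ hs)
    have hBm := r.preAlg_le t _ hB
    set B := κ ⁻¹' A ∩ r.startSet t with hBdef
    have hEm : MeasurableSet (r.θbar t ⁻¹' E) := r.measurable_θbar t hE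
    have c1 := setIntegral_condExp (μ := P) (r.preAlg_le t) (s := B)
      (f := (r.θbar t ⁻¹' E).indicator fun _ => (1 : ℝ))
      ((integrable_const (1 : ℝ)).indicator hEm) hB
    have c2 : ∫ ω in B, (P[(r.θbar t ⁻¹' E).indicator fun _ => (1 : ℝ) | r.preAlg t]) ω ∂P =
        ∫ ω in B, (M (κ ω)).real E ∂P := by
      refine setIntegral_congr_ae hBm ?_
      filter_upwards [r.sample t ht E hE] with ω hω hωB
      rw [← htr]
      exact hω hωB.2
    rw [c2, setIntegral_indicator hEm, setIntegral_one_eq_measureReal] at c1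
    have c3 : ENNReal.ofReal (∫ ω in B, (M (κ ω)).real E ∂P) = ∫⁻ ω in B, M (κ ω) E ∂P := by
      have hle : ∀ ω, M (κ ω) E ≤ 1 := fun ω => (measure_mono (Set.subset_univ E)).trans (by
        rw [hM]; exact trunc_univ_le_one pb)
      rw [integral_eq_lintegral_of_nonneg_ae (ae_of_all _ fun _ => measureReal_nonneg)
        (((M.measurable_coe hE).comp hκ').ennreal_toReal.aestronglyMeasurable),
        ENNReal.ofReal_toReal]
      · refine lintegral_congr fun ω => ?_
        rw [Measure.real, ENNReal.ofReal_toReal ((hle ω).trans_lt ENNReal.one_lt_top).ne]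
      · refine ne_of_lt (lt_of_le_of_lt (b := ∫⁻ _ in B, 1 ∂P) (lintegral_mono fun ω => ?_) ?_)
        · rw [Measure.real, ENNReal.ofReal_toReal ((hle ω).trans_lt ENNReal.one_lt_top).ne]
          exact hle ω
        · simp
    rw [← c3, c1, ofReal_measureReal]
    congr 1
    ext ω
    simp only [hBdef, Set.mem_inter_iff, Set.mem_preimage, Set.mem_prod]
    tauto
  simp only [htr]
  have hFm : Measurable fun k => ∫⁻ b, F (k, b) ∂(M k) := by
    exact Measurable.lintegral_kernel_prod_right' (κ := M) (f := F) hF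
  rw [← lintegral_map (f := F) hF hpair, key, Measure.lintegral_compProd hF,
    lintegral_map hFm hκ']

end Run

end Posterior

/-! ### The posterior of the true parameter is the truncated Gaussian μ_t. -/

section PosteriorInduction

variable {n m : ℕ} {pb : Problem n m} {σ : ℝ} {Tmin : ℕ} {Ω : Type*} [mΩ : MeasurableSpace Ω]
  {P : Measure Ω} {r : Run pb σ Tmin P}

namespace Run

variable {t : ℕ} {H : Type} [MeasurableSpace H] {η : Ω → H}

lemma lintegral_noise_of_post [IsProbabilityMeasure P] (ht : 1 ≤ t) {K : Type*}
    [MeasurableSpace K] {κ : Ω → K} (hκ : Measurable[r.postAlg t] κ)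
    {F : K × (Fin n → ℝ) → ℝ≥0∞} (hF : Measurable F) :
    ∫⁻ ω, F (κ ω, r.w t ω) ∂P = ∫⁻ ω, ∫⁻ y, F (κ ω, y) ∂(noise n σ) ∂P := by
  have hκ' : Measurable κ := hκ.mono ((r.postAlg_le_preAlg t).trans (r.preAlg_le _)) le_rfl
  have hind : IndepFun κ (r.w t) P := by
    rw [IndepFun_iff_Indep]
    exact (indep_of_indep_of_le_right (r.indep_w t ht) hκ.comap_le).symm
  have hmap := (indepFun_iff_map_prod_eq_prod_map_map hκ'.aemeasurable
    (r.measurable_w t).aemeasurable).1 hind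
  rw [r.law_w t ht] at hmap
  have : IsProbabilityMeasure (P.map κ) := Measure.isProbabilityMeasure_map hκ'.aemeasurable
  rw [← lintegral_map (f := F) hF (hκ'.prodMk (r.measurable_w t)), hmap,
    lintegral_prod _ hF.aemeasurable, lintegral_map (Measurable.lintegral_prod_right' hF) hκ']

lemma IsHistory.measurable' (h : r.IsHistory t η) : Measurable η :=
  h.measurable.mono (r.preAlg_le t) le_rfl

lemma IsHistory.law_on (h : r.IsHistory t η) {s : Set H} (hs : MeasurableSet s)
    {F : H × Param n m → ℝ≥0∞} (hF : Measurable F) :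
    ∫⁻ ω in η ⁻¹' s, F (η ω, r.θ ω) ∂P =
      ∫⁻ ω in η ⁻¹' s, ∫⁻ ϑ, F (η ω, ϑ) ∂(pb.trunc (r.θhat t ω) (r.Sig t ω)) ∂P := by
  have hms := h.measurable' hs
  have := h.law ((Prod.fst ⁻¹' s).indicator F) (hF.indicator (measurable_fst hs))
  rw [← lintegral_indicator hms, ← lintegral_indicator hms]
  refine Eq.trans (lintegral_congr fun ω => ?_) (this.trans (lintegral_congr fun ω => ?_)) <;>
    by_cases hω : η ω ∈ s <;> simp [hω, Set.indicator]

/-- The posterior as a kernel on histories. -/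
lemma IsHistory.exists_kernel (ht : 1 ≤ t) (h : r.IsHistory t η) : ∃ M : Kernel H (Param n m),
    IsFiniteKernel M ∧ ∀ ω, pb.trunc (r.θhat t ω) (r.Sig t ω) = M (η ω) := by
  obtain ⟨g1, hg1, e1⟩ := h.known_θhat
  obtain ⟨g2, hg2, e2⟩ := h.known_Sig t ht le_rfl
  obtain ⟨M, hM⟩ : ∃ M : Kernel H (Param n m), ∀ k, M k = pb.trunc (g1 k) (g2 k) :=
    ⟨⟨_, measurable_trunc_comp pb hg1 hg2⟩, fun _ => rfl⟩
  exact ⟨M, ⟨⟨1, ENNReal.one_lt_top, fun y => by rw [hM]; exact trunc_univ_le_one pb⟩⟩,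
    fun ω => by rw [hM, e1, e2]⟩

/-- The new sample is drawn from μ_t independently of θ given the history, so it carries no
information on θ and the posterior is unchanged. -/
lemma IsHistory.law_post [IsProbabilityMeasure P] (ht : 1 ≤ t) (h : r.IsHistory t η)
    {F : (H × Param n m) × Param n m → ℝ≥0∞} (hF : Measurable F) :
    ∫⁻ ω, F ((η ω, r.θbar t ω), r.θ ω) ∂P =
      ∫⁻ ω, ∫⁻ ϑ, F ((η ω, r.θbar t ω), ϑ) ∂(pb.trunc (r.θhat t ω) (r.Sig t ω)) ∂P := by
  obtain ⟨s, hs, hst⟩ := h.exists_startSet ht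
  obtain ⟨M, hMf, hM⟩ := h.exists_kernel ht
  have hη := h.measurable'
  have hA : MeasurableSet (r.startSet t) := hst ▸ hη hs
  rw [← lintegral_add_compl _ hA, ← lintegral_add_compl (fun ω => ∫⁻ ϑ, _ ∂_) hA]
  congr 1
  · have hF1 : Measurable fun q : (H × Param n m) × Param n m => F ((q.1.1, q.2), q.1.2) := by
      fun_prop
    -- On the start set three integrations are combined: the sample given history and θ, the sample
    -- given the history, and θ given the history. Fubini then exchanges sample and parameter.
    have s1 := r.lintegral_sample ht (h.measurable.prodMk (r.measurable_θ_pre t))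
      (s := Prod.fst ⁻¹' s) (measurable_fst hs) (by rw [hst]; rfl)
      (h.known_θhat.trans ⟨Prod.fst, measurable_fst, fun _ => rfl⟩)
      ((h.known_Sig t ht le_rfl).trans ⟨Prod.fst, measurable_fst, fun _ => rfl⟩) hF1
    have hF2 : Measurable fun q : H × Param n m => ∫⁻ ϑ, F (q, ϑ) ∂(M q.1) :=
      Measurable.lintegral_kernel_prod_right' (κ := M.comap Prod.fst measurable_fst) (f := F) hF
    have s2 := r.lintegral_sample ht h.measurable hs hst h.known_θhat
      (h.known_Sig t ht le_rfl) hF2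
    have hF3 : Measurable fun q : H × Param n m => ∫⁻ b, F ((q.1, b), q.2) ∂(M q.1) :=
      Measurable.lintegral_kernel_prod_right' (κ := M.comap Prod.fst measurable_fst)
        (f := fun p : (H × Param n m) × Param n m => F ((p.1.1, p.2), p.1.2)) (by fun_prop)
    have s3 := h.law_on hs hF3
    simp only [hM] at s1 s2 s3 ⊢
    rw [← hst] at s3
    rw [s1, s2, s3]
    refine lintegral_congr fun ω => ?_
    refine lintegral_lintegral_swap ?_
    exact (show Measurable fun p : Param n m × Param n m => F ((η ω, p.2), p.1) by
      fun_prop).aemeasurable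
  -- Off the start set the old sample is kept, and this is part of the history. At time 1 every path
  -- starts an episode.
  · rcases Nat.lt_or_ge 1 t with h1 | h1
    · obtain ⟨b, hb, hbη⟩ := h.known_θbar h1
      have hk : ∀ ω ∈ (r.startSet t)ᶜ, r.θbar t ω = b (η ω) := fun ω hω => by
        rw [r.keep t ht ω hω, hbη]
      have := h.law_on hs.compl (F := fun q => F ((q.1, b q.1), q.2)) (by fun_prop)
      rw [Set.preimage_compl, ← hst] at this
      rw [setLIntegral_congr_fun hA.compl (fun ω hω => by simp only [hk ω hω]; rfl),
        this]
      refine setLIntegral_congr_fun hA.compl fun ω hω => ?_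
      simp only [hk ω hω]
    · obtain rfl : t = 1 := by omega
      have : (r.startSet 1)ᶜ = ∅ := by
        ext ω
        simp [startSet, startsAt_one]
      simp [this]

lemma IsHistory.known_post {Y : Type*} [MeasurableSpace Y] {f : Ω → Y} (hf : Known η f) :
    Known (fun ω => (η ω, r.θbar t ω)) f :=
  hf.trans ⟨Prod.fst, measurable_fst, fun _ => rfl⟩

lemma IsHistory.known_z (ht : 1 ≤ t) (h : r.IsHistory t η) :
    Known (fun ω => (η ω, r.θbar t ω)) (r.z t) := by
  have hx : Known (fun ω => (η ω, r.θbar t ω)) (r.x t) := known_post h.known_x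
  have hb : Known (fun ω => (η ω, r.θbar t ω)) (r.θbar t) :=
    ⟨Prod.snd, measurable_snd, fun _ => rfl⟩
  have := (hx.prodMk hb).comp (g := fun p => Sum.elim p.1 (gain pb.Q pb.R p.2 *ᵥ p.1)) (by
    have hu : Measurable fun p : (Fin n → ℝ) × Param n m => gain pb.Q pb.R p.2 *ᵥ p.1 :=
      measurable_mulVec ((measurable_gain pb.posDef_Q pb.posDef_R).comp measurable_snd)
        measurable_fst
    refine measurable_pi_iff.2 fun i => ?_
    cases i with
    | inl i => exact (measurable_pi_apply i).comp measurable_fst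
    | inr i => exact (measurable_pi_apply i).comp hu)
  rwa [show r.z t = fun ω => Sum.elim (r.x t ω) (gain pb.Q pb.R (r.θbar t ω) *ᵥ r.x t ω) from
    funext fun ω => by rw [z, r.u_eq t ht]]

lemma IsHistory.measurable_post (ht : 1 ≤ t) (h : r.IsHistory t η) :
    Measurable[r.postAlg t] fun ω => (η ω, r.θbar t ω) :=
  (h.measurable.mono (r.preAlg_le_postAlg t) le_rfl).prodMk (r.measurable_θbar_post ht)

/-- Since x_{t+1} = θᵀz_t + w_t with z_t a function of history and sample, the noise is integrated
out first and then θ by its posterior. -/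
lemma IsHistory.lintegral_next [IsProbabilityMeasure P] (ht : 1 ≤ t) (h : r.IsHistory t η)
    {F : ((H × Param n m) × (Fin n → ℝ)) × Param n m → ℝ≥0∞} (hF : Measurable F) :
    ∫⁻ ω, F (((η ω, r.θbar t ω), r.x (t + 1) ω), r.θ ω) ∂P =
      ∫⁻ ω, ∫⁻ ϑ, ∫⁻ y, F (((η ω, r.θbar t ω), obs ϑ (r.z t ω) + y), ϑ) ∂(noise n σ)
        ∂(pb.trunc (r.θhat t ω) (r.Sig t ω)) ∂P := by
  obtain ⟨zf, hzf, ez⟩ := h.known_z ht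
  have ho : Measurable fun p : (H × Param n m) × Param n m => obs p.2 (zf p.1) :=
    measurable_obs measurable_snd (hzf.comp measurable_fst)
  have hF1 : Measurable fun p : ((H × Param n m) × Param n m) × (Fin n → ℝ) =>
      F ((p.1.1, obs p.1.2 (zf p.1.1) + p.2), p.1.2) :=
    hF.comp (((measurable_fst.comp measurable_fst).prodMk
      ((ho.comp measurable_fst).add measurable_snd)).prodMk (measurable_snd.comp measurable_fst))
  have hF2 : Measurable fun p : (H × Param n m) × Param n m =>
      ∫⁻ y, F ((p.1, obs p.2 (zf p.1) + y), p.2) ∂(noise n σ) :=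
    Measurable.lintegral_prod_right' hF1
  have hm : Measurable[r.postAlg t] fun ω => ((η ω, r.θbar t ω), r.θ ω) :=
    (h.measurable_post ht).prodMk ((r.measurable_θ_pre t).mono (r.preAlg_le_postAlg t) le_rfl)
  have e1 := lintegral_noise_of_post ht hm hF1
  have e2 := h.law_post ht hF2
  simp only [r.x_succ' ht, ez] at e1 e2 ⊢
  rw [e1, e2]

lemma _root_.LQ.measurable_postMean {X : Type*} [MeasurableSpace X] {μ : X → Param n m}
    {S : X → Matrix (Fin n ⊕ Fin m) (Fin n ⊕ Fin m) ℝ} {z : X → Fin n ⊕ Fin m → ℝ}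
    {y : X → Fin n → ℝ} (hμ : Measurable μ) (hS : Measurable S) (hz : Measurable z)
    (hy : Measurable y) (σ : ℝ) :
    Measurable fun a => postMean (μ a) (S a) (z a) σ (y a) := by
  refine measurable_pi_lambda _ fun i => ?_
  have h1 : Measurable fun a => μ a i := (measurable_pi_apply i).comp hμ
  have h2 : Measurable fun a => (μ a i).ofLp ⬝ᵥ z a :=
    measurable_dotProduct ((WithLp.measurable_ofLp _ _).comp h1) hz
  have h3 : Measurable fun a => WithLp.toLp 2 (S a *ᵥ z a) :=
    (WithLp.measurable_toLp _ _).comp (measurable_mulVec hS hz)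
  exact h1.add (((((measurable_pi_apply i).comp hy).sub h2).div
    (measurable_const.add (measurable_qf hS hz))).smul h3)

lemma _root_.LQ.measurable_postCov {X ι : Type*} [MeasurableSpace X] [Fintype ι] [DecidableEq ι]
    {S : X → Matrix ι ι ℝ} {z : X → ι → ℝ} (hS : Measurable S) (hz : Measurable z) (σ : ℝ) :
    Measurable fun a => postCov (S a) (z a) σ := by
  refine measurable_matrix_inv (measurable_matrix_add (measurable_matrix_inv hS)
    (measurable_matrix_iff.2 fun i j => ?_))
  exact (((measurable_pi_apply i).comp hz).mul ((measurable_pi_apply j).comp hz)).const_mul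
    (1 / σ ^ 2)

/-- The previous formula expresses both sides through prior and noise at time t; Bayes' rule for the
truncated Gaussian identifies them, as the recursions for mean and covariance are the conjugate
updates. -/
lemma IsHistory.law_succ [IsProbabilityMeasure P] (hσ : 0 < σ) (ht : 1 ≤ t)
    (h : r.IsHistory t η) {F : ((H × Param n m) × (Fin n → ℝ)) × Param n m → ℝ≥0∞}
    (hF : Measurable F) :
    ∫⁻ ω, F (((η ω, r.θbar t ω), r.x (t + 1) ω), r.θ ω) ∂P =
      ∫⁻ ω, ∫⁻ ϑ, F (((η ω, r.θbar t ω), r.x (t + 1) ω), ϑ)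
        ∂(pb.trunc (r.θhat (t + 1) ω) (r.Sig (t + 1) ω)) ∂P := by
  obtain ⟨zf, hzf, ez⟩ := h.known_z ht
  obtain ⟨g1, hg1, e1⟩ := known_post (r := r) (t := t) h.known_θhat
  obtain ⟨g2, hg2, e2⟩ := known_post (r := r) (t := t) (h.known_Sig t ht le_rfl)
  obtain ⟨M, hM⟩ : ∃ M : Kernel ((H × Param n m) × (Fin n → ℝ)) (Param n m), ∀ k, M k =
      pb.trunc (postMean (g1 k.1) (g2 k.1) (zf k.1) σ k.2) (postCov (g2 k.1) (zf k.1) σ) :=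
    ⟨⟨_, measurable_trunc_comp pb
      (measurable_postMean (hg1.comp measurable_fst) (hg2.comp measurable_fst)
        (hzf.comp measurable_fst) measurable_snd σ)
      (measurable_postCov (hg2.comp measurable_fst) (hzf.comp measurable_fst) σ)⟩, fun _ => rfl⟩
  have : IsFiniteKernel M := ⟨⟨1, ENNReal.one_lt_top, fun y => by
    rw [hM]; exact trunc_univ_le_one pb⟩⟩
  have hG : Measurable fun p : ((H × Param n m) × (Fin n → ℝ)) × Param n m =>
      ∫⁻ ϑ, F (p.1, ϑ) ∂(M p.1) :=
    (Measurable.lintegral_kernel_prod_right' (κ := M) (f := F) hF).comp measurable_fst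
  have l1 := h.lintegral_next ht hF
  have l2 := h.lintegral_next ht hG
  have hM' : ∀ ω, pb.trunc (r.θhat (t + 1) ω) (r.Sig (t + 1) ω) =
      M ((η ω, r.θbar t ω), r.x (t + 1) ω) := fun ω => by
    rw [hM, r.θhat_succ' ht, r.Sig_succ' ht, e1, e2, ez]
  simp only [hM']
  rw [l1, l2]
  refine lintegral_congr fun ω => ?_
  have := lintegral_trunc_bayes (μ := r.θhat t ω) pb (r.posDef_Sig t ht ω) (r.z t ω) hσ
    (F := fun p => F (((η ω, r.θbar t ω), p.2), p.1)) (by fun_prop)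
  rw [this]
  simp only [hM, e1, e2, ez]

lemma IsHistory.next [IsProbabilityMeasure P] (hσ : 0 < σ) (ht : 1 ≤ t)
    (h : r.IsHistory t η) :
    r.IsHistory (t + 1) fun ω => ((η ω, r.θbar t ω), r.x (t + 1) ω) := by
  have hup {Y : Type _} [MeasurableSpace Y] {f : Ω → Y}
      (hf : Known (fun ω => (η ω, r.θbar t ω)) f) :
      Known (fun ω => ((η ω, r.θbar t ω), r.x (t + 1) ω)) f :=
    hf.trans ⟨Prod.fst, measurable_fst, fun _ => rfl⟩
  have hx : Known (fun ω => ((η ω, r.θbar t ω), r.x (t + 1) ω)) (r.x (t + 1)) :=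
    ⟨Prod.snd, measurable_snd, fun _ => rfl⟩
  have hz := hup (h.known_z ht)
  have hS := hup (known_post (r := r) (t := t) (h.known_Sig t ht le_rfl))
  have hθ := hup (known_post (r := r) (t := t) h.known_θhat)
  refine ⟨?_, hx, ?_, fun s h1 h2 => ?_, fun _ => ?_, fun F hF => h.law_succ hσ ht hF⟩
  · have hp := (h.measurable_post ht).mono (r.postAlg_le_preAlg t) le_rfl
    refine hp.prodMk ?_
    have hw : Measurable[r.preAlg (t + 1)] (r.w t) :=
      measurable_iff_comap_le.2 (r.comap_w_le ht (by omega))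
    have hz' : Measurable[r.preAlg (t + 1)] (r.z t) := (h.known_z ht).measurable hp
    rw [show r.x (t + 1) = fun ω => obs (r.θ ω) (r.z t ω) + r.w t ω from
      funext fun ω => r.x_succ' ht ω]
    have ho : Measurable fun p : Param n m × (Fin n ⊕ Fin m → ℝ) => obs p.1 p.2 :=
      measurable_obs measurable_fst measurable_snd
    exact (ho.comp ((r.measurable_θ_pre (t + 1)).prodMk hz')).add hw
  · have := (((hθ.prodMk hS).prodMk hz).prodMk hx).comp
      (g := fun p => postMean p.1.1.1 p.1.1.2 p.1.2 σ p.2)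
      (measurable_postMean (by fun_prop) (by fun_prop) (by fun_prop) (by fun_prop) σ)
    simpa only [← r.θhat_succ' ht] using this
  · rcases Nat.lt_or_ge t s with h3 | h3
    · obtain rfl : s = t + 1 := by omega
      have := (hS.prodMk hz).comp (g := fun p => postCov p.1 p.2 σ)
        (measurable_postCov measurable_fst measurable_snd σ)
      simpa only [← r.Sig_succ' ht] using this
    · exact hup (known_post (h.known_Sig s h1 h3))
  · exact ⟨fun p => p.1.2, by fun_prop, fun _ => rfl⟩

/-- The history space grows by one sample and one state per step, so it is built by induction
together with its type. At time 1 nothing random has been observed and the posterior is the prior.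
-/
lemma exists_isHistory [IsProbabilityMeasure P] (hσ : 0 < σ) (r : Run pb σ Tmin P) (ht : 1 ≤ t) :
    ∃ (H : Type) (_ : MeasurableSpace H) (η : Ω → H), r.IsHistory t η := by
  induction t, ht using Nat.le_induction with
  | base =>
    refine ⟨Unit, inferInstance, fun _ => (), measurable_const, ?_, ?_, fun s h1 h2 => ?_,
      fun h => by omega, fun F hF => ?_⟩
    · rw [show r.x 1 = fun _ => 0 from funext r.x_one]; exact known_const _
    · rw [show r.θhat 1 = fun _ => pb.mean from funext r.θhat_one]; exact known_const _
    · obtain rfl : s = 1 := by omega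
      rw [show r.Sig 1 = fun _ => pb.cov from funext r.Sig_one]; exact known_const _
    · simp only [r.θhat_one, r.Sig_one]
      rw [lintegral_const, measure_univ, mul_one, ← Problem.prior, ← r.law_θ,
        lintegral_map (by fun_prop) r.measurable_θ]
  | succ t ht ih =>
    obtain ⟨H, mH, η, h⟩ := ih
    exact ⟨_, inferInstance, _, h.next hσ ht⟩

end Run

end PosteriorInduction

/-! ### Consequences of the posterior law. -/

section PosteriorConsequences

variable {n m : ℕ} {pb : Problem n m} {σ : ℝ} {Tmin : ℕ} {Ω : Type*} [mΩ : MeasurableSpace Ω]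
  {P : Measure Ω} (r : Run pb σ Tmin P) {t : ℕ}

namespace Run

lemma postAlg_le (t : ℕ) : r.postAlg t ≤ mΩ := (r.postAlg_le_preAlg t).trans (r.preAlg_le _)

lemma ae_θ_mem : ∀ᵐ ω ∂P, r.θ ω ∈ pb.supp := by
  have h : ∀ᵐ ϑ ∂(P.map r.θ), ϑ ∈ pb.supp := by
    rw [r.law_θ]
    exact ae_cond_mem pb.isCompact_supp.measurableSet
  exact ae_of_ae_map r.measurable_θ.aemeasurable h

variable [IsProbabilityMeasure P]

lemma measurable_x (hσ : 0 < σ) (ht : 1 ≤ t) : Measurable (r.x t) := by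
  obtain ⟨H, mH, η, h⟩ := exists_isHistory hσ r ht
  exact h.known_x.measurable h.measurable'

lemma measurable_Sig (hσ : 0 < σ) (ht : 1 ≤ t) : Measurable (r.Sig t) := by
  obtain ⟨H, mH, η, h⟩ := exists_isHistory hσ r ht
  exact (h.known_Sig t ht le_rfl).measurable h.measurable'

lemma measurable_θhat (hσ : 0 < σ) (ht : 1 ≤ t) : Measurable (r.θhat t) := by
  obtain ⟨H, mH, η, h⟩ := exists_isHistory hσ r ht
  exact h.known_θhat.measurable h.measurable'

lemma measurable_clk (hσ : 0 < σ) (ht : 1 ≤ t) : Measurable (r.clk t) := by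
  obtain ⟨H, mH, η, h⟩ := exists_isHistory hσ r ht
  exact h.known_clk.measurable h.measurable'

lemma measurableSet_startSet (hσ : 0 < σ) (ht : 1 ≤ t) : MeasurableSet (r.startSet t) := by
  obtain ⟨H, mH, η, h⟩ := exists_isHistory hσ r ht
  obtain ⟨s, hs, e⟩ := h.exists_startSet ht
  rw [e]
  exact h.measurable' hs

lemma measurable_z_post (hσ : 0 < σ) (ht : 1 ≤ t) : Measurable[r.postAlg t] (r.z t) := by
  obtain ⟨H, mH, η, h⟩ := exists_isHistory hσ r ht
  exact (h.known_z ht).measurable (h.measurable_post ht)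

lemma measurable_z (hσ : 0 < σ) (ht : 1 ≤ t) : Measurable (r.z t) :=
  (r.measurable_z_post hσ ht).mono (r.postAlg_le t) le_rfl

/-- At the start of an episode, the sampled and the true parameter have the same conditional law. -/
lemma lintegral_start_θbar (hσ : 0 < σ) (ht : 1 ≤ t)
    {φ : ((ℤ × ℤ) × Param n m × Matrix (Fin n ⊕ Fin m) (Fin n ⊕ Fin m) ℝ) × Param n m → ℝ≥0∞}
    (hφ : Measurable φ) :
    ∫⁻ ω in r.startSet t, φ ((r.clk t ω, r.θhat t ω, r.Sig t ω), r.θbar t ω) ∂P =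
      ∫⁻ ω in r.startSet t, φ ((r.clk t ω, r.θhat t ω, r.Sig t ω), r.θ ω) ∂P := by
  obtain ⟨H, mH, η, h⟩ := exists_isHistory hσ r ht
  obtain ⟨s, hs, e⟩ := h.exists_startSet ht
  have hS := h.known_Sig t ht le_rfl
  obtain ⟨g, hg, hgη⟩ := h.known_clk.prodMk (h.known_θhat.prodMk hS)
  have hF : Measurable fun p : H × Param n m => φ (g p.1, p.2) := by fun_prop
  have h1 := r.lintegral_sample ht h.measurable hs e h.known_θhat hS hF
  have h2 := h.law_on hs hF
  rw [← e] at h2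
  simp only [← hgη] at h1 h2
  rw [h1, h2]

/-- Given the past, the inverse mass does not increase in mean, so it behaves like a nonnegative
supermartingale. This prevents the cost of removing the truncation from accumulating with time. -/
lemma lintegral_inv_mass_le (hσ : 0 < σ) (ht : 1 ≤ t) :
    ∫⁻ ω, (gaussParam (r.θhat t ω) (r.Sig t ω) pb.supp)⁻¹ ∂P ≤
      (gaussParam pb.mean pb.cov pb.supp)⁻¹ := by
  induction t, ht using Nat.le_induction with
  | base => simp [r.θhat_one, r.Sig_one]
  | succ t ht ih =>
    refine le_trans ?_ ih
    obtain ⟨H, mH, η, h⟩ := exists_isHistory hσ r ht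
    obtain ⟨zf, hzf, ez⟩ := h.known_z ht
    obtain ⟨g1, hg1, e1⟩ := IsHistory.known_post (r := r) (t := t) h.known_θhat
    obtain ⟨g2, hg2, e2⟩ := IsHistory.known_post (r := r) (t := t) (h.known_Sig t ht le_rfl)
    have hF : Measurable fun p : ((H × Param n m) × (Fin n → ℝ)) × Param n m =>
        (gaussParam (postMean (g1 p.1.1) (g2 p.1.1) (zf p.1.1) σ p.1.2)
          (postCov (g2 p.1.1) (zf p.1.1) σ) pb.supp)⁻¹ :=
      ((Measure.measurable_coe pb.isCompact_supp.measurableSet).comp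
        (measurable_gaussParam_comp
          (measurable_postMean (by fun_prop) (by fun_prop) (by fun_prop) (by fun_prop) σ)
          (measurable_postCov (by fun_prop) (by fun_prop) σ))).inv
    have l := h.lintegral_next ht hF
    simp only [← e1, ← e2, ← ez] at l
    simp only [r.θhat_succ' ht, r.Sig_succ' ht]
    rw [l]
    exact lintegral_mono fun ω =>
      lintegral_trunc_inv_mass_le (μ := r.θhat t ω) pb (r.posDef_Sig t ht ω) (r.z t ω) hσ

/-- The squared deviation of the parameter `ϑ` from the posterior mean along `v`, relative to the
posterior covariance. -/
noncomputable def dev (r : Run pb σ Tmin P) (v : EuclideanSpace ℝ (Fin n)) (t : ℕ) (ω : Ω)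
    (ϑ : Param n m) : ℝ :=
  qf (r.Sig t ω)⁻¹ (colComb v (ϑ - r.θhat t ω)).ofLp

lemma measurable_exp_dev (v : EuclideanSpace ℝ (Fin n)) :
    Measurable fun p : ((ℤ × ℤ) × Param n m × Matrix (Fin n ⊕ Fin m) (Fin n ⊕ Fin m) ℝ) ×
        Param n m => ENNReal.ofReal (Real.exp (qf p.1.2.2⁻¹
          (colComb v (p.2 - p.1.2.1)).ofLp / 4)) := by
  have : Measurable fun p : ((ℤ × ℤ) × Param n m × Matrix (Fin n ⊕ Fin m) (Fin n ⊕ Fin m) ℝ) ×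
        Param n m => qf p.1.2.2⁻¹ (colComb v (p.2 - p.1.2.1)).ofLp :=
    measurable_qf (measurable_matrix_inv (by fun_prop)) ((WithLp.measurable_ofLp _ _).comp
      ((measurable_colComb v).comp (by fun_prop)))
  fun_prop

/-- Given the history, θ has the truncated posterior. Replacing it by the full Gaussian costs the
inverse mass of the support, and the Gaussian moment does not depend on the history. -/
lemma lintegral_exp_dev_le (hσ : 0 < σ) (ht : 1 ≤ t) {v : EuclideanSpace ℝ (Fin n)}
    (hv : ‖v‖ = 1) :
    ∫⁻ ω, ENNReal.ofReal (Real.exp (r.dev v t ω (r.θ ω) / 4)) ∂P ≤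
      ENNReal.ofReal √2 ^ (n + m) * (gaussParam pb.mean pb.cov pb.supp)⁻¹ := by
  obtain ⟨H, mH, η, h⟩ := exists_isHistory hσ r ht
  obtain ⟨g, hg, hgη⟩ := h.known_clk.prodMk (h.known_θhat.prodMk (h.known_Sig t ht le_rfl))
  have hF : Measurable fun p : H × Param n m => ENNReal.ofReal (Real.exp (qf (g p.1).2.2⁻¹
      (colComb v (p.2 - (g p.1).2.1)).ofLp / 4)) :=
    (measurable_exp_dev v).comp (g := fun p : ((ℤ × ℤ) × Param n m × Matrix (Fin n ⊕ Fin m) (Fin n ⊕ Fin m) ℝ) ×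
        Param n m => ENNReal.ofReal (Real.exp (qf p.1.2.2⁻¹
          (colComb v (p.2 - p.1.2.1)).ofLp / 4))) (f := fun p : H × Param n m => (g p.1, p.2))
      (by fun_prop)
  have l := h.law _ hF
  simp only [← hgη] at l
  simp only [dev]
  rw [l]
  calc _ ≤ ∫⁻ ω, ENNReal.ofReal √2 ^ (n + m) *
        (gaussParam (r.θhat t ω) (r.Sig t ω) pb.supp)⁻¹ ∂P := by
        refine lintegral_mono fun ω => ?_
        simp only
        rw [lintegral_trunc pb, mul_comm,
          ← lintegral_exp_qf_gaussParam (μ := r.θhat t ω) (r.posDef_Sig t ht ω) hv]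
        gcongr
        exact Set.indicator_le_self _ _ _
    _ ≤ _ := by
        rw [lintegral_const_mul']
        · gcongr
          exact r.lintegral_inv_mass_le hσ ht
        · finiteness

lemma lintegral_exp_dev_θbar_le (hσ : 0 < σ) (ht : 1 ≤ t) {v : EuclideanSpace ℝ (Fin n)}
    (hv : ‖v‖ = 1) :
    ∫⁻ ω in r.startSet t, ENNReal.ofReal (Real.exp (r.dev v t ω (r.θbar t ω) / 4)) ∂P ≤
      ENNReal.ofReal √2 ^ (n + m) * (gaussParam pb.mean pb.cov pb.supp)⁻¹ := by
  have := r.lintegral_start_θbar hσ ht (measurable_exp_dev v)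
  refine this.le.trans ((setLIntegral_le_lintegral _ _).trans ?_)
  exact r.lintegral_exp_dev_le hσ ht hv

/-- The indicator of the complement of the support has the same integral for the sample as for θ on
the start set, namely zero; between starts the sample does not change. -/
lemma ae_θbar_mem (hσ : 0 < σ) : ∀ᵐ ω ∂P, ∀ t, 1 ≤ t → r.θbar t ω ∈ pb.supp := by
  have hstart : ∀ t, 1 ≤ t → ∀ᵐ ω ∂P, ω ∈ r.startSet t → r.θbar t ω ∈ pb.supp := fun t ht => by
    have hms := pb.isCompact_supp.measurableSet
    have := r.lintegral_start_θbar hσ ht (φ := fun p => pb.suppᶜ.indicator 1 p.2)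
      ((measurable_one.indicator hms.compl).comp measurable_snd)
    have h0 : ∫⁻ ω in r.startSet t, pb.suppᶜ.indicator (1 : Param n m → ℝ≥0∞) (r.θ ω) ∂P = 0 := by
      refine (lintegral_eq_zero_iff
        ((measurable_one.indicator hms.compl).comp r.measurable_θ)).2 (ae_restrict_of_ae ?_)
      filter_upwards [r.ae_θ_mem] with ω hω
      simp [hω]
    simp only [h0] at this
    have := (lintegral_eq_zero_iff
      ((measurable_one.indicator hms.compl).comp (r.measurable_θbar t))).1 this
    rw [EventuallyEq, ae_restrict_iff' (r.measurableSet_startSet hσ ht)] at this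
    filter_upwards [this] with ω hω hst
    by_contra hc
    simpa [hc] using hω hst
  filter_upwards [ae_all_iff.2 fun t => ae_all_iff.2 (hstart t)] with ω hω t ht
  induction t, ht using Nat.le_induction with
  | base => exact hω 1 le_rfl (startsAt_one _)
  | succ t ht ih =>
    by_cases hs : ω ∈ r.startSet (t + 1)
    · exact hω (t + 1) (by omega) hs
    · rw [r.keep (t + 1) (by omega) ω hs]
      exact ih

end Run

end PosteriorConsequences

/-! ### Counting episodes, for an arbitrary sequence of determinants. -/

section EpisodeCount

variable {Tmin : ℕ} {D : ℕ → ℝ}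

lemma clock_succ_of_start {t : ℕ} (h : StartsAt Tmin D (t + 1)) :
    clock Tmin D (t + 1) = ((t : ℤ) + 1, (t : ℤ) + 1 - (clock Tmin D t).1) := by
  rw [clock_succ]
  exact if_pos h

lemma clock_succ_of_not_start {t : ℕ} (h : ¬ StartsAt Tmin D (t + 1)) :
    clock Tmin D (t + 1) = clock Tmin D t := by
  rw [clock_succ]
  exact if_neg h

lemma clock_one : clock Tmin D 1 = (1, (Tmin : ℤ) + 1) := by
  rw [clock_succ_of_start (t := 0) (startsAt_one D)]
  simp [clock, add_comm]

/-- Within an episode the last test has failed. As the previous length exceeds `Tmin`, the length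
test is never suppressed by the minimum length, whereas the determinant test is. -/
lemma clock_invariant {t : ℕ} (ht : 1 ≤ t) :
    (t : ℤ) - (clock Tmin D t).1 ≤ (clock Tmin D t).2 ∧
      ((t : ℤ) - (clock Tmin D t).1 > Tmin → 1 / 2 * D (clock Tmin D t).1.toNat ≤ D t) := by
  obtain ⟨t, rfl⟩ : ∃ k, t = k + 1 := ⟨t - 1, by omega⟩
  obtain ⟨-, -, h3⟩ := clock_bounds (Tmin := Tmin) D (t + 1) ht
  by_cases h : StartsAt Tmin D (t + 1)
  · rw [clock_succ_of_start h] at h3 ⊢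
    push_cast
    refine ⟨by omega, fun h' => ?_⟩
    omega
  · have h' : ¬ EndsAt Tmin D (clock Tmin D (t + 1)) (t + 1) := by
      rw [clock_succ_of_not_start h]; exact h
    simp only [EndsAt, not_and, not_or, not_lt, gt_iff_lt] at h'
    refine ⟨?_, fun h1 => (h' h1).2⟩
    by_contra hc
    exact hc (h' (by omega)).1

open Classical in
/-- The number of episodes started up to time `T`. -/
noncomputable def numStarts (Tmin : ℕ) (D : ℕ → ℝ) (T : ℕ) : ℝ :=
  ∑ s ∈ Finset.Icc 1 T, if StartsAt Tmin D s then 1 else 0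

lemma numStarts_succ_of_start {t : ℕ} (h : StartsAt Tmin D (t + 1)) :
    numStarts Tmin D (t + 1) = numStarts Tmin D t + 1 := by
  rw [numStarts, Finset.sum_Icc_succ_top (by omega), if_pos h, numStarts]

lemma numStarts_succ_of_not_start {t : ℕ} (h : ¬ StartsAt Tmin D (t + 1)) :
    numStarts Tmin D (t + 1) = numStarts Tmin D t := by
  rw [numStarts, Finset.sum_Icc_succ_top (by omega), if_neg h, numStarts, add_zero]

lemma numStarts_one : numStarts Tmin D 1 = 1 := by
  rw [numStarts, Finset.Icc_self, Finset.sum_singleton, if_pos (startsAt_one D)]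

lemma numStarts_nonneg (t : ℕ) : 0 ≤ numStarts Tmin D t :=
  Finset.sum_nonneg fun s _ => by split_ifs <;> norm_num

-- The lengths of the completed episodes telescope; the extra `Tmin` comes from the fictitious
-- episode that starts at time `-Tmin`.
open Classical in
lemma sum_prevLength {t : ℕ} (ht : 1 ≤ t) :
    ∑ s ∈ Finset.Icc 1 t, (if StartsAt Tmin D s then ((clock Tmin D s).2 : ℝ) else 0) =
      (clock Tmin D t).1 + Tmin := by
  induction t, ht using Nat.le_induction with
  | base => simp [startsAt_one, clock_one, add_comm]
  | succ t ht ih =>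
    rw [Finset.sum_Icc_succ_top (by omega), ih]
    by_cases h : StartsAt Tmin D (t + 1)
    · rw [if_pos h, clock_succ_of_start h]
      push_cast
      ring
    · rw [if_neg h, clock_succ_of_not_start h, add_zero]

-- An episode has at most T_{k-1} + 1 steps, a number known when it starts. The induction carries
-- the slack of the running episode, which is nonnegative.
open Classical in
lemma sum_le_sum_starts {F : ℕ → ℝ} (hF : ∀ t, 1 ≤ t → 0 ≤ F t)
    (hk : ∀ t, 1 ≤ t → ¬ StartsAt Tmin D (t + 1) → F (t + 1) = F t) {t : ℕ} (ht : 1 ≤ t) :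
    ∑ s ∈ Finset.Icc 1 t, F s ≤
      ∑ s ∈ Finset.Icc 1 t, if StartsAt Tmin D s then ((clock Tmin D s).2 + 1) * F s else 0 := by
  suffices h : ∑ s ∈ Finset.Icc 1 t, F s ≤ (∑ s ∈ Finset.Icc 1 t,
      if StartsAt Tmin D s then ((clock Tmin D s).2 + 1) * F s else 0) -
        ((clock Tmin D t).2 - (t - (clock Tmin D t).1)) * F t by
    have h1 : (0 : ℝ) ≤ ((clock Tmin D t).2 - (t - (clock Tmin D t).1)) * F t := by
      refine mul_nonneg ?_ (hF t ht)
      have := (clock_invariant (Tmin := Tmin) (D := D) ht).1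
      rw [sub_nonneg]
      exact_mod_cast this
    linarith
  induction t, ht using Nat.le_induction with
  | base => simp [startsAt_one, clock_one]; linarith
  | succ t ht ih =>
    rw [Finset.sum_Icc_succ_top (by omega), Finset.sum_Icc_succ_top (by omega)]
    have h1 : (0 : ℝ) ≤ ((clock Tmin D t).2 - (t - (clock Tmin D t).1)) * F t := by
      refine mul_nonneg ?_ (hF t ht)
      have := (clock_invariant (Tmin := Tmin) (D := D) ht).1
      rw [sub_nonneg]
      exact_mod_cast this
    by_cases h : StartsAt Tmin D (t + 1)
    · rw [if_pos h, clock_succ_of_start h]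
      push_cast
      nlinarith
    · rw [if_neg h, clock_succ_of_not_start h, hk t ht h]
      push_cast
      nlinarith

-- Each episode has at most `Tmin + 1` steps of age at most `Tmin`. The induction counts those of
-- the running episode exactly, by the minimum.
open Classical in
lemma card_early_le {t : ℕ} (ht : 1 ≤ t) :
    ∑ s ∈ Finset.Icc 1 t, (if (s : ℤ) - (clock Tmin D s).1 ≤ Tmin then (1 : ℝ) else 0) ≤
      (Tmin + 1) * numStarts Tmin D t := by
  suffices h : ∑ s ∈ Finset.Icc 1 t, (if (s : ℤ) - (clock Tmin D s).1 ≤ Tmin then (1 : ℝ) else 0) ≤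
      (Tmin + 1) * (numStarts Tmin D t - 1) +
        ((min ((t : ℤ) - (clock Tmin D t).1 + 1) (Tmin + 1) : ℤ) : ℝ) by
    have h1 : ((min ((t : ℤ) - (clock Tmin D t).1 + 1) (Tmin + 1) : ℤ) : ℝ) ≤ Tmin + 1 := by
      exact_mod_cast min_le_right _ _
    linarith
  induction t, ht using Nat.le_induction with
  | base =>
    rw [Finset.Icc_self, Finset.sum_singleton, numStarts_one, clock_one]
    simp
  | succ t ht ih =>
    rw [Finset.sum_Icc_succ_top (by omega)]
    have h0 : ((min ((t : ℤ) - (clock Tmin D t).1 + 1) (Tmin + 1) : ℤ) : ℝ) ≤ Tmin + 1 := by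
      exact_mod_cast min_le_right _ _
    by_cases h : StartsAt Tmin D (t + 1)
    · rw [clock_succ_of_start h, numStarts_succ_of_start h, if_pos (by simp)]
      have h1 : min (((t + 1 : ℕ) : ℤ) - ((t : ℤ) + 1) + 1) (Tmin + 1) = 1 := by push_cast; omega
      rw [h1, Int.cast_one]
      linarith
    · rw [clock_succ_of_not_start h, numStarts_succ_of_not_start h]
      refine (add_le_add_left ih _).trans ?_
      rw [add_assoc]
      gcongr
      split_ifs with h1
      · have : min ((t : ℤ) - (clock Tmin D t).1 + 1) (Tmin + 1) + 1 ≤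
          min (((t + 1 : ℕ) : ℤ) - (clock Tmin D t).1 + 1) (Tmin + 1) := by
          push_cast at h1 ⊢; omega
        exact_mod_cast this
      · have : min ((t : ℤ) - (clock Tmin D t).1 + 1) (Tmin + 1) ≤
          min (((t + 1 : ℕ) : ℤ) - (clock Tmin D t).1 + 1) (Tmin + 1) := by
          push_cast; omega
        rw [add_zero]
        exact_mod_cast this

/-- Inside an episode `V'` cancels against the next `V`, so only one value of `V` per episode
survives; the induction keeps the last term `-V' T` for the next cancellation. -/
lemma sum_telescope_le {V V' : ℕ → ℝ} {b : ℝ} (hV' : ∀ t, 1 ≤ t → 0 ≤ V' t) {T : ℕ}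
    (hV : ∀ t, 1 ≤ t → t ≤ T → V t ≤ b)
    (hk : ∀ t, 1 ≤ t → ¬ StartsAt Tmin D (t + 1) → V (t + 1) = V' t) (hT : 1 ≤ T) :
    ∑ t ∈ Finset.Icc 1 T, (V t - V' t) ≤ numStarts Tmin D T * b := by
  suffices h : ∑ t ∈ Finset.Icc 1 T, (V t - V' t) ≤ numStarts Tmin D T * b - V' T by
    linarith [hV' T hT]
  induction T, hT using Nat.le_induction with
  | base => simp [numStarts_one, hV 1 le_rfl le_rfl]
  | succ t ht ih =>
    rw [Finset.sum_Icc_succ_top (by omega)]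
    have ih := ih fun s h1 h2 => hV s h1 (by omega)
    by_cases h : StartsAt Tmin D (t + 1)
    · rw [numStarts_succ_of_start h]
      linarith [hV (t + 1) (by omega) le_rfl, hV' t ht]
    · rw [numStarts_succ_of_not_start h, hk t ht h]
      linarith

/-- The number of episodes is controlled by the horizon and the number of halvings of `D`. -/
lemma numStarts_le (hD : ∀ t, 1 ≤ t → 0 < D t) (hanti : ∀ t, 1 ≤ t → D (t + 1) ≤ D t) {q : ℝ}
    (hq : 0 < q) {T : ℕ} (hT : 1 ≤ T) :
    numStarts Tmin D T ≤ T / q + (q + 1) * (Real.logb 2 (D 1 / D (T + 1)) + 1) := by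
  have hanti' : ∀ s t : ℕ, 1 ≤ s → s ≤ t → D t ≤ D s := fun s t hs hst => by
    induction t, hst using Nat.le_induction with
    | base => exact le_rfl
    | succ t h ih => exact (hanti t (by omega)).trans ih
  have hlog : ∀ s t : ℕ, 1 ≤ s → s ≤ t →
      Real.logb 2 (D 1 / D s) ≤ Real.logb 2 (D 1 / D t) := fun s t hs hst =>
    Real.logb_le_logb_of_le (by norm_num) (div_pos (hD 1 le_rfl) (hD s hs))
      (div_le_div_of_nonneg_left (hD 1 le_rfl).le (hD t (by omega)) (hanti' s t hs hst))
  -- A potential that rises by at least 1 at each start. If the episode outlasted its predecessor,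
  -- either the minimum grows by 1, or the length reached q and the first term grows by 1 while the
  -- minimum is at its cap. If the determinant halved, the logarithm contributes q + 1, which pays
  -- for a loss of at most q in the minimum.
  suffices h : ∀ t : ℕ, 1 ≤ t → numStarts Tmin D t ≤ (clock Tmin D t).1 / q +
      (q + 1) * Real.logb 2 (D 1 / D (clock Tmin D t).1.toNat) +
        min ((clock Tmin D t).2 : ℝ) q + 1 by
    obtain ⟨h1, h2, -⟩ := clock_bounds (Tmin := Tmin) D T hT
    refine (h T hT).trans ?_
    have e1 : ((clock Tmin D T).1 : ℝ) / q ≤ T / q := by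
      gcongr
      exact_mod_cast h2
    have e2 := mul_le_mul_of_nonneg_left
      (hlog (clock Tmin D T).1.toNat (T + 1) (by omega) (by omega)) (by linarith : 0 ≤ q + 1)
    have e3 := min_le_right ((clock Tmin D T).2 : ℝ) q
    linarith
  intro t ht
  induction t, ht using Nat.le_induction with
  | base =>
    rw [numStarts_one, clock_one]
    simp [div_self (hD 1 le_rfl).ne']
    positivity
  | succ t ht ih =>
    by_cases h : StartsAt Tmin D (t + 1)
    · rw [numStarts_succ_of_start h, clock_succ_of_start h]
      obtain ⟨h1, h2, h3⟩ := clock_bounds (Tmin := Tmin) D t ht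
      set s := clock Tmin D t with hs
      obtain ⟨h4, h5⟩ : EndsAt Tmin D s (t + 1) := h
      have hσ : ((t : ℤ) + 1).toNat = t + 1 := by omega
      have hσ' : ((s.1.toNat : ℤ) : ℝ) = (s.1 : ℝ) := by rw [Int.toNat_of_nonneg (by omega)]
      simp only [hσ]
      push_cast at h4 h5 ⊢
      have hst : (s.1 : ℝ) ≤ t + 1 := by exact_mod_cast (by omega : s.1 ≤ (t : ℤ) + 1)
      have e1 : (s.1 : ℝ) / q ≤ (t + 1) / q := by gcongr
      have e2 := mul_le_mul_of_nonneg_left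
        (hlog s.1.toNat (t + 1) (by omega) (by omega)) (by linarith : 0 ≤ q + 1)
      rcases h5 with h5 | h5
      · have h6 : (s.2 : ℝ) + 1 ≤ t + 1 - s.1 := by
          exact_mod_cast (by omega : s.2 + 1 ≤ (t : ℤ) + 1 - s.1)
        rcases le_total q (t + 1 - s.1 : ℝ) with h7 | h7
        · rw [min_eq_right h7]
          have : (s.1 : ℝ) / q + 1 ≤ (t + 1) / q := by
            rw [div_add_one hq.ne']
            exact div_le_div_of_nonneg_right (by linarith) hq.le
          linarith [min_le_right (s.2 : ℝ) q]
        · rw [min_eq_left h7]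
          linarith [min_le_left (s.2 : ℝ) q]
      · have hDs := hD s.1.toNat (by omega)
        have hDt := hD (t + 1) (by omega)
        have e3 : Real.logb 2 (D 1 / D s.1.toNat) + 1 ≤ Real.logb 2 (D 1 / D (t + 1)) := by
          rw [← Real.logb_self_eq_one (b := 2) (by norm_num), ← Real.logb_mul
            (div_pos (hD 1 le_rfl) hDs).ne' (by norm_num)]
          refine Real.logb_le_logb_of_le (by norm_num)
            (mul_pos (div_pos (hD 1 le_rfl) hDs) (by norm_num)) ?_
          rw [div_mul_eq_mul_div, div_le_div_iff₀ hDs hDt]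
          have := hD 1 le_rfl
          nlinarith
        have e4 := mul_le_mul_of_nonneg_left e3 (by linarith : 0 ≤ q + 1)
        have e5 : (0 : ℝ) ≤ min ((t : ℝ) + 1 - s.1) q := by
          refine le_min ?_ hq.le
          linarith
        linarith [min_le_right (s.2 : ℝ) q]
    · rw [numStarts_succ_of_not_start h, clock_succ_of_not_start h]
      exact ih

end EpisodeCount

/-! ### Rank one updates of the covariance. -/

section CovarianceUpdate

variable {ι : Type*} [Fintype ι] [DecidableEq ι] {S : Matrix ι ι ℝ}

lemma qf_mulVec_inv (hS : S.PosDef) (a : ι → ℝ) : qf S (S⁻¹ *ᵥ a) = qf S⁻¹ a := by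
  rw [qf, mulVec_mulVec, mul_nonsing_inv _ ((isUnit_iff_isUnit_det _).1 hS.isUnit), one_mulVec,
    dotProduct_comm, qf]

lemma dotProduct_sq_le_qf (hS : S.PosDef) (a z : ι → ℝ) :
    (a ⬝ᵥ z) ^ 2 ≤ qf S⁻¹ a * qf S z := by
  have h := dotProduct_mulVec_sq_le hS.posSemidef z (S⁻¹ *ᵥ a)
  rw [qf_mulVec_inv hS, mulVec_mulVec,
    mul_nonsing_inv _ ((isUnit_iff_isUnit_det _).1 hS.isUnit), one_mulVec, dotProduct_comm] at h
  linarith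

lemma dotProduct_self_le_qf_inv (hS : S.PosDef) (a : ι → ℝ) : a ⬝ᵥ a ≤ ‖S‖ * qf S⁻¹ a := by
  have h1 := dotProduct_sq_le_qf hS a a
  have h2 := qf_le_norm S a
  rw [norm_toLp_sq] at h2
  have h3 : 0 ≤ qf S⁻¹ a := qf_nonneg hS.inv.posSemidef a
  have h4 : 0 ≤ a ⬝ᵥ a := by rw [← norm_toLp_sq]; positivity
  rcases h4.eq_or_lt with h5 | h5
  · rw [← h5]; positivity
  · have := h1.trans (mul_le_mul_of_nonneg_left h2 h3)
    nlinarith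

lemma qf_inv_postCov (hS : S.PosDef) (z a : ι → ℝ) (σ : ℝ) :
    qf (postCov S z σ)⁻¹ a = qf S⁻¹ a + 1 / σ ^ 2 * (a ⬝ᵥ z) ^ 2 := by
  rw [postCov, nonsing_inv_nonsing_inv _
    ((isUnit_iff_isUnit_det _).1 (posDef_inv_add hS z σ).isUnit), qf_add_matrix, qf_smul_matrix,
    qf_vecMulVec]

/-- The matrix determinant lemma for S⁻¹ + σ⁻²zzᵀ. -/
lemma det_postCov_mul (hS : S.PosDef) (z : ι → ℝ) (σ : ℝ) :
    (postCov S z σ).det * (1 + qf S z / σ ^ 2) = S.det := by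
  have hu : IsUnit (S⁻¹).det := (isUnit_iff_isUnit_det _).1 hS.inv.isUnit
  have hu' := (isUnit_iff_isUnit_det _).1 hS.isUnit
  have h := det_add_replicateCol_mul_replicateRow (ι := Unit) hu ((1 / σ ^ 2) • z) z
  rw [← vecMulVec_eq Unit, smul_vecMulVec, nonsing_inv_nonsing_inv _ hu'] at h
  have h1 : (1 + replicateRow Unit z * S * replicateCol Unit ((1 / σ ^ 2) • z)).det =
      1 + qf S z / σ ^ 2 := by
    rw [det_unique, Matrix.mul_assoc, ← replicateCol_mulVec, Matrix.add_apply, Matrix.one_apply_eq,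
      replicateRow_mul_replicateCol_apply, mulVec_smul, dotProduct_smul, smul_eq_mul, qf]
    ring
  rw [h1, det_nonsing_inv, Ring.inverse_eq_inv'] at h
  have hp : 0 < (S⁻¹ + (1 / σ ^ 2) • vecMulVec z z).det := (posDef_inv_add hS z σ).det_pos
  have hd : 0 < S.det := hS.det_pos
  rw [postCov, det_nonsing_inv, Ring.inverse_eq_inv', h]
  rw [h] at hp
  have : 1 + qf S z / σ ^ 2 ≠ 0 := fun h0 => by rw [h0] at hp; simp at hp
  field_simp

/-- Only one direction is shrunk, and the determinant records the full shrinkage; by Cauchy-Schwarz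
no direction shrinks by a larger factor. -/
lemma qf_mul_det_postCov_le (hS : S.PosDef) (z a : ι → ℝ) {σ : ℝ} (hσ : 0 < σ) :
    qf S a * (postCov S z σ).det ≤ qf (postCov S z σ) a * S.det := by
  rw [← det_postCov_mul hS z σ, qf_postCov hS z a hσ]
  have h1 := dotProduct_mulVec_sq_le hS.posSemidef a z
  have h2 : 0 ≤ qf S z := qf_nonneg hS.posSemidef z
  have h3 := (posDef_postCov hS z σ).det_pos
  have h5 : 0 < σ ^ 2 := by positivity
  have h4 : qf S a ≤ (qf S a - (a ⬝ᵥ (S *ᵥ z)) ^ 2 / (σ ^ 2 + qf S z)) * (1 + qf S z / σ ^ 2) := by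
    have : (qf S a - (a ⬝ᵥ (S *ᵥ z)) ^ 2 / (σ ^ 2 + qf S z)) * (1 + qf S z / σ ^ 2) =
        qf S a + (qf S a * qf S z - (a ⬝ᵥ (S *ᵥ z)) ^ 2) / σ ^ 2 := by
      field_simp
      ring
    rw [this]
    have : 0 ≤ (qf S a * qf S z - (a ⬝ᵥ (S *ᵥ z)) ^ 2) / σ ^ 2 :=
      div_nonneg (by linarith) h5.le
    linarith
  nlinarith

lemma det_le_pow {A : Matrix ι ι ℝ} (hA : A.PosSemidef) {κ : ℝ}
    (h : ∀ x, qf A x ≤ κ * (x ⬝ᵥ x)) : A.det ≤ κ ^ Fintype.card ι := by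
  rw [hA.isHermitian.det_eq_prod_eigenvalues, ← Finset.card_univ, ← Finset.prod_const]
  refine Finset.prod_le_prod (fun i _ => by simpa using hA.eigenvalues_nonneg i) fun i _ => ?_
  have h1 := hA.isHermitian.eigenvalues_eq i
  have h2 := h (hA.isHermitian.eigenvectorBasis i)
  rw [← norm_toLp_sq, WithLp.toLp_ofLp, hA.isHermitian.eigenvectorBasis.norm_eq_one] at h2
  simp only [star_trivial, RCLike.re_to_real] at h1
  rw [RCLike.ofReal_real_eq_id, id, h1]
  simpa [qf] using h2

end CovarianceUpdate

/-! ### Comparison of determinants. -/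

section DetBound

open scoped MatrixOrder

variable {ι : Type*} [Fintype ι] [DecidableEq ι] {S : Matrix ι ι ℝ}

/-- Conjugation by the square root of S turns the hypothesis into a bound by κ times the identity,
hence into a bound on all eigenvalues. -/
lemma det_mul_det_le_pow (hS : S.PosDef) {A : Matrix ι ι ℝ} (hA : A.PosSemidef) {κ : ℝ}
    (h : ∀ x, qf A x ≤ κ * qf S⁻¹ x) : A.det * S.det ≤ κ ^ Fintype.card ι := by
  set L := CFC.sqrt S with hL
  have hLs : L.PosSemidef := nonneg_iff_posSemidef.1 (CFC.sqrt_nonneg S)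
  have hLt := transpose_eq_of_posSemidef hLs
  have hLL : L * L = S := CFC.sqrt_mul_sqrt_self S (nonneg_iff_posSemidef.2 hS.posSemidef)
  have hq : ∀ x, qf (L * A * L) x = qf A (L *ᵥ x) := fun x => by
    conv_lhs => rw [← hLt]
    rw [hLt]
    nth_rewrite 1 [← hLt]
    exact qf_transpose_mul_mul _ _ _
  have hps : (L * A * L).PosSemidef := by
    refine posSemidef_of_qf ?_ fun x => ?_
    · rw [transpose_mul, transpose_mul, hLt, transpose_eq_of_posSemidef hA, Matrix.mul_assoc]
    · rw [hq]; exact qf_nonneg hA _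
  have := det_le_pow hps (κ := κ) fun x => by
    rw [hq]
    refine (h _).trans (le_of_eq ?_)
    rw [← qf_transpose_mul_mul, hL, sqrt_mul_inv_mul_sqrt hS, qf, one_mulVec]
  rw [det_mul, det_mul] at this
  rw [← hLL, det_mul]
  linarith

end DetBound

/-! ### Bounds along a sample path. -/

section Pathwise

variable {n m : ℕ} {pb : Problem n m} {σ : ℝ} {Tmin : ℕ} {Ω : Type*} [mΩ : MeasurableSpace Ω]
  {P : Measure Ω} (r : Run pb σ Tmin P) {ω : Ω}

lemma mul_pow_le_one_of_tMinStar_le {α ρ : ℝ} (hα : 1 ≤ α) (hρ : 0 < ρ) (hρ1 : ρ < 1)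
    (h : tMinStar ρ α ≤ Tmin) : α * ρ ^ Tmin ≤ 1 := by
  have hl : 0 < -Real.log ρ := neg_pos.2 (Real.log_neg hρ hρ1)
  have h1 : Real.log α / (-Real.log ρ) ≤ Tmin := (Nat.le_ceil _).trans (by exact_mod_cast h)
  rw [div_le_iff₀ hl] at h1
  have h2 : Real.log (α * ρ ^ Tmin) ≤ 0 := by
    rw [Real.log_mul (by positivity) (by positivity), Real.log_pow]
    linarith
  exact (Real.log_nonpos_iff (by positivity)).1 h2

namespace Run

/-- All parameters along the sample path lie in the support of the prior. -/
def InSupp (r : Run pb σ Tmin P) (ω : Ω) : Prop :=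
  r.θ ω ∈ pb.supp ∧ ∀ t, 1 ≤ t → r.θbar t ω ∈ pb.supp

lemma θbar_succ_of_not_start {t : ℕ} (h : ¬ StartsAt Tmin (r.detSig ω) (t + 1)) :
    r.θbar (t + 1) ω = r.θbar t ω := r.keep (t + 1) (by omega) ω h

lemma obs_z {t : ℕ} (ht : 1 ≤ t) (ϑ : Param n m) :
    obs ϑ (r.z t ω) = pb.closedLoop ϑ (r.θbar t ω) *ᵥ r.x t ω := by
  rw [z, obs_sumElim, r.u_eq t ht, Problem.closedLoop, add_mulVec, mulVec_mulVec]

/-- The constant in the bound of the states by the noise. -/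
noncomputable def _root_.LQ.stateConst (α ρ : ℝ) : ℝ := α * (α / (1 - ρ) ^ 2) + α / (1 - ρ)

lemma _root_.LQ.norm_pow_le {pb : Problem n m} {α ρ : ℝ} (hα : 1 ≤ α) (hpb : pb.PowerBound ρ α)
    {θ φ : Param n m} (hθ : θ ∈ pb.supp) (hφ : φ ∈ pb.supp) (j : ℕ) (v : Fin n → ℝ) :
    ‖WithLp.toLp 2 (pb.closedLoop θ φ ^ j *ᵥ v)‖ ≤ α * ρ ^ j * ‖WithLp.toLp 2 v‖ := by
  rcases Nat.eq_zero_or_pos j with rfl | hj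
  · rw [pow_zero, one_mulVec, pow_zero, mul_one]
    exact le_mul_of_one_le_left (norm_nonneg _) hα
  · exact (norm_toLp_mulVec_le _ _).trans
      (mul_le_mul_of_nonneg_right (hpb θ hθ φ hφ j hj) (norm_nonneg _))

lemma norm_x_le {α ρ : ℝ} (hα : 1 ≤ α) (hρ : 0 < ρ) (hρ1 : ρ < 1) (hpb : pb.PowerBound ρ α)
    (hmin : α * ρ ^ Tmin ≤ 1) (hω : r.InSupp ω) {W : ℝ} (hW : 0 ≤ W) {T : ℕ}
    (hw : ∀ t, 1 ≤ t → t ≤ T → ‖WithLp.toLp 2 (r.w t ω)‖ ≤ W) {t : ℕ} (ht : 1 ≤ t)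
    (htT : t ≤ T + 1) : ‖WithLp.toLp 2 (r.x t ω)‖ ≤ stateConst α ρ * W := by
  have h1ρ : 0 < 1 - ρ := by linarith
  -- E bounds the state at the start of an episode and F the noise collected since then. E is the
  -- fixed point of e ↦ ρe + F, so the bound at starts reproduces itself.
  set E : ℝ := α / (1 - ρ) ^ 2 * W with hE
  set F : ℝ := α * W / (1 - ρ) with hF
  have hE0 : 0 ≤ E := by positivity
  have hF0 : 0 ≤ F := by positivity
  have hFE : ρ * E + F = E := by
    rw [hE, hF]; field_simp; ring
  -- A closed loop need not contract in one step, so all its powers applied to the state are bounded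
  -- at once; the exponent j plus the age of the episode records the total decay.
  suffices h : ∀ t, 1 ≤ t → t ≤ T + 1 → ∀ j : ℕ,
      ‖WithLp.toLp 2 (pb.closedLoop (r.θ ω) (r.θbar t ω) ^ j *ᵥ r.x t ω)‖ ≤
        α * ρ ^ (j + ((t : ℤ) - (r.clk t ω).1).toNat) * E + ρ ^ j * F by
    have h0 := h t ht htT 0
    rw [pow_zero, one_mulVec, pow_zero, one_mul] at h0
    refine h0.trans ?_
    have h2 : ρ ^ (0 + ((t : ℤ) - (r.clk t ω).1).toNat) ≤ 1 := pow_le_one₀ hρ.le hρ1.le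
    have h3 : α * ρ ^ (0 + ((t : ℤ) - (r.clk t ω).1).toNat) * E ≤ α * 1 * E := by gcongr
    refine (add_le_add_left h3 F).trans (le_of_eq ?_)
    rw [hE, hF, stateConst]; ring
  intro t ht
  induction t, ht using Nat.le_induction with
  | base =>
    intro _ j
    rw [r.x_one, mulVec_zero, WithLp.toLp_zero, norm_zero]
    positivity
  | succ t ht ih =>
    intro htT j
    have ih := ih (by omega)
    have hwt := hw t ht (by omega)
    have hx : r.x (t + 1) ω = pb.closedLoop (r.θ ω) (r.θbar t ω) *ᵥ r.x t ω + r.w t ω := by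
      rw [r.x_succ' ht, r.obs_z ht]
    have hstep : ∀ j : ℕ,
        ‖WithLp.toLp 2 (pb.closedLoop (r.θ ω) (r.θbar t ω) ^ j *ᵥ r.x (t + 1) ω)‖ ≤
          α * ρ ^ (j + 1 + ((t : ℤ) - (r.clk t ω).1).toNat) * E + ρ ^ j * F := fun j => by
      rw [hx, mulVec_add, mulVec_mulVec, ← pow_succ, WithLp.toLp_add]
      refine (norm_add_le _ _).trans ?_
      have h1 := ih (j + 1)
      have h2 := (norm_pow_le hα hpb hω.1 (hω.2 t ht) j (r.w t ω)).trans
        (mul_le_mul_of_nonneg_left hwt (by positivity))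
      have h3 : ρ ^ (j + 1) * F + α * ρ ^ j * W = ρ ^ j * F := by
        rw [hF, pow_succ]; field_simp; ring
      linarith
    obtain ⟨c1, c2, -⟩ := clock_bounds (Tmin := Tmin) (r.detSig ω) t ht
    by_cases hs : StartsAt Tmin (r.detSig ω) (t + 1)
    · have e1 : (((t + 1 : ℕ) : ℤ) - (r.clk (t + 1) ω).1).toNat = 0 := by
        rw [clk, clock_succ_of_start hs]; simp
      rw [e1]
      have h0 := hstep 0
      rw [pow_zero, one_mulVec, pow_zero, one_mul] at h0
      have h4 : (Tmin : ℤ) < ((t + 1 : ℕ) : ℤ) - (r.clk t ω).1 := hs.1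
      have h5 : Tmin + 1 ≤ 0 + 1 + ((t : ℤ) - (r.clk t ω).1).toNat := by omega
      -- At a change of episode the age exceeds `Tmin`. This is where the minimum episode length
      -- cancels the factor α and leaves one more factor ρ.
      have h6 : α * ρ ^ (0 + 1 + ((t : ℤ) - (r.clk t ω).1).toNat) ≤ ρ :=
        calc _ ≤ α * ρ ^ (Tmin + 1) := mul_le_mul_of_nonneg_left
              (pow_le_pow_of_le_one hρ.le hρ1.le h5) (by linarith)
          _ = α * ρ ^ Tmin * ρ := by ring
          _ ≤ 1 * ρ := by gcongr
          _ = ρ := one_mul _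
      have h7 : ‖WithLp.toLp 2 (r.x (t + 1) ω)‖ ≤ E := by
        nlinarith
      refine (norm_pow_le hα hpb hω.1 (hω.2 (t + 1) (by omega)) j _).trans ?_
      have h8 := mul_le_mul_of_nonneg_left h7 (by positivity : 0 ≤ α * ρ ^ j)
      have h9 : 0 ≤ ρ ^ j * F := by positivity
      rw [add_zero]
      linarith
    · have e1 : (((t + 1 : ℕ) : ℤ) - (r.clk (t + 1) ω).1).toNat =
          1 + ((t : ℤ) - (r.clk t ω).1).toNat := by
        have c3 : (r.clk t ω).1 ≤ t := c2
        rw [show r.clk (t + 1) ω = r.clk t ω from clock_succ_of_not_start hs]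
        omega
      rw [e1, r.θbar_succ_of_not_start hs, ← add_assoc]
      exact hstep j

lemma θbar_clk {t : ℕ} (ht : 1 ≤ t) : r.θbar t ω = r.θbar (r.clk t ω).1.toNat ω := by
  induction t, ht using Nat.le_induction with
  | base => rw [clk, clock_one]; rfl
  | succ t ht ih =>
    by_cases hs : StartsAt Tmin (r.detSig ω) (t + 1)
    · rw [clk, clock_succ_of_start hs]; congr
    · rw [r.θbar_succ_of_not_start hs, ih, clk, clk, clock_succ_of_not_start hs]

lemma clk_mem_startSet {t : ℕ} (ht : 1 ≤ t) : ω ∈ r.startSet (r.clk t ω).1.toNat := by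
  induction t, ht using Nat.le_induction with
  | base => rw [clk, clock_one]; exact startsAt_one _
  | succ t ht ih =>
    by_cases hs : StartsAt Tmin (r.detSig ω) (t + 1)
    · rw [clk, clock_succ_of_start hs]; exact hs
    · rwa [show r.clk (t + 1) ω = r.clk t ω from clock_succ_of_not_start hs]

/-- The normalized predictive variance. -/
noncomputable def info (r : Run pb σ Tmin P) (t : ℕ) (ω : Ω) : ℝ :=
  qf (r.Sig t ω) (r.z t ω) / σ ^ 2

lemma info_nonneg {t : ℕ} (ht : 1 ≤ t) : 0 ≤ r.info t ω :=
  div_nonneg (qf_nonneg (r.posDef_Sig t ht ω).posSemidef _) (sq_nonneg _)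

lemma detSig_pos {t : ℕ} (ht : 1 ≤ t) : 0 < r.detSig ω t := (r.posDef_Sig t ht ω).det_pos

lemma detSig_succ {t : ℕ} (ht : 1 ≤ t) :
    r.detSig ω (t + 1) * (1 + r.info t ω) = r.detSig ω t := by
  rw [detSig, r.Sig_succ' ht, info, det_postCov_mul (r.posDef_Sig t ht ω), detSig]

lemma detSig_succ_le {t : ℕ} (ht : 1 ≤ t) : r.detSig ω (t + 1) ≤ r.detSig ω t := by
  rw [← r.detSig_succ ht]
  have h1 := r.detSig_pos (ω := ω) (t := t + 1) (by omega)
  have h2 := r.info_nonneg (ω := ω) ht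
  nlinarith

lemma sum_logb_info {T : ℕ} (hT : 1 ≤ T) :
    ∑ t ∈ Finset.Icc 1 T, Real.logb 2 (1 + r.info t ω) =
      Real.logb 2 (r.detSig ω 1 / r.detSig ω (T + 1)) := by
  have key : ∀ t, 1 ≤ t → Real.logb 2 (1 + r.info t ω) =
      Real.logb 2 (r.detSig ω t) - Real.logb 2 (r.detSig ω (t + 1)) := fun t ht => by
    rw [← r.detSig_succ ht, Real.logb_mul (r.detSig_pos (by omega)).ne'
      (by linarith [r.info_nonneg (ω := ω) ht])]
    ring
  rw [Real.logb_div (r.detSig_pos le_rfl).ne' (r.detSig_pos (by omega)).ne']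
  induction T, hT using Nat.le_induction with
  | base => simp [key]
  | succ t ht ih => rw [Finset.sum_Icc_succ_top (by omega), ih, key (t + 1) (by omega)]; ring

/-- Along the updates no quadratic form shrinks by a larger factor than the determinant. Within an
episode this lets Σ_t replace the covariance of the episode start, at a cost of 2 after the minimum
length. -/
lemma qf_Sig_mul_detSig_le (hσ : 0 < σ) {s t : ℕ} (hs : 1 ≤ s) (hst : s ≤ t)
    (a : Fin n ⊕ Fin m → ℝ) :
    qf (r.Sig s ω) a * r.detSig ω t ≤ qf (r.Sig t ω) a * r.detSig ω s := by
  induction t, hst using Nat.le_induction with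
  | base => exact le_rfl
  | succ t hst ih =>
    have h1 := qf_mul_det_postCov_le (r.posDef_Sig t (by omega) ω) (r.z t ω) a hσ
    rw [← r.Sig_succ' (by omega)] at h1
    have p1 := r.detSig_pos (ω := ω) (t := t) (by omega)
    have p2 := r.detSig_pos (ω := ω) (t := t + 1) (by omega)
    have p3 := r.detSig_pos (ω := ω) hs
    change _ * r.detSig ω (t + 1) ≤ _ * r.detSig ω t at h1
    refine le_of_mul_le_mul_right ?_ p1
    calc _ = qf (r.Sig s ω) a * r.detSig ω t * r.detSig ω (t + 1) := by ring
      _ ≤ qf (r.Sig t ω) a * r.detSig ω s * r.detSig ω (t + 1) := by gcongr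
      _ = qf (r.Sig t ω) a * r.detSig ω (t + 1) * r.detSig ω s := by ring
      _ ≤ qf (r.Sig (t + 1) ω) a * r.detSig ω t * r.detSig ω s := by gcongr
      _ = _ := by ring

lemma qf_inv_Sig {T : ℕ} (a : Fin n ⊕ Fin m → ℝ) : qf (r.Sig (T + 1) ω)⁻¹ a =
    qf pb.cov⁻¹ a + ∑ t ∈ Finset.Icc 1 T, 1 / σ ^ 2 * (a ⬝ᵥ r.z t ω) ^ 2 := by
  induction T with
  | zero => simp [r.Sig_one]
  | succ t ih =>
    rw [Finset.sum_Icc_succ_top (by omega), r.Sig_succ' (by omega),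
      qf_inv_postCov (r.posDef_Sig _ (by omega) ω), ih]
    ring

/-- Σ_{T+1}⁻¹ = Σ_1⁻¹ + σ⁻² ∑ z_t z_tᵀ, and each rank one term is at most σ⁻²‖Σ_1‖ |z_t|² Σ_1⁻¹. -/
lemma detSig_ratio_le {T : ℕ} : r.detSig ω 1 / r.detSig ω (T + 1) ≤
    (1 + ‖pb.cov‖ / σ ^ 2 * ∑ t ∈ Finset.Icc 1 T, ‖WithLp.toLp 2 (r.z t ω)‖ ^ 2) ^ (n + m) := by
  have hP := r.posDef_Sig (T + 1) (by omega) ω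
  have h := det_mul_det_le_pow pb.posDef_cov hP.inv.posSemidef
    (κ := 1 + ‖pb.cov‖ / σ ^ 2 * ∑ t ∈ Finset.Icc 1 T, ‖WithLp.toLp 2 (r.z t ω)‖ ^ 2) fun a => by
      have h1 := dotProduct_self_le_qf_inv pb.posDef_cov a
      have h2 : ∀ t ∈ Finset.Icc 1 T, 1 / σ ^ 2 * (a ⬝ᵥ r.z t ω) ^ 2 ≤
          ‖pb.cov‖ / σ ^ 2 * ‖WithLp.toLp 2 (r.z t ω)‖ ^ 2 * qf pb.cov⁻¹ a := fun t _ => by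
        have h3 := abs_dotProduct_le a (r.z t ω)
        have h4 : (a ⬝ᵥ r.z t ω) ^ 2 ≤ (a ⬝ᵥ a) * ‖WithLp.toLp 2 (r.z t ω)‖ ^ 2 := by
          rw [← norm_toLp_sq, ← mul_pow, ← sq_abs]
          gcongr
        calc _ ≤ 1 / σ ^ 2 * ((‖pb.cov‖ * qf pb.cov⁻¹ a) * ‖WithLp.toLp 2 (r.z t ω)‖ ^ 2) := by
              gcongr
              exact h4.trans (by gcongr)
          _ = _ := by ring
      rw [r.qf_inv_Sig]
      refine (add_le_add_right (Finset.sum_le_sum h2) _).trans (le_of_eq ?_)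
      rw [← Finset.sum_mul, ← Finset.mul_sum]
      ring
  rw [det_nonsing_inv, Ring.inverse_eq_inv', Fintype.card_sum, Fintype.card_fin,
    Fintype.card_fin] at h
  rw [div_eq_inv_mul]
  simp only [detSig, r.Sig_one]
  exact h

lemma sum_z_dotProduct (v : EuclideanSpace ℝ (Fin n)) (ϑ : Param n m) (z : Fin n ⊕ Fin m → ℝ) :
    (colComb v ϑ).ofLp ⬝ᵥ z = v.ofLp ⬝ᵥ obs ϑ z := by
  simp only [colComb, WithLp.ofLp_sum, WithLp.ofLp_smul, sum_dotProduct, smul_dotProduct,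
    smul_eq_mul]
  rfl

/-- In the later part of an episode, the prediction of the sampled parameter is accurate. -/
lemma norm_obs_sub_le (hσ : 0 < σ) {N : Finset (EuclideanSpace ℝ (Fin n))}
    (hN : ∀ y, ∃ v ∈ N, ‖y‖ ≤ 2 * inner ℝ v y) {t : ℕ} (ht : 1 ≤ t) {Z : ℝ} (hZ : 0 ≤ Z)
    (h1 : ∀ v ∈ N, r.dev v (r.clk t ω).1.toNat ω (r.θ ω) ≤ Z)
    (h2 : ∀ v ∈ N, r.dev v (r.clk t ω).1.toNat ω (r.θbar (r.clk t ω).1.toNat ω) ≤ Z)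
    (hlate : ¬ (t : ℤ) - (r.clk t ω).1 ≤ Tmin) :
    ‖WithLp.toLp 2 (obs (r.θ ω) (r.z t ω) - obs (r.θbar t ω) (r.z t ω))‖ ≤
      4 * √Z * √(2 * σ ^ 2 * r.info t ω) := by
  obtain ⟨c1, c2, -⟩ := clock_bounds (Tmin := Tmin) (r.detSig ω) t ht
  have c3 := (clock_invariant (Tmin := Tmin) (D := r.detSig ω) ht).2 (not_le.1 hlate)
  have c1' : 1 ≤ (r.clk t ω).1 := c1
  have c2' : (r.clk t ω).1 ≤ t := c2
  set s := (r.clk t ω).1.toNat with hs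
  change 1 / 2 * r.detSig ω s ≤ r.detSig ω t at c3
  have hs1 : 1 ≤ s := by omega
  have hP := r.posDef_Sig s hs1 ω
  have hz : qf (r.Sig s ω) (r.z t ω) ≤ 2 * σ ^ 2 * r.info t ω := by
    have h3 := r.qf_Sig_mul_detSig_le (ω := ω) hσ hs1 (by omega : s ≤ t) (r.z t ω)
    have h4 : 2 * σ ^ 2 * r.info t ω = 2 * qf (r.Sig t ω) (r.z t ω) := by
      rw [info]; field_simp
    rw [h4]
    have p1 := r.detSig_pos (ω := ω) ht
    have h5 := qf_nonneg (r.posDef_Sig t ht ω).posSemidef (r.z t ω)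
    refine le_of_mul_le_mul_right (h3.trans ?_) p1
    nlinarith
  have hdev : ∀ ϑ v, r.dev v s ω ϑ ≤ Z →
      |(colComb v (ϑ - r.θhat s ω)).ofLp ⬝ᵥ r.z t ω| ≤ √Z * √(2 * σ ^ 2 * r.info t ω) :=
    fun ϑ v hv => by
      rw [← Real.sqrt_mul hZ]
      refine Real.abs_le_sqrt ((dotProduct_sq_le_qf hP _ _).trans ?_)
      exact mul_le_mul hv hz (qf_nonneg hP.posSemidef _) hZ
  -- The net contributes a factor 2, and passing through the posterior mean gives one deviation for
  -- θ and one for the sample; together this is the constant 4.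
  obtain ⟨v, hv, hle⟩ := hN (WithLp.toLp 2 (obs (r.θ ω) (r.z t ω) - obs (r.θbar t ω) (r.z t ω)))
  refine hle.trans ?_
  have e1 : inner ℝ v (WithLp.toLp 2 (obs (r.θ ω) (r.z t ω) - obs (r.θbar t ω) (r.z t ω))) =
      (colComb v (r.θ ω - r.θhat s ω)).ofLp ⬝ᵥ r.z t ω -
        (colComb v (r.θbar s ω - r.θhat s ω)).ofLp ⬝ᵥ r.z t ω := by
    rw [inner_eq_dotProduct, sum_z_dotProduct, sum_z_dotProduct, ← dotProduct_sub,
      r.θbar_clk ht]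
    congr 1
    ext i
    simp [obs, sub_dotProduct, hs]
  rw [e1]
  have a1 := abs_le.1 (hdev _ v (h1 v hv))
  have a2 := abs_le.1 (hdev _ v (h2 v hv))
  linarith [a1.2, a2.1]

end Run

end Pathwise

/-! ### Pathwise bounds for drift and prediction error. -/

lemma trace_le_card_mul_norm {ι : Type*} [Fintype ι] [DecidableEq ι] (S : Matrix ι ι ℝ) :
    S.trace ≤ Fintype.card ι * ‖S‖ := by
  rw [Matrix.trace, ← nsmul_eq_mul, ← Finset.card_univ]
  refine Finset.sum_le_card_nsmul _ _ _ fun i _ => ?_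
  have h := qf_le_norm S (Pi.single i 1)
  rw [norm_toLp_sq] at h
  simpa [qf] using h

lemma qf_sub_qf_le {ι : Type*} [Fintype ι] [DecidableEq ι] {S : Matrix ι ι ℝ} (hS : S.PosSemidef)
    (y y' : ι → ℝ) : qf S y - qf S y' ≤ ‖S‖ * ‖WithLp.toLp 2 (y - y')‖ *
      (‖WithLp.toLp 2 y‖ + ‖WithLp.toLp 2 y'‖) := by
  have h1 : qf S y - qf S y' = (y - y') ⬝ᵥ (S *ᵥ (y + y')) := by
    have := dotProduct_mulVec_comm_of_symm (transpose_eq_of_posSemidef hS) y y'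
    simp only [qf, mulVec_add, sub_dotProduct, dotProduct_add]
    linarith
  rw [h1]
  refine (le_abs_self _).trans ((abs_dotProduct_mulVec_le S _ _).trans ?_)
  rw [WithLp.toLp_add]
  gcongr
  exact norm_add_le _ _

/-- Uniform bounds over the support of the prior. -/
structure Problem.Bounds {n m : ℕ} (pb : Problem n m) (Tmin : ℕ) (α ρ s g : ℝ) : Prop where
  one_le : 1 ≤ α
  pos : 0 < ρ
  lt_one : ρ < 1
  powerBound : pb.PowerBound ρ α
  contract : α * ρ ^ Tmin ≤ 1
  ric_nonneg : 0 ≤ s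
  ric_le : ∀ φ ∈ pb.supp, ‖ricS pb.Q pb.R φ‖ ≤ s
  gain_nonneg : 0 ≤ g
  gain_le : ∀ φ ∈ pb.supp, ‖gain pb.Q pb.R φ‖ ≤ g
  bellman : ∀ φ ∈ pb.supp, ∀ x, qf (ricS pb.Q pb.R φ) x =
    cost pb.Q pb.R x (gain pb.Q pb.R φ *ᵥ x) +
      qf (ricS pb.Q pb.R φ) (pb.closedLoop φ φ *ᵥ x)
  optCost_eq : ∀ σ : ℝ, ∀ φ ∈ pb.supp,
    optCost pb.Q pb.R σ φ = σ ^ 2 * (ricS pb.Q pb.R φ).trace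

section PathwiseRegret

variable {n m : ℕ} {pb : Problem n m} {σ : ℝ} {Tmin : ℕ} {Ω : Type*} [mΩ : MeasurableSpace Ω]
  {P : Measure Ω} (r : Run pb σ Tmin P) {ω : Ω} {α ρ s g : ℝ}

lemma Problem.Bounds.stateConst_nonneg (hb : pb.Bounds Tmin α ρ s g) : 0 ≤ stateConst α ρ := by
  have := hb.one_le
  have := hb.lt_one
  have : 0 < 1 - ρ := by linarith
  unfold stateConst
  positivity

lemma Problem.Bounds.qf_ric_le (hb : pb.Bounds Tmin α ρ s g) {φ : Param n m} (hφ : φ ∈ pb.supp)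
    {x : Fin n → ℝ} {X : ℝ} (hx : ‖WithLp.toLp 2 x‖ ≤ X) :
    qf (ricS pb.Q pb.R φ) x ≤ s * X ^ 2 :=
  (qf_le_norm _ _).trans (mul_le_mul (hb.ric_le φ hφ) (by gcongr) (sq_nonneg _) hb.ric_nonneg)

lemma Problem.Bounds.trace_ric_le (hb : pb.Bounds Tmin α ρ s g) {φ : Param n m}
    (hφ : φ ∈ pb.supp) : (ricS pb.Q pb.R φ).trace ≤ n * s := by
  refine (trace_le_card_mul_norm _).trans ?_
  rw [Fintype.card_fin]
  gcongr
  exact hb.ric_le φ hφ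

namespace Run

/-- The Riccati matrix of the sampled parameter. -/
noncomputable def ric (r : Run pb σ Tmin P) (t : ℕ) (ω : Ω) : Matrix (Fin n) (Fin n) ℝ :=
  ricS pb.Q pb.R (r.θbar t ω)

lemma posSemidef_ric (t : ℕ) : (r.ric t ω).PosSemidef := posSemidef_ricS _

lemma cost_eq (hb : pb.Bounds Tmin α ρ s g) (hω : r.InSupp ω) {t : ℕ} (ht : 1 ≤ t) :
    cost pb.Q pb.R (r.x t ω) (r.u t ω) = qf (r.ric t ω) (r.x t ω) -
      qf (r.ric t ω) (obs (r.θbar t ω) (r.z t ω)) := by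
  rw [ric, hb.bellman _ (hω.2 t ht), r.u_eq t ht, r.obs_z ht]
  ring

variable {W : ℝ} {T : ℕ}

lemma sum_drift_le (hb : pb.Bounds Tmin α ρ s g) (hω : r.InSupp ω) (hT : 1 ≤ T) {X : ℝ}
    (hX : ∀ t, 1 ≤ t → t ≤ T + 1 → ‖WithLp.toLp 2 (r.x t ω)‖ ≤ X) :
    ∑ t ∈ Finset.Icc 1 T, (qf (r.ric t ω) (r.x t ω) - qf (r.ric t ω) (r.x (t + 1) ω)) ≤
      numStarts Tmin (r.detSig ω) T * (s * X ^ 2) :=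
  sum_telescope_le (V := fun t => qf (r.ric t ω) (r.x t ω))
    (V' := fun t => qf (r.ric t ω) (r.x (t + 1) ω))
    (fun t _ => qf_nonneg (r.posSemidef_ric t) _)
    (fun t h1 h2 => hb.qf_ric_le (hω.2 t h1) (hX t h1 (by omega)))
    (fun t _ h => by simp only [ric, r.θbar_succ_of_not_start h]) hT

lemma norm_obs_le (hb : pb.Bounds Tmin α ρ s g) (hω : r.InSupp ω) {t : ℕ} (ht : 1 ≤ t) {X : ℝ}
    (hX : ‖WithLp.toLp 2 (r.x t ω)‖ ≤ X) {ϑ : Param n m} (hϑ : ϑ ∈ pb.supp) :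
    ‖WithLp.toLp 2 (obs ϑ (r.z t ω))‖ ≤ α * X := by
  have h := norm_pow_le hb.one_le hb.powerBound hϑ (hω.2 t ht) 1 (r.x t ω)
  rw [pow_one, ← r.obs_z ht, pow_one] at h
  have h1 := hb.one_le
  have h2 := hb.lt_one
  have h3 := hb.pos
  calc _ ≤ α * ρ * ‖WithLp.toLp 2 (r.x t ω)‖ := h
    _ ≤ α * 1 * X := by gcongr
    _ = α * X := by ring

/-- Early steps are charged to the number of episodes, steps with large information gain to the log
determinant, and the remaining ones are small because the prediction is accurate. -/
lemma sum_error_le (hb : pb.Bounds Tmin α ρ s g) (hσ : 0 < σ) (hω : r.InSupp ω) (hT : 1 ≤ T)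
    {X : ℝ} (hX0 : 0 ≤ X) (hX : ∀ t, 1 ≤ t → t ≤ T + 1 → ‖WithLp.toLp 2 (r.x t ω)‖ ≤ X)
    {N : Finset (EuclideanSpace ℝ (Fin n))} (hN : ∀ y, ∃ v ∈ N, ‖y‖ ≤ 2 * inner ℝ v y)
    {Z : ℝ} (hZ : 0 ≤ Z) (h1 : ∀ t, 1 ≤ t → t ≤ T → ∀ v ∈ N, r.dev v t ω (r.θ ω) ≤ Z)
    (h2 : ∀ t, 1 ≤ t → t ≤ T → ω ∈ r.startSet t → ∀ v ∈ N, r.dev v t ω (r.θbar t ω) ≤ Z) :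
    ∑ t ∈ Finset.Icc 1 T, (qf (r.ric t ω) (obs (r.θ ω) (r.z t ω)) -
        qf (r.ric t ω) (obs (r.θbar t ω) (r.z t ω))) ≤
      s * α ^ 2 * X ^ 2 * ((Tmin + 1) * numStarts Tmin (r.detSig ω) T +
        Real.logb 2 (r.detSig ω 1 / r.detSig ω (T + 1))) +
      8 * s * α * X * √Z * √(2 * σ ^ 2) *
        √(T * Real.logb 2 (r.detSig ω 1 / r.detSig ω (T + 1))) := by
  classical
  have hα := hb.one_le
  have hs := hb.ric_nonneg
  set ℓ : ℕ → ℝ := fun t => Real.logb 2 (1 + r.info t ω) with hℓ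
  have hℓ0 : ∀ t, 1 ≤ t → 0 ≤ ℓ t := fun t ht =>
    Real.logb_nonneg (by norm_num) (by linarith [r.info_nonneg (ω := ω) ht])
  have hstep : ∀ t ∈ Finset.Icc 1 T, qf (r.ric t ω) (obs (r.θ ω) (r.z t ω)) -
        qf (r.ric t ω) (obs (r.θbar t ω) (r.z t ω)) ≤
      s * α ^ 2 * X ^ 2 * (if (t : ℤ) - (clock Tmin (r.detSig ω) t).1 ≤ Tmin then (1 : ℝ) else 0) +
        s * α ^ 2 * X ^ 2 * ℓ t + 8 * s * α * X * √Z * √(2 * σ ^ 2) * √(ℓ t) := by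
    intro t ht
    rw [Finset.mem_Icc] at ht
    have hi := r.info_nonneg (ω := ω) ht.1
    have hxt := hX t ht.1 (by omega)
    have o1 := r.norm_obs_le hb hω ht.1 hxt hω.1
    have o2 := r.norm_obs_le hb hω ht.1 hxt (hω.2 t ht.1)
    have hcrude : qf (r.ric t ω) (obs (r.θ ω) (r.z t ω)) -
        qf (r.ric t ω) (obs (r.θbar t ω) (r.z t ω)) ≤ s * α ^ 2 * X ^ 2 := by
      have b1 := hb.qf_ric_le (hω.2 t ht.1) o1
      have b2 := qf_nonneg (r.posSemidef_ric (ω := ω) t) (obs (r.θbar t ω) (r.z t ω))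
      change qf (r.ric t ω) _ ≤ _ at b1
      linarith [mul_pow α X 2]
    have hl := hℓ0 t ht.1
    have p1 : 0 ≤ s * α ^ 2 * X ^ 2 := by positivity
    have p2 : 0 ≤ 8 * s * α * X * √Z * √(2 * σ ^ 2) * √(ℓ t) := by positivity
    by_cases hearly : (t : ℤ) - (clock Tmin (r.detSig ω) t).1 ≤ Tmin
    · rw [if_pos hearly]
      nlinarith
    · rw [if_neg hearly]
      -- An information gain of at least 1 adds at least 1 to the base 2 logarithm, which pays for
      -- the crude bound. Below 1 the gain itself is at most log₂(1 + gain), because 2^u ≤ 1 + u on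
      -- [0, 1].
      rcases le_total 1 (r.info t ω) with hu | hu
      · have : 1 ≤ ℓ t := by
          rw [hℓ, Real.le_logb_iff_rpow_le (by norm_num) (by linarith), Real.rpow_one]
          linarith
        nlinarith
      · have hul : r.info t ω ≤ ℓ t := by
          rw [hℓ, Real.le_logb_iff_rpow_le (by norm_num) (by linarith)]
          have := rpow_one_add_le_one_add_mul_self (s := 1) (by norm_num) hi hu
          norm_num at this
          linarith
        obtain ⟨c1, c2, -⟩ := clock_bounds (Tmin := Tmin) (r.detSig ω) t ht.1
        have c1' : 1 ≤ (r.clk t ω).1 := c1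
        have c2' : (r.clk t ω).1 ≤ t := c2
        have he := r.norm_obs_sub_le hσ hN ht.1 hZ
          (h1 _ (by omega) (by omega)) (h2 _ (by omega) (by omega) (r.clk_mem_startSet ht.1)) hearly
        have hd := qf_sub_qf_le (r.posSemidef_ric (ω := ω) t) (obs (r.θ ω) (r.z t ω))
          (obs (r.θbar t ω) (r.z t ω))
        have hn : ‖r.ric t ω‖ ≤ s := hb.ric_le _ (hω.2 t ht.1)
        have h3 : √(2 * σ ^ 2 * r.info t ω) ≤ √(2 * σ ^ 2) * √(ℓ t) := by
          rw [← Real.sqrt_mul (by positivity)]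
          gcongr
        calc _ ≤ s * (4 * √Z * (√(2 * σ ^ 2) * √(ℓ t))) * (α * X + α * X) := by
              refine hd.trans ?_
              gcongr
              exact he.trans (by gcongr)
          _ = 8 * s * α * X * √Z * √(2 * σ ^ 2) * √(ℓ t) := by ring
          _ ≤ _ := by nlinarith
  refine (Finset.sum_le_sum hstep).trans ?_
  rw [Finset.sum_add_distrib, Finset.sum_add_distrib, ← Finset.mul_sum, ← Finset.mul_sum,
    ← Finset.mul_sum, r.sum_logb_info hT, mul_add (s * α ^ 2 * X ^ 2)]
  -- Cauchy-Schwarz over time; the sum of the logarithms telescopes to the log determinant ratio.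
  have hsq : ∑ t ∈ Finset.Icc 1 T, √(ℓ t) ≤
      √(T * Real.logb 2 (r.detSig ω 1 / r.detSig ω (T + 1))) := by
    rw [← r.sum_logb_info hT]
    refine Real.le_sqrt_of_sq_le ?_
    have := sq_sum_le_card_mul_sum_sq (s := Finset.Icc 1 T) (f := fun t => √(ℓ t))
    rw [Nat.card_Icc, Nat.add_sub_cancel] at this
    refine this.trans (le_of_eq ?_)
    congr 1
    exact Finset.sum_congr rfl fun t ht => Real.sq_sqrt (hℓ0 t (Finset.mem_Icc.1 ht).1)
  gcongr
  exact card_early_le hT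

end Run

end PathwiseRegret

/-! ### Dimension and noise scaling of the pathwise bound. -/

section ScaledRegret

variable {n m : ℕ} {pb : Problem n m} {σ : ℝ} {Tmin : ℕ} {Ω : Type*} [mΩ : MeasurableSpace Ω]
  {P : Measure Ω} (r : Run pb σ Tmin P) {ω : Ω} {α ρ s g : ℝ}

/-- Growth constant of the logarithm of the information gain. -/
noncomputable def infoConst (α ρ g c : ℝ) : ℝ := 2 * (c * (1 + g ^ 2) * stateConst α ρ ^ 2 + 2)

/-- Constant of the leading term in the pathwise regret bound. -/
noncomputable def mainConst (Tmin : ℕ) (α ρ s g c : ℝ) : ℝ :=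
  2 * s * stateConst α ρ ^ 2 * (infoConst α ρ g c + 2) +
  s * α ^ 2 * stateConst α ρ ^ 2 *
    (2 * (Tmin + 1) * (infoConst α ρ g c + 2) + infoConst α ρ g c) +
  16 * s * α * stateConst α ρ * infoConst α ρ g c +
  s * (Tmin + 2 * (infoConst α ρ g c + 2))

/-- The error term of the regret, after Young's inequality. -/
lemma error_term_le {n T d L η ξ c Λ s α C σ Z : ℝ} (hn : 0 ≤ n) (hT : 0 ≤ T) (hd : 0 ≤ d)
    (hL : 0 ≤ L) (hη : 0 ≤ η) (hξ : 0 ≤ ξ) (hξη : ξ ≤ η) (hc : 0 ≤ c) (hs : 0 ≤ s) (hα : 0 ≤ α)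
    (hC : 0 ≤ C) (hσ : 0 ≤ σ) (hZ : 0 ≤ Z) (hΛ : Λ ≤ c * (d * L * η)) :
    8 * s * α * (C * (σ * √(n * ξ))) * √Z * √(2 * σ ^ 2) * √(T * Λ) ≤
      16 * s * α * C * c * (σ ^ 2 * (d * √(n * T) * L * η ^ 2)) +
        8 * s * α * C * (σ ^ 2 * √(n * T) * Z) := by
  have e1 : √(2 * σ ^ 2) = √2 * σ := by
    rw [Real.sqrt_mul (by norm_num), Real.sqrt_sq hσ]
  have e2 : √(n * ξ) * √Z * √2 * √(T * Λ) ≤ √(n * T) * (2 * c * (d * L * η ^ 2) + Z) := by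
    calc √(n * ξ) * √Z * √2 * √(T * Λ)
        ≤ √(n * ξ) * √Z * √2 * √(T * (c * (d * L * η))) := by gcongr
      -- The product is regrouped so that √(nT) is split off; what is left is a geometric mean of Z
      -- and d L η², and Young's inequality keeps both linear in the dimension d.
      _ = √(n * T) * √((2 * c * (d * L * η) * ξ) * Z) := by
        rw [← Real.sqrt_mul (by positivity), ← Real.sqrt_mul (by positivity),
          ← Real.sqrt_mul (by positivity), ← Real.sqrt_mul (by positivity)]
        congr 1; ring
      _ ≤ √(n * T) * (2 * c * (d * L * η ^ 2) + Z) := by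
        gcongr
        have h3 : 2 * c * (d * L * η) * ξ ≤ 2 * c * (d * L * η ^ 2) := by
          calc _ ≤ 2 * c * (d * L * η) * η := by gcongr
            _ = _ := by ring
        have h4 : 0 ≤ 2 * c * (d * L * η) * ξ := by positivity
        rw [Real.sqrt_le_left (by positivity)]
        nlinarith
  rw [e1]
  calc _ = 8 * s * α * C * σ ^ 2 * (√(n * ξ) * √Z * √2 * √(T * Λ)) := by ring
    _ ≤ 8 * s * α * C * σ ^ 2 * (√(n * T) * (2 * c * (d * L * η ^ 2) + Z)) := by gcongr
    _ = _ := by ring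

/-- The sampling term of the regret. -/
lemma trace_term_le {n T d L η c K s σ tr τ : ℝ} (hn : 0 ≤ n) (hτ : 0 ≤ τ) (hK : 0 ≤ K)
    (hd1 : 1 ≤ d) (hL1 : 1 ≤ L) (hη1 : 1 ≤ η) (hc : 0 ≤ c) (hs : 0 ≤ s) (hRn : n ≤ √(n * T))
    (hnK : n * K ≤ 2 * (c + 2) * (d * √(n * T) * L * η)) (htr : tr ≤ n * s) :
    σ ^ 2 * (tr * (τ + K)) ≤
      s * (τ + 2 * (c + 2)) * (σ ^ 2 * (d * √(n * T) * L * η ^ 2)) := by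
  have e3 : n * τ ≤ τ * (d * √(n * T) * L * η ^ 2) := by
    have : n ≤ d * √(n * T) * L * η ^ 2 := by
      have l1 : 1 ≤ d * L * η ^ 2 := by
        have := one_le_mul_of_one_le_of_one_le hd1 hL1
        exact one_le_mul_of_one_le_of_one_le this (one_le_pow₀ hη1)
      calc n ≤ √(n * T) * 1 := by linarith
        _ ≤ √(n * T) * (d * L * η ^ 2) := by gcongr
        _ = _ := by ring
    calc _ = τ * n := by ring
      _ ≤ _ := by gcongr
  have e4 : n * K ≤ 2 * (c + 2) * (d * √(n * T) * L * η ^ 2) := by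
    refine hnK.trans ?_
    have : d * √(n * T) * L * η ≤ d * √(n * T) * L * η ^ 2 := by
      rw [sq, ← mul_assoc]
      exact le_mul_of_one_le_right (by positivity) hη1
    gcongr
  calc _ ≤ σ ^ 2 * (n * s * (τ + K)) := by gcongr
    _ = s * σ ^ 2 * (n * τ + n * K) := by ring
    _ ≤ s * σ ^ 2 * (τ * (d * √(n * T) * L * η ^ 2) +
        2 * (c + 2) * (d * √(n * T) * L * η ^ 2)) := by gcongr
    _ = _ := by ring

namespace Run

variable {T : ℕ} {ξ : ℝ}

lemma norm_z_sq_le (hb : pb.Bounds Tmin α ρ s g) (hω : r.InSupp ω) {t : ℕ} (ht : 1 ≤ t) {X : ℝ}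
    (hX : ‖WithLp.toLp 2 (r.x t ω)‖ ≤ X) :
    ‖WithLp.toLp 2 (r.z t ω)‖ ^ 2 ≤ (1 + g ^ 2) * X ^ 2 := by
  have h1 : ‖WithLp.toLp 2 (r.z t ω)‖ ^ 2 =
      ‖WithLp.toLp 2 (r.x t ω)‖ ^ 2 + ‖WithLp.toLp 2 (r.u t ω)‖ ^ 2 := by
    rw [norm_toLp_sq, norm_toLp_sq, norm_toLp_sq, z, sumElim_dotProduct_sumElim]
  have h2 : ‖WithLp.toLp 2 (r.u t ω)‖ ≤ g * X := by
    rw [r.u_eq t ht]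
    refine (norm_toLp_mulVec_le _ _).trans ?_
    have := hb.gain_nonneg
    gcongr
    exact hb.gain_le _ (hω.2 t ht)
  rw [h1]
  calc _ ≤ X ^ 2 + (g * X) ^ 2 := by gcongr
    _ = _ := by ring

/-- The determinant ratio is a power n + m of a quantity polynomial in T and ξ; the noise variance
cancels between σ⁻² and |z|². -/
lemma logb_detSig_le (hb : pb.Bounds Tmin α ρ s g) (hσ : 0 < σ) (hω : r.InSupp ω) (hn : 1 ≤ n)
    (hnT : n ≤ T) (hξ : 0 ≤ ξ)
    (hX : ∀ t, 1 ≤ t → t ≤ T + 1 →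
      ‖WithLp.toLp 2 (r.x t ω)‖ ≤ stateConst α ρ * (σ * √(n * ξ))) :
    Real.logb 2 (r.detSig ω 1 / r.detSig ω (T + 1)) ≤
      infoConst α ρ g ‖pb.cov‖ * ((n + m : ℝ) * (1 + Real.log T) * (1 + ξ)) := by
  set C := stateConst α ρ with hC
  set b := ‖pb.cov‖ * (1 + g ^ 2) * C ^ 2 with hbdef
  have hb0 : 0 ≤ b := by positivity
  have hn' : (1 : ℝ) ≤ n := by exact_mod_cast hn
  have hnT' : (n : ℝ) ≤ T := by exact_mod_cast hnT
  have hT' : (1 : ℝ) ≤ T := hn'.trans hnT'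
  have hlogT : 0 ≤ Real.log T := Real.log_nonneg hT'
  have hκ : 1 + ‖pb.cov‖ / σ ^ 2 * ∑ t ∈ Finset.Icc 1 T, ‖WithLp.toLp 2 (r.z t ω)‖ ^ 2 ≤
      (1 + b) * (T * T) * (1 + ξ) := by
    have h1 : ∑ t ∈ Finset.Icc 1 T, ‖WithLp.toLp 2 (r.z t ω)‖ ^ 2 ≤
        T * ((1 + g ^ 2) * (C * (σ * √(n * ξ))) ^ 2) := by
      have := Finset.sum_le_card_nsmul (Finset.Icc 1 T) (fun t => ‖WithLp.toLp 2 (r.z t ω)‖ ^ 2)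
        ((1 + g ^ 2) * (C * (σ * √(n * ξ))) ^ 2) fun t ht => by
          rw [Finset.mem_Icc] at ht
          exact r.norm_z_sq_le hb hω ht.1 (hX t ht.1 (by omega))
      rwa [Nat.card_Icc, Nat.add_sub_cancel, nsmul_eq_mul] at this
    calc _ ≤ 1 + ‖pb.cov‖ / σ ^ 2 * (T * ((1 + g ^ 2) * (C * (σ * √(n * ξ))) ^ 2)) := by gcongr
      _ = 1 + b * (T * n) * ξ := by
        rw [mul_pow, mul_pow, Real.sq_sqrt (by positivity), hbdef]
        field_simp
      -- The assumption n ≤ T removes the dimension from the logarithm.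
      _ ≤ 1 + b * (T * T) * ξ := by gcongr
      _ ≤ _ := by
        have : (1 : ℝ) ≤ T * T := by nlinarith
        have h2 : 0 ≤ b * (T * T) := by positivity
        have h3 : 0 ≤ (T * T : ℝ) * ξ := by positivity
        nlinarith
  set κ := 1 + ‖pb.cov‖ / σ ^ 2 * ∑ t ∈ Finset.Icc 1 T, ‖WithLp.toLp 2 (r.z t ω)‖ ^ 2 with hκd
  have hκ1 : 1 ≤ κ := by
    rw [hκd, le_add_iff_nonneg_right]
    exact mul_nonneg (by positivity) (Finset.sum_nonneg fun t _ => by positivity)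
  have hlogκ : Real.log κ ≤ b + 2 * Real.log T + ξ := by
    refine (Real.log_le_log (by linarith) hκ).trans ?_
    rw [Real.log_mul (by positivity) (by positivity), Real.log_mul (by positivity) (by positivity),
      Real.log_mul (by positivity) (by positivity)]
    have h1 := Real.log_le_sub_one_of_pos (show 0 < 1 + b by positivity)
    have h2 := Real.log_le_sub_one_of_pos (show 0 < 1 + ξ by positivity)
    linarith
  have hlogκ0 : 0 ≤ Real.log κ := Real.log_nonneg hκ1
  have hratio := r.detSig_ratio_le (ω := ω) (T := T)
  have hpos : 0 < r.detSig ω 1 / r.detSig ω (T + 1) :=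
    div_pos (r.detSig_pos le_rfl) (r.detSig_pos (by omega))
  have h1 : Real.log (r.detSig ω 1 / r.detSig ω (T + 1)) ≤ (n + m : ℝ) * Real.log κ := by
    refine (Real.log_le_log hpos hratio).trans ?_
    rw [Real.log_pow]
    push_cast
    exact le_rfl
  have h2 : Real.logb 2 (r.detSig ω 1 / r.detSig ω (T + 1)) ≤ 2 * ((n + m : ℝ) * Real.log κ) := by
    rw [Real.logb, div_le_iff₀ (Real.log_pos (by norm_num))]
    have h3 : (1 / 2 : ℝ) ≤ Real.log 2 := by linarith [Real.log_two_gt_d9]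
    have h4 : 0 ≤ (n + m : ℝ) * Real.log κ := by positivity
    nlinarith
  have h5 : Real.log κ ≤ (b + 2) * ((1 + Real.log T) * (1 + ξ)) := by
    refine hlogκ.trans ?_
    have : 0 ≤ Real.log T * ξ := by positivity
    nlinarith [mul_nonneg hb0 this, mul_nonneg hb0 hlogT, mul_nonneg hb0 hξ]
  calc _ ≤ 2 * ((n + m : ℝ) * Real.log κ) := h2
    _ ≤ 2 * ((n + m : ℝ) * ((b + 2) * ((1 + Real.log T) * (1 + ξ)))) := by gcongr
    _ = _ := by rw [infoConst, hbdef, hC]; ring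

lemma numStarts_le_of_detSig (hn : 1 ≤ n) (hnT : n ≤ T) (hξ : 0 ≤ ξ) {c : ℝ} (hc : 0 ≤ c)
    (h : Real.logb 2 (r.detSig ω 1 / r.detSig ω (T + 1)) ≤
      c * ((n + m : ℝ) * (1 + Real.log T) * (1 + ξ))) :
    n * numStarts Tmin (r.detSig ω) T ≤
      2 * (c + 2) * ((n + m : ℝ) * √(n * T) * (1 + Real.log T) * (1 + ξ)) := by
  have hn' : (1 : ℝ) ≤ n := by exact_mod_cast hn
  have hm' : (0 : ℝ) ≤ m := by positivity
  have hnT' : (n : ℝ) ≤ T := by exact_mod_cast hnT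
  have hT' : (1 : ℝ) ≤ T := hn'.trans hnT'
  have hlogT : 0 ≤ Real.log T := Real.log_nonneg hT'
  set d : ℝ := n + m with hd
  have hd1 : 1 ≤ d := by linarith
  -- This threshold balances T/q against q times the log determinant, which is of order d. It
  -- satisfies T/q = dq, and n ≤ d gives nq ≤ √(nT).
  set q : ℝ := √(T / d) with hq
  have hq0 : 0 < q := Real.sqrt_pos.2 (by positivity)
  have hq2 : q ^ 2 = T / d := Real.sq_sqrt (by positivity)
  have hK := numStarts_le (Tmin := Tmin) (D := r.detSig ω) (fun t ht => r.detSig_pos ht)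
    (fun t ht => r.detSig_succ_le ht) hq0 (T := T) (by omega)
  set E : ℝ := (1 + Real.log T) * (1 + ξ) with hE
  have hE1 : 1 ≤ E := by nlinarith [mul_nonneg hlogT hξ]
  have h1 : Real.logb 2 (r.detSig ω 1 / r.detSig ω (T + 1)) + 1 ≤ (c + 1) * (d * E) := by
    have : 1 ≤ d * E := by nlinarith
    calc _ ≤ c * (d * (1 + Real.log T) * (1 + ξ)) + d * E := by linarith
      _ = _ := by rw [hE]; ring
  have h2 : (T : ℝ) / q = d * q := by
    rw [div_eq_iff hq0.ne']
    have : d * q ^ 2 = T := by rw [hq2]; field_simp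
    linarith
  have hRq : n * q ≤ √(n * T) := by
    refine Real.le_sqrt_of_sq_le ?_
    rw [mul_pow, hq2, mul_div_assoc', div_le_iff₀ (by linarith)]
    have : (n : ℝ) ≤ d := by linarith
    have hh : 0 ≤ (n : ℝ) * T := by positivity
    nlinarith
  have hRn : (n : ℝ) ≤ √(n * T) := by
    refine Real.le_sqrt_of_sq_le ?_
    nlinarith
  have h3 : numStarts Tmin (r.detSig ω) T ≤ d * q + (q + 1) * ((c + 1) * (d * E)) := by
    rw [← h2]
    refine hK.trans ?_
    gcongr
  have hR0 : 0 ≤ √(n * T : ℝ) := Real.sqrt_nonneg _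
  calc _ ≤ n * (d * q + (q + 1) * ((c + 1) * (d * E))) := by gcongr
    _ = d * (n * q) + (n * q + n) * ((c + 1) * (d * E)) := by ring
    _ ≤ d * √(n * T) + (√(n * T) + √(n * T)) * ((c + 1) * (d * E)) := by gcongr
    _ ≤ d * √(n * T) * E + (√(n * T) + √(n * T)) * ((c + 1) * (d * E)) := by
      have : 0 ≤ d * √(n * T) := by positivity
      nlinarith
    _ ≤ 2 * (c + 2) * (d * √(n * T) * E) := by
      have : 0 ≤ d * √(n * T) * E := by positivity
      nlinarith
    _ = _ := by rw [hE]; ring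

/-- A squared state bound carries a factor nξσ², so each term reduces to nK, to n times the log
determinant, or to √(nT) times a mixed term; n ≤ √(nT) is used throughout. -/
lemma pathwise_gap_le (hb : pb.Bounds Tmin α ρ s g) (hσ : 0 < σ) (hω : r.InSupp ω) (hn : 1 ≤ n)
    (hnT : n ≤ T) (hξ : 0 ≤ ξ)
    (hw : ∀ t, 1 ≤ t → t ≤ T → ‖WithLp.toLp 2 (r.w t ω)‖ ≤ σ * √(n * ξ))
    {N : Finset (EuclideanSpace ℝ (Fin n))} (hN : ∀ y, ∃ v ∈ N, ‖y‖ ≤ 2 * inner ℝ v y)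
    {Z : ℝ} (hZ : 0 ≤ Z) (h1 : ∀ t, 1 ≤ t → t ≤ T → ∀ v ∈ N, r.dev v t ω (r.θ ω) ≤ Z)
    (h2 : ∀ t, 1 ≤ t → t ≤ T → ω ∈ r.startSet t → ∀ v ∈ N, r.dev v t ω (r.θbar t ω) ≤ Z) :
    ∑ t ∈ Finset.Icc 1 T, (qf (r.ric t ω) (r.x t ω) - qf (r.ric t ω) (r.x (t + 1) ω)) +
      ∑ t ∈ Finset.Icc 1 T, (qf (r.ric t ω) (obs (r.θ ω) (r.z t ω)) -
        qf (r.ric t ω) (obs (r.θbar t ω) (r.z t ω))) +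
      σ ^ 2 * ((ricS pb.Q pb.R (r.θ ω)).trace * (Tmin + numStarts Tmin (r.detSig ω) T)) ≤
    mainConst Tmin α ρ s g ‖pb.cov‖ *
      (σ ^ 2 * ((n + m : ℝ) * √(n * T) * (1 + Real.log T) * (1 + ξ) ^ 2)) +
      8 * s * α * stateConst α ρ * (σ ^ 2 * √(n * T) * Z) := by
  have hT : 1 ≤ T := by omega
  have hn' : (1 : ℝ) ≤ n := by exact_mod_cast hn
  have hm' : (0 : ℝ) ≤ m := by positivity
  have hnT' : (n : ℝ) ≤ T := by exact_mod_cast hnT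
  have hT' : (1 : ℝ) ≤ T := hn'.trans hnT'
  have hlogT : 0 ≤ Real.log T := Real.log_nonneg hT'
  have hX := fun t (ht : 1 ≤ t) (htT : t ≤ T + 1) => r.norm_x_le hb.one_le hb.pos hb.lt_one
    hb.powerBound hb.contract hω (by positivity) hw ht htT
  have hC0 := hb.stateConst_nonneg
  have hs0 := hb.ric_nonneg
  have hα := hb.one_le
  have hΛ := r.logb_detSig_le hb hσ hω hn hnT hξ hX
  have hc0 : 0 ≤ infoConst α ρ g ‖pb.cov‖ := by unfold infoConst; positivity
  have hK := r.numStarts_le_of_detSig hn hnT hξ hc0 hΛ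
  have g1 := r.sum_drift_le hb hω hT hX
  have g2 := r.sum_error_le hb hσ hω hT (by positivity) hX hN hZ h1 h2
  have htr := hb.trace_ric_le hω.1
  have hK0 := numStarts_nonneg (Tmin := Tmin) (D := r.detSig ω) T
  have hRn : (n : ℝ) ≤ √(n * T) := by
    refine Real.le_sqrt_of_sq_le ?_
    nlinarith
  set C := stateConst α ρ
  set c := infoConst α ρ g ‖pb.cov‖ with hcdef
  set K := numStarts Tmin (r.detSig ω) T
  set Λ := Real.logb 2 (r.detSig ω 1 / r.detSig ω (T + 1))
  set d : ℝ := n + m with hd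
  set L : ℝ := 1 + Real.log T with hL
  set η : ℝ := 1 + ξ with hη
  have hL1 : 1 ≤ L := by linarith
  have hη1 : 1 ≤ η := by linarith
  have hξη : ξ ≤ η := by linarith
  have hd1 : 1 ≤ d := by linarith
  have hR0 : 0 ≤ √(n * T : ℝ) := Real.sqrt_nonneg _
  have hX2 : (C * (σ * √(n * ξ))) ^ 2 = C ^ 2 * σ ^ 2 * (n * ξ) := by
    rw [mul_pow, mul_pow, Real.sq_sqrt (by positivity)]; ring
  have hnK : n * ξ * K ≤ 2 * (c + 2) * (d * √(n * T) * L * η ^ 2) := by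
    calc _ = n * K * ξ := by ring
      _ ≤ 2 * (c + 2) * (d * √(n * T) * L * η) * η := by gcongr
      _ = _ := by ring
  have hnΛ : n * ξ * Λ ≤ c * (d * √(n * T) * L * η ^ 2) := by
    calc _ ≤ n * ξ * (c * (d * L * η)) := by gcongr
      _ ≤ √(n * T) * η * (c * (d * L * η)) := by gcongr
      _ = _ := by ring
  have f1 : K * (s * (C * (σ * √(n * ξ))) ^ 2) ≤
      2 * s * C ^ 2 * (c + 2) * (σ ^ 2 * (d * √(n * T) * L * η ^ 2)) := by
    rw [hX2]
    calc _ = s * C ^ 2 * σ ^ 2 * (n * ξ * K) := by ring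
      _ ≤ s * C ^ 2 * σ ^ 2 * (2 * (c + 2) * (d * √(n * T) * L * η ^ 2)) := by gcongr
      _ = _ := by ring
  have f2 : s * α ^ 2 * (C * (σ * √(n * ξ))) ^ 2 * ((Tmin + 1) * K + Λ) ≤
      s * α ^ 2 * C ^ 2 * (2 * (Tmin + 1) * (c + 2) + c) *
        (σ ^ 2 * (d * √(n * T) * L * η ^ 2)) := by
    rw [hX2]
    calc _ = s * α ^ 2 * C ^ 2 * σ ^ 2 * ((Tmin + 1) * (n * ξ * K) + n * ξ * Λ) := by ring
      _ ≤ s * α ^ 2 * C ^ 2 * σ ^ 2 * ((Tmin + 1) * (2 * (c + 2) * (d * √(n * T) * L * η ^ 2)) +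
          c * (d * √(n * T) * L * η ^ 2)) := by gcongr
      _ = _ := by ring
  have f3 := error_term_le (T := T) (C := C) (σ := σ) (Z := Z) (α := α) (by linarith : (0 : ℝ) ≤ n)
    (by linarith) (by linarith) (by linarith) (by linarith) hξ hξη hc0 hs0 (by linarith) hC0 hσ.le
    hZ hΛ
  have f4 := trace_term_le (σ := σ) (by linarith : (0 : ℝ) ≤ n) (by positivity : (0 : ℝ) ≤ Tmin)
    hK0 hd1 hL1 hη1 hc0 hs0 hRn hK htr
  have hm : mainConst Tmin α ρ s g ‖pb.cov‖ = 2 * s * C ^ 2 * (c + 2) +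
      s * α ^ 2 * C ^ 2 * (2 * (Tmin + 1) * (c + 2) + c) + 16 * s * α * C * c +
      s * (Tmin + 2 * (c + 2)) := rfl
  rw [hm]
  linarith

end Run

end ScaledRegret

/-! ### Moments of logarithms. -/

section LogMoments

variable {Ω : Type*} [MeasurableSpace Ω] {P : Measure Ω} [IsProbabilityMeasure P]

lemma log_sq_le {u a : ℝ} (hu : 1 ≤ u) (ha : 1 ≤ a) :
    Real.log u ^ 2 ≤ 2 * Real.log a ^ 2 + 8 * (u / a) := by
  have h0 : 0 ≤ Real.log u := Real.log_nonneg hu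
  have hla : 0 ≤ Real.log a := Real.log_nonneg ha
  rcases le_total u a with h | h
  · have h1 := Real.log_le_log (by linarith) h
    have h2 : 0 ≤ u / a := by positivity
    nlinarith
  · have hv : 1 ≤ u / a := (one_le_div (by linarith)).2 h
    have h1 : Real.log u = Real.log a + Real.log (u / a) := by
      rw [Real.log_div (by linarith) (by linarith)]; ring
    have h2 : Real.log (u / a) ≤ 2 * √(u / a) := by
      have := Real.log_le_sub_one_of_pos (Real.sqrt_pos.2 (by linarith : 0 < u / a))
      rw [Real.log_sqrt (by linarith)] at this
      linarith
    have h3 : 0 ≤ Real.log (u / a) := Real.log_nonneg hv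
    have h4 : Real.log (u / a) ^ 2 ≤ 4 * (u / a) := by
      calc _ ≤ (2 * √(u / a)) ^ 2 := by gcongr
        _ = _ := by rw [mul_pow, Real.sq_sqrt (by linarith)]; norm_num
    rw [h1]
    nlinarith [sq_nonneg (Real.log a - Real.log (u / a))]

/-- The tangent of the logarithm at a gives log U ≤ log a - 1 + U/a, as in Jensen's inequality. The
square of the logarithm is not concave, so the cruder `log_sq_le` is integrated instead. -/
lemma log_moments {U : Ω → ℝ} (hU : Measurable U) (h1 : ∀ ω, 1 ≤ U ω) {a : ℝ} (ha : 1 ≤ a)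
    (h : ∫⁻ ω, ENNReal.ofReal (U ω) ∂P ≤ ENNReal.ofReal a) :
    (Integrable (fun ω => Real.log (U ω)) P ∧ ∫ ω, Real.log (U ω) ∂P ≤ Real.log a) ∧
      (Integrable (fun ω => Real.log (U ω) ^ 2) P ∧
        ∫ ω, Real.log (U ω) ^ 2 ∂P ≤ 2 * Real.log a ^ 2 + 8) := by
  have hint : Integrable U P := by
    refine ⟨hU.aestronglyMeasurable, ?_⟩
    rw [hasFiniteIntegral_iff_ofReal (ae_of_all _ fun ω => zero_le_one.trans (h1 ω))]
    exact h.trans_lt ENNReal.ofReal_lt_top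
  have hE : ∫ ω, U ω ∂P ≤ a := by
    rw [integral_eq_lintegral_of_nonneg_ae (ae_of_all _ fun ω => zero_le_one.trans (h1 ω)) hU.aestronglyMeasurable]
    exact ENNReal.toReal_le_of_le_ofReal (by linarith) h
  have ha0 : 0 < a := by linarith
  have hdiv : (∫ ω, U ω ∂P) / a ≤ 1 := (div_le_one ha0).2 hE
  have hl : ∀ ω, Real.log (U ω) ≤ (Real.log a - 1) + U ω / a := fun ω => by
    have h2 := Real.log_le_sub_one_of_pos (div_pos (by linarith [h1 ω]) ha0 : 0 < U ω / a)
    rw [Real.log_div (by linarith [h1 ω]) ha0.ne'] at h2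
    linarith
  have hl0 : ∀ ω, 0 ≤ Real.log (U ω) := fun ω => Real.log_nonneg (h1 ω)
  have hd1 : Integrable (fun ω => (Real.log a - 1) + U ω / a) P :=
    (integrable_const _).add (hint.div_const a)
  have hd2 : Integrable (fun ω => 2 * Real.log a ^ 2 + 8 * (U ω / a)) P :=
    (integrable_const _).add ((hint.div_const a).const_mul 8)
  have hi1 : Integrable (fun ω => Real.log (U ω)) P :=
    hd1.mono' hU.log.aestronglyMeasurable (ae_of_all _ fun ω => by
      rw [Real.norm_of_nonneg (hl0 ω)]; exact hl ω)
  have hi2 : Integrable (fun ω => Real.log (U ω) ^ 2) P :=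
    hd2.mono' (hU.log.pow_const 2).aestronglyMeasurable (ae_of_all _ fun ω => by
      rw [Real.norm_of_nonneg (sq_nonneg _)]; exact log_sq_le (h1 ω) ha)
  refine ⟨⟨hi1, ?_⟩, hi2, ?_⟩
  · refine (integral_mono hi1 hd1 hl).trans ?_
    rw [integral_add (integrable_const _) (hint.div_const a), integral_const, integral_div]
    simp
    linarith
  · refine (integral_mono hi2 hd2 fun ω => log_sq_le (h1 ω) ha).trans ?_
    rw [integral_add (integrable_const _) ((hint.div_const a).const_mul 8), integral_const,
      integral_const_mul, integral_div]
    simp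
    linarith

end LogMoments

/-! ### Noise level and deviations as logarithms of potentials. -/

section Potentials

variable {n m : ℕ} {pb : Problem n m} {σ : ℝ} {Tmin : ℕ} {Ω : Type*} [mΩ : MeasurableSpace Ω]
  {P : Measure Ω} (r : Run pb σ Tmin P)

namespace Run

/-- Exponential potential of the noise. -/
noncomputable def noisePot (r : Run pb σ Tmin P) (T : ℕ) (ω : Ω) : ℝ :=
  ∑ t ∈ Finset.Icc 1 T, Real.exp ((r.w t ω ⬝ᵥ r.w t ω) / (4 * σ ^ 2))

/-- The squared size of the noise, relative to its mean. -/
noncomputable def noiseLevel (r : Run pb σ Tmin P) (T : ℕ) (ω : Ω) : ℝ :=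
  4 / n * Real.log (r.noisePot T ω)

lemma one_le_noisePot {T : ℕ} (hT : 1 ≤ T) (ω : Ω) : 1 ≤ r.noisePot T ω := by
  have h : ∀ t, 1 ≤ Real.exp ((r.w t ω ⬝ᵥ r.w t ω) / (4 * σ ^ 2)) := fun t => by
    refine Real.one_le_exp (div_nonneg ?_ (by positivity))
    rw [← norm_toLp_sq]; positivity
  exact (h 1).trans (Finset.single_le_sum
    (f := fun t => Real.exp ((r.w t ω ⬝ᵥ r.w t ω) / (4 * σ ^ 2)))
    (fun t _ => (zero_le_one.trans (h t))) (Finset.mem_Icc.2 ⟨le_rfl, hT⟩))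

lemma noiseLevel_nonneg {T : ℕ} (hT : 1 ≤ T) (ω : Ω) : 0 ≤ r.noiseLevel T ω :=
  mul_nonneg (by positivity) (Real.log_nonneg (r.one_le_noisePot hT ω))

/-- One summand of the potential is at most the whole sum. The factor 4/n in the noise level undoes
the exponent 1/(4σ²) and normalizes by the dimension. -/
lemma norm_w_le (hσ : 0 < σ) (hn : 1 ≤ n) {T t : ℕ} (ht : 1 ≤ t) (htT : t ≤ T) (ω : Ω) :
    ‖WithLp.toLp 2 (r.w t ω)‖ ≤ σ * √(n * r.noiseLevel T ω) := by
  have hn' : (n : ℝ) ≠ 0 := by positivity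
  have h1 : (r.w t ω ⬝ᵥ r.w t ω) / (4 * σ ^ 2) ≤ Real.log (r.noisePot T ω) := by
    rw [Real.le_log_iff_exp_le (zero_lt_one.trans_le (r.one_le_noisePot (ht.trans htT) ω))]
    exact Finset.single_le_sum (f := fun t => Real.exp ((r.w t ω ⬝ᵥ r.w t ω) / (4 * σ ^ 2)))
      (fun t _ => (Real.exp_pos _).le) (Finset.mem_Icc.2 ⟨ht, htT⟩)
  rw [div_le_iff₀ (by positivity), ← norm_toLp_sq] at h1
  have h2 : n * r.noiseLevel T ω = 4 * Real.log (r.noisePot T ω) := by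
    rw [noiseLevel]; field_simp
  rw [h2]
  refine abs_le_of_sq_le_sq' ?_ (by positivity) |>.2
  rw [mul_pow, Real.sq_sqrt (by have := Real.log_nonneg (r.one_le_noisePot (ht.trans htT) ω); positivity)]
  linarith

lemma measurable_noisePot (T : ℕ) : Measurable (r.noisePot T) :=
  Finset.measurable_sum _ fun t _ =>
    ((measurable_dotProduct (r.measurable_w t) (r.measurable_w t)).div_const _).exp

lemma lintegral_noisePot_le (hσ : 0 < σ) (T : ℕ) :
    ∫⁻ ω, ENNReal.ofReal (r.noisePot T ω) ∂P ≤ ENNReal.ofReal (T * √2 ^ n) := by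
  have hm : Measurable fun x : Fin n → ℝ => ENNReal.ofReal (Real.exp ((x ⬝ᵥ x) / (4 * σ ^ 2))) :=
    ((measurable_dotProduct measurable_id measurable_id).div_const _).exp.ennreal_ofReal
  have h : ∀ t ∈ Finset.Icc 1 T, ∫⁻ ω, ENNReal.ofReal
      (Real.exp ((r.w t ω ⬝ᵥ r.w t ω) / (4 * σ ^ 2))) ∂P = ENNReal.ofReal √2 ^ n := fun t ht => by
    rw [← lintegral_exp_sq_noise n hσ, ← r.law_w t (Finset.mem_Icc.1 ht).1,
      lintegral_map hm (r.measurable_w t)]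
  have hm' : ∀ t, Measurable fun ω => ENNReal.ofReal
      (Real.exp ((r.w t ω ⬝ᵥ r.w t ω) / (4 * σ ^ 2))) := fun t => hm.comp (r.measurable_w t)
  simp only [noisePot]
  simp only [ENNReal.ofReal_sum_of_nonneg fun t _ => (Real.exp_pos _).le]
  rw [lintegral_finsetSum _ fun t _ => hm' t, Finset.sum_congr rfl h,
    Finset.sum_const, Nat.card_Icc, Nat.add_sub_cancel, ENNReal.ofReal_mul (by positivity),
    ENNReal.ofReal_natCast, nsmul_eq_mul, ENNReal.ofReal_pow (by positivity)]

/-- The potential has mean at most T √2^n, whose logarithm is at most n(1 + log T); the factor 4/n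
removes the dimension. The estimate leads to 2 + 320(1 + log T)², rounded up to 400(1 + log T)². -/
lemma integrable_noiseLevel [IsProbabilityMeasure P] (hσ : 0 < σ) (hn : 1 ≤ n) {T : ℕ}
    (hT : 1 ≤ T) : Integrable (fun ω => (1 + r.noiseLevel T ω) ^ 2) P ∧
      ∫ ω, (1 + r.noiseLevel T ω) ^ 2 ∂P ≤ 400 * (1 + Real.log T) ^ 2 := by
  have hn' : (1 : ℝ) ≤ n := by exact_mod_cast hn
  have hT' : (1 : ℝ) ≤ T := by exact_mod_cast hT
  have h2 : (1 : ℝ) ≤ √2 := Real.one_le_sqrt.2 (by norm_num)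
  have ha : (1 : ℝ) ≤ T * √2 ^ n := one_le_mul_of_one_le_of_one_le hT' (one_le_pow₀ h2)
  obtain ⟨⟨i1, -⟩, i2, b2⟩ := log_moments (P := P) (r.measurable_noisePot T)
    (r.one_le_noisePot hT) ha (r.lintegral_noisePot_le hσ T)
  have he : ∀ ω, (1 + r.noiseLevel T ω) ^ 2 = 1 + 8 / n * Real.log (r.noisePot T ω) +
      16 / n ^ 2 * Real.log (r.noisePot T ω) ^ 2 := fun ω => by
    rw [noiseLevel]; ring
  have hi : Integrable (fun ω => (1 + r.noiseLevel T ω) ^ 2) P := by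
    simp only [he]
    exact ((integrable_const _).add (i1.const_mul _)).add (i2.const_mul _)
  refine ⟨hi, ?_⟩
  have hle : ∀ ω, (1 + r.noiseLevel T ω) ^ 2 ≤
      2 + 32 / n ^ 2 * Real.log (r.noisePot T ω) ^ 2 := fun ω => by
    have : 32 / (n : ℝ) ^ 2 * Real.log (r.noisePot T ω) ^ 2 = 2 * r.noiseLevel T ω ^ 2 := by
      rw [noiseLevel]; ring
    rw [this]
    nlinarith [sq_nonneg (1 - r.noiseLevel T ω)]
  have hd : Integrable (fun ω => 2 + 32 / (n : ℝ) ^ 2 * Real.log (r.noisePot T ω) ^ 2) P :=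
    (integrable_const _).add (i2.const_mul _)
  refine (integral_mono hi hd hle).trans ?_
  rw [integral_add (integrable_const _) (i2.const_mul _), integral_const, integral_const_mul]
  simp only [probReal_univ, smul_eq_mul, one_mul]
  have hlogT : 0 ≤ Real.log T := Real.log_nonneg hT'
  have hla : Real.log (T * √2 ^ n) ≤ n * (1 + Real.log T) := by
    rw [Real.log_mul (by positivity) (by positivity), Real.log_pow]
    have h3 : Real.log √2 ≤ 1 := by
      rw [Real.log_sqrt (by norm_num)]; linarith [Real.log_two_lt_d9]
    nlinarith
  have hla0 : 0 ≤ Real.log (T * √2 ^ n) := Real.log_nonneg ha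
  have hsq : Real.log (T * √2 ^ n) ^ 2 ≤ n ^ 2 * (1 + Real.log T) ^ 2 := by
    rw [← mul_pow]; gcongr
  have hL : 1 ≤ (1 + Real.log T) ^ 2 := one_le_pow₀ (by linarith)
  have hnn : (1 : ℝ) ≤ n ^ 2 := one_le_pow₀ hn'
  calc 2 + 32 / (n : ℝ) ^ 2 * ∫ ω, Real.log (r.noisePot T ω) ^ 2 ∂P
      ≤ 2 + 32 / (n : ℝ) ^ 2 * (2 * (n ^ 2 * (1 + Real.log T) ^ 2) +
          8 * (n ^ 2 * (1 + Real.log T) ^ 2)) := by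
        gcongr
        nlinarith
    _ = 2 + 320 * (1 + Real.log T) ^ 2 := by field_simp; ring
    _ ≤ _ := by linarith

/-- Exponential potential of the deviations of the true and the sampled parameters. -/
noncomputable def devPot (r : Run pb σ Tmin P) (N : Finset (EuclideanSpace ℝ (Fin n))) (T : ℕ)
    (ω : Ω) : ℝ :=
  ∑ t ∈ Finset.Icc 1 T, ∑ v ∈ N, (Real.exp (r.dev v t ω (r.θ ω) / 4) +
    (r.startSet t).indicator (fun ω => Real.exp (r.dev v t ω (r.θbar t ω) / 4)) ω)

variable {N : Finset (EuclideanSpace ℝ (Fin n))}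

lemma devPot_term_nonneg (v : EuclideanSpace ℝ (Fin n)) (t : ℕ) (ω : Ω) :
    0 ≤ Real.exp (r.dev v t ω (r.θ ω) / 4) +
    (r.startSet t).indicator (fun ω => Real.exp (r.dev v t ω (r.θbar t ω) / 4)) ω :=
  add_nonneg (Real.exp_pos _).le (Set.indicator_nonneg (fun _ _ => (Real.exp_pos _).le) _)

lemma devPot_term_le {T t : ℕ} (ht : 1 ≤ t) (htT : t ≤ T) {v : EuclideanSpace ℝ (Fin n)}
    (hv : v ∈ N) (ω : Ω) : Real.exp (r.dev v t ω (r.θ ω) / 4) +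
    (r.startSet t).indicator (fun ω => Real.exp (r.dev v t ω (r.θbar t ω) / 4)) ω ≤
      r.devPot N T ω :=
  (Finset.single_le_sum (f := fun v => Real.exp (r.dev v t ω (r.θ ω) / 4) +
    (r.startSet t).indicator (fun ω => Real.exp (r.dev v t ω (r.θbar t ω) / 4)) ω)
    (fun v _ => r.devPot_term_nonneg v t ω) hv).trans
  (Finset.single_le_sum (f := fun t => ∑ v ∈ N, (Real.exp (r.dev v t ω (r.θ ω) / 4) +
    (r.startSet t).indicator (fun ω => Real.exp (r.dev v t ω (r.θbar t ω) / 4)) ω))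
    (fun t _ => Finset.sum_nonneg fun v _ => r.devPot_term_nonneg v t ω)
    (Finset.mem_Icc.2 ⟨ht, htT⟩))

lemma one_le_devPot (hN : N.Nonempty) {T : ℕ} (hT : 1 ≤ T) (ω : Ω) : 1 ≤ r.devPot N T ω := by
  obtain ⟨v, hv⟩ := hN
  refine le_trans ?_ (r.devPot_term_le le_rfl hT hv ω)
  have h1 : 1 ≤ Real.exp (r.dev v 1 ω (r.θ ω) / 4) := Real.one_le_exp
    (div_nonneg (qf_nonneg (r.posDef_Sig 1 le_rfl ω).inv.posSemidef _) (by norm_num))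
  have h2 := Set.indicator_nonneg (s := r.startSet 1)
    (f := fun ω => Real.exp (r.dev v 1 ω (r.θbar 1 ω) / 4)) (fun _ _ => (Real.exp_pos _).le) ω
  linarith

lemma dev_θ_le (hN : N.Nonempty) {T t : ℕ} (ht : 1 ≤ t) (htT : t ≤ T)
    {v : EuclideanSpace ℝ (Fin n)} (hv : v ∈ N) (ω : Ω) :
    r.dev v t ω (r.θ ω) ≤ 4 * Real.log (r.devPot N T ω) := by
  have h : r.dev v t ω (r.θ ω) / 4 ≤ Real.log (r.devPot N T ω) := by
    rw [Real.le_log_iff_exp_le (zero_lt_one.trans_le (r.one_le_devPot hN (ht.trans htT) ω))]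
    refine le_trans ?_ (r.devPot_term_le ht htT hv ω)
    exact le_add_of_nonneg_right (Set.indicator_nonneg (fun _ _ => (Real.exp_pos _).le) _)
  linarith

lemma dev_θbar_le (hN : N.Nonempty) {T t : ℕ} (ht : 1 ≤ t) (htT : t ≤ T)
    {v : EuclideanSpace ℝ (Fin n)} (hv : v ∈ N) {ω : Ω} (hω : ω ∈ r.startSet t) :
    r.dev v t ω (r.θbar t ω) ≤ 4 * Real.log (r.devPot N T ω) := by
  have h : r.dev v t ω (r.θbar t ω) / 4 ≤ Real.log (r.devPot N T ω) := by
    rw [Real.le_log_iff_exp_le (zero_lt_one.trans_le (r.one_le_devPot hN (ht.trans htT) ω))]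
    refine le_trans ?_ (r.devPot_term_le ht htT hv ω)
    rw [Set.indicator_of_mem hω]
    exact le_add_of_nonneg_left (Real.exp_pos _).le
  linarith

variable [IsProbabilityMeasure P]

lemma measurable_exp_dev_comp (hσ : 0 < σ) {t : ℕ} (ht : 1 ≤ t) (v : EuclideanSpace ℝ (Fin n))
    {ϑ : Ω → Param n m} (hϑ : Measurable ϑ) :
    Measurable fun ω => Real.exp (r.dev v t ω (ϑ ω) / 4) := by
  have h1 := r.measurable_Sig hσ ht
  have h2 := r.measurable_θhat hσ ht
  exact ((measurable_qf (measurable_matrix_inv h1) ((WithLp.measurable_ofLp _ _).comp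
      ((measurable_colComb v).comp (hϑ.sub h2)))).div_const 4).exp

lemma measurable_devPot (hσ : 0 < σ) (N : Finset (EuclideanSpace ℝ (Fin n))) (T : ℕ) :
    Measurable (r.devPot N T) := by
  refine Finset.measurable_sum _ fun t ht => Finset.measurable_sum _ fun v _ => ?_
  rw [Finset.mem_Icc] at ht
  exact (r.measurable_exp_dev_comp hσ ht.1 v r.measurable_θ).add
    ((r.measurable_exp_dev_comp hσ ht.1 v (r.measurable_θbar t)).indicator
      (r.measurableSet_startSet hσ ht.1))

/-- Union bound over times and net, with two deviations per pair: one for θ, and one for the sample,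
which is counted only where an episode starts. -/
lemma lintegral_devPot_le (hσ : 0 < σ) (hN : ∀ v ∈ N, ‖v‖ = 1) (T : ℕ) :
    ∫⁻ ω, ENNReal.ofReal (r.devPot N T ω) ∂P ≤
      ENNReal.ofReal (T * (N.card * (2 * (√2 ^ (n + m) * ((gaussParam pb.mean pb.cov).real pb.supp)⁻¹)))) := by
  set B : ℝ := √2 ^ (n + m) * ((gaussParam pb.mean pb.cov).real pb.supp)⁻¹ with hB
  have hB0 : 0 ≤ B := by positivity
  have hBe : ENNReal.ofReal √2 ^ (n + m) * (gaussParam pb.mean pb.cov pb.supp)⁻¹ =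
      ENNReal.ofReal B := by
    have hp : 0 < (gaussParam pb.mean pb.cov).real pb.supp :=
      ENNReal.toReal_pos pb.mass_ne_zero (measure_ne_top _ _)
    rw [hB, ENNReal.ofReal_mul (by positivity), ENNReal.ofReal_pow (by positivity),
      ENNReal.ofReal_inv_of_pos hp, ofReal_measureReal]
  have hterm : ∀ t ∈ Finset.Icc 1 T, ∀ v ∈ N, ∫⁻ ω, ENNReal.ofReal
      (Real.exp (r.dev v t ω (r.θ ω) / 4) + (r.startSet t).indicator
        (fun ω => Real.exp (r.dev v t ω (r.θbar t ω) / 4)) ω) ∂P ≤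
        ENNReal.ofReal (2 * B) := by
    intro t ht v hv
    rw [Finset.mem_Icc] at ht
    have hs := r.measurableSet_startSet hσ ht.1
    have e : ∀ ω, ENNReal.ofReal (Real.exp (r.dev v t ω (r.θ ω) / 4) + (r.startSet t).indicator
        (fun ω => Real.exp (r.dev v t ω (r.θbar t ω) / 4)) ω) =
        ENNReal.ofReal (Real.exp (r.dev v t ω (r.θ ω) / 4)) + (r.startSet t).indicator
        (fun ω => ENNReal.ofReal (Real.exp (r.dev v t ω (r.θbar t ω) / 4))) ω := fun ω => by
      rw [ENNReal.ofReal_add (Real.exp_pos _).le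
        (Set.indicator_nonneg (fun _ _ => (Real.exp_pos _).le) _)]
      congr 1
      by_cases h : ω ∈ r.startSet t <;> simp [h]
    simp only [e]
    rw [lintegral_add_left (r.measurable_exp_dev_comp hσ ht.1 v r.measurable_θ).ennreal_ofReal,
      lintegral_indicator hs, two_mul, ENNReal.ofReal_add hB0 hB0, ← hBe]
    exact add_le_add (r.lintegral_exp_dev_le hσ ht.1 (hN v hv))
      (r.lintegral_exp_dev_θbar_le hσ ht.1 (hN v hv))
  have hmeas : ∀ t ∈ Finset.Icc 1 T, ∀ v ∈ N, Measurable fun ω => ENNReal.ofReal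
      (Real.exp (r.dev v t ω (r.θ ω) / 4) + (r.startSet t).indicator
        (fun ω => Real.exp (r.dev v t ω (r.θbar t ω) / 4)) ω) := fun t ht v _ => by
    rw [Finset.mem_Icc] at ht
    exact ((r.measurable_exp_dev_comp hσ ht.1 v r.measurable_θ).add
      ((r.measurable_exp_dev_comp hσ ht.1 v (r.measurable_θbar t)).indicator
        (r.measurableSet_startSet hσ ht.1))).ennreal_ofReal
  have hsum : ∀ ω, ENNReal.ofReal (r.devPot N T ω) = ∑ t ∈ Finset.Icc 1 T, ∑ v ∈ N,
      ENNReal.ofReal (Real.exp (r.dev v t ω (r.θ ω) / 4) + (r.startSet t).indicator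
        (fun ω => Real.exp (r.dev v t ω (r.θbar t ω) / 4)) ω) := fun ω => by
    rw [devPot, ENNReal.ofReal_sum_of_nonneg fun t _ =>
      Finset.sum_nonneg fun v _ => r.devPot_term_nonneg v t ω]
    exact Finset.sum_congr rfl fun t _ =>
      ENNReal.ofReal_sum_of_nonneg fun v _ => r.devPot_term_nonneg v t ω
  simp only [hsum]
  rw [lintegral_finsetSum' _ fun t ht =>
    (Finset.measurable_sum _ fun v hv => hmeas t ht v hv).aemeasurable]
  have h1 : ∀ t ∈ Finset.Icc 1 T, ∫⁻ ω, ∑ v ∈ N,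
      ENNReal.ofReal (Real.exp (r.dev v t ω (r.θ ω) / 4) + (r.startSet t).indicator
        (fun ω => Real.exp (r.dev v t ω (r.θbar t ω) / 4)) ω) ∂P ≤
      N.card • ENNReal.ofReal (2 * B) := fun t ht => by
    rw [lintegral_finsetSum' _ fun v hv => (hmeas t ht v hv).aemeasurable]
    exact Finset.sum_le_card_nsmul _ _ _ (hterm t ht)
  refine (Finset.sum_le_card_nsmul _ _ _ h1).trans (le_of_eq ?_)
  rw [Nat.card_Icc, Nat.add_sub_cancel, nsmul_eq_mul, nsmul_eq_mul,
    ENNReal.ofReal_mul (p := (T : ℝ)) (by positivity),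
    ENNReal.ofReal_mul (p := (N.card : ℝ)) (by positivity), ENNReal.ofReal_natCast,
    ENNReal.ofReal_natCast]

/-- The logarithm turns the 5^n points of the net and the moments √2^(n+m) into terms linear in n +
m, so the net does not affect the order of the bound. -/
lemma integrable_log_devPot (hσ : 0 < σ) (hn : 1 ≤ n) (hN0 : N.Nonempty) (hNc : N.card ≤ 5 ^ n)
    (hN : ∀ v ∈ N, ‖v‖ = 1) {T : ℕ} (hT : 1 ≤ T) :
    Integrable (fun ω => Real.log (r.devPot N T ω)) P ∧
      ∫ ω, Real.log (r.devPot N T ω) ∂P ≤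
        (5 + ((gaussParam pb.mean pb.cov).real pb.supp)⁻¹) * ((n + m) * (1 + Real.log T)) := by
  have hn' : (1 : ℝ) ≤ n := by exact_mod_cast hn
  have hT' : (1 : ℝ) ≤ T := by exact_mod_cast hT
  have hm0 : (0 : ℝ) ≤ m := by positivity
  set M := (gaussParam pb.mean pb.cov).real pb.supp with hM
  have hp : 0 < M := ENNReal.toReal_pos pb.mass_ne_zero (measure_ne_top _ _)
  have hM1 : M ≤ 1 := measureReal_le_one
  have hMi : 1 ≤ M⁻¹ := (one_le_inv₀ hp).2 hM1
  have h2 : (1 : ℝ) ≤ √2 := Real.one_le_sqrt.2 (by norm_num)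
  have h2p : (1 : ℝ) ≤ √2 ^ (n + m) := one_le_pow₀ h2
  have h5p : (1 : ℝ) ≤ 5 ^ n := one_le_pow₀ (by norm_num)
  have hle : ∫⁻ ω, ENNReal.ofReal (r.devPot N T ω) ∂P ≤
      ENNReal.ofReal (T * (5 ^ n * (2 * (√2 ^ (n + m) * M⁻¹)))) := by
    refine (r.lintegral_devPot_le hσ hN T).trans (ENNReal.ofReal_le_ofReal ?_)
    gcongr
    exact_mod_cast hNc
  have ha : 1 ≤ (T : ℝ) * (5 ^ n * (2 * (√2 ^ (n + m) * M⁻¹))) :=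
    one_le_mul_of_one_le_of_one_le hT' (one_le_mul_of_one_le_of_one_le h5p
      (one_le_mul_of_one_le_of_one_le (by norm_num) (one_le_mul_of_one_le_of_one_le h2p hMi)))
  obtain ⟨⟨i1, b1⟩, -⟩ := log_moments (P := P) (r.measurable_devPot hσ N T)
    (r.one_le_devPot hN0 hT) ha hle
  refine ⟨i1, b1.trans ?_⟩
  rw [Real.log_mul (by positivity) (by positivity), Real.log_mul (by positivity) (by positivity),
    Real.log_mul (by positivity) (by positivity), Real.log_mul (by positivity) (by positivity),
    Real.log_pow, Real.log_pow]
  have l1 : Real.log 5 ≤ 2 := by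
    rw [Real.log_le_iff_le_exp (by norm_num)]
    have := Real.add_one_le_exp (1 : ℝ)
    have h3 : Real.exp 2 = Real.exp 1 * Real.exp 1 := by rw [← Real.exp_add]; norm_num
    have := Real.exp_one_gt_d9
    nlinarith
  have l2 : Real.log 2 ≤ 1 := by linarith [Real.log_two_lt_d9]
  have l3 : Real.log √2 ≤ 1 := by rw [Real.log_sqrt (by norm_num)]; linarith
  have l4 : Real.log M⁻¹ ≤ M⁻¹ := (Real.log_le_sub_one_of_pos (by positivity)).trans (by linarith)
  have hlogT : 0 ≤ Real.log T := Real.log_nonneg hT'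
  have hd : (1 : ℝ) ≤ n + m := by linarith
  push_cast
  have e1 : Real.log T ≤ (n + m) * Real.log T := le_mul_of_one_le_left hlogT hd
  have e2 : (n : ℝ) * Real.log 5 ≤ n * 2 := by gcongr
  have e3 : ((n : ℝ) + m) * Real.log √2 ≤ (n + m) * 1 := by gcongr
  have e4 : M⁻¹ ≤ M⁻¹ * ((n + m) * (1 + Real.log T)) :=
    le_mul_of_one_le_right (by positivity) (one_le_mul_of_one_le_of_one_le hd (by linarith))
  have e5 : 0 ≤ ((n : ℝ) + m) * Real.log T := by positivity
  linarith

end Run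

end Potentials

/-! ### Expectation of the noise term and of the sampling term. -/

section Expectation

variable {n m : ℕ} {pb : Problem n m} {σ : ℝ} {Tmin : ℕ} {Ω : Type*} [mΩ : MeasurableSpace Ω]
  {P : Measure Ω} [IsProbabilityMeasure P] (r : Run pb σ Tmin P) {α ρ s g : ℝ}

lemma measurable_matrix_trace {X ι : Type*} [MeasurableSpace X] [Fintype ι] {S : X → Matrix ι ι ℝ}
    (hS : Measurable S) : Measurable fun a => (S a).trace :=
  Finset.measurable_sum _ fun i _ => (measurable_matrix_iff.1 hS) i i

namespace Run

variable {T : ℕ}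

lemma ae_inSupp (hσ : 0 < σ) : ∀ᵐ ω ∂P, r.InSupp ω := by
  filter_upwards [r.ae_θ_mem, r.ae_θbar_mem hσ] with ω h1 h2 using ⟨h1, h2⟩

/-- Bound on the states up to the horizon. -/
noncomputable def stateBound (r : Run pb σ Tmin P) (α ρ : ℝ) (T : ℕ) (ω : Ω) : ℝ :=
  stateConst α ρ * (σ * √(n * r.noiseLevel T ω))

omit [IsProbabilityMeasure P] in
lemma norm_x_le_stateBound (hb : pb.Bounds Tmin α ρ s g) (hσ : 0 < σ) (hn : 1 ≤ n) {ω : Ω}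
    (hω : r.InSupp ω) {t : ℕ} (ht : 1 ≤ t) (htT : t ≤ T + 1) :
    ‖WithLp.toLp 2 (r.x t ω)‖ ≤ r.stateBound α ρ T ω :=
  r.norm_x_le hb.one_le hb.pos hb.lt_one hb.powerBound hb.contract hω (by positivity)
    (fun _ h1 h2 => r.norm_w_le hσ hn h1 h2 ω) ht htT

omit [IsProbabilityMeasure P] in
lemma stateBound_sq (hT : 1 ≤ T) (ω : Ω) :
    r.stateBound α ρ T ω ^ 2 = stateConst α ρ ^ 2 * σ ^ 2 * n * r.noiseLevel T ω := by
  rw [stateBound, mul_pow, mul_pow, Real.sq_sqrt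
    (mul_nonneg (by positivity) (r.noiseLevel_nonneg hT ω))]
  ring

lemma integrable_stateBound_sq (hσ : 0 < σ) (hn : 1 ≤ n) (hT : 1 ≤ T) :
    Integrable (fun ω => r.stateBound α ρ T ω ^ 2) P := by
  have h := (r.integrable_noiseLevel hσ hn hT).1
  simp only [r.stateBound_sq hT]
  refine (h.mono' ?_ (ae_of_all _ fun ω => ?_)).const_mul _
  · exact ((r.measurable_noisePot T).log.const_mul _).aestronglyMeasurable
  · have := r.noiseLevel_nonneg hT ω
    rw [Real.norm_of_nonneg this]
    nlinarith

omit [IsProbabilityMeasure P] in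
lemma measurable_ric (t : ℕ) : Measurable (r.ric t) :=
  (measurable_ricS pb.posDef_Q pb.posDef_R).comp (r.measurable_θbar t)

omit [IsProbabilityMeasure P] in
lemma measurable_trace_ricS_θ : Measurable fun ω => (ricS pb.Q pb.R (r.θ ω)).trace :=
  measurable_matrix_trace ((measurable_ricS pb.posDef_Q pb.posDef_R).comp r.measurable_θ)

lemma integrable_qf_ric (hb : pb.Bounds Tmin α ρ s g) (hσ : 0 < σ) (hn : 1 ≤ n) (hT : 1 ≤ T)
    {t : ℕ} (ht : 1 ≤ t) {y : Ω → Fin n → ℝ} (hy : Measurable y) {c : ℝ}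
    (hyb : ∀ ω, r.InSupp ω → ‖WithLp.toLp 2 (y ω)‖ ≤ c * r.stateBound α ρ T ω) :
    Integrable (fun ω => qf (r.ric t ω) (y ω)) P := by
  refine ((r.integrable_stateBound_sq (α := α) (ρ := ρ) hσ hn hT).const_mul (s * c ^ 2)).mono'
    (measurable_qf (r.measurable_ric t) hy).aestronglyMeasurable ?_
  filter_upwards [r.ae_inSupp hσ] with ω hω
  rw [Real.norm_of_nonneg (qf_nonneg (r.posSemidef_ric t) _)]
  refine (hb.qf_ric_le (hω.2 t ht) (hyb ω hω)).trans (le_of_eq ?_)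
  ring

lemma integrable_trace_ric (hb : pb.Bounds Tmin α ρ s g) (hσ : 0 < σ) {t : ℕ} (ht : 1 ≤ t) :
    Integrable (fun ω => (r.ric t ω).trace) P := by
  refine (integrable_const ((n : ℝ) * s)).mono'
    (measurable_matrix_trace (r.measurable_ric t)).aestronglyMeasurable ?_
  filter_upwards [r.ae_inSupp hσ] with ω hω
  rw [Real.norm_of_nonneg (r.posSemidef_ric t).trace_nonneg]
  exact hb.trace_ric_le (hω.2 t ht)

lemma integrable_trace_ricS_θ (hb : pb.Bounds Tmin α ρ s g) (hσ : 0 < σ) :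
    Integrable (fun ω => (ricS pb.Q pb.R (r.θ ω)).trace) P := by
  refine (integrable_const ((n : ℝ) * s)).mono' r.measurable_trace_ricS_θ.aestronglyMeasurable ?_
  filter_upwards [r.ae_inSupp hσ] with ω hω
  rw [Real.norm_of_nonneg (posSemidef_ricS _).trace_nonneg]
  exact hb.trace_ric_le hω.1

/-- One step of noise adds `σ² tr S` to the expected quadratic form. -/
lemma integral_qf_ric_next (hb : pb.Bounds Tmin α ρ s g) (hσ : 0 < σ) {t : ℕ} (ht : 1 ≤ t)
    (hi : Integrable (fun ω => qf (r.ric t ω) (obs (r.θ ω) (r.z t ω))) P) :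
    ∫ ω, qf (r.ric t ω) (r.x (t + 1) ω) ∂P =
      ∫ ω, qf (r.ric t ω) (obs (r.θ ω) (r.z t ω)) ∂P + σ ^ 2 * ∫ ω, (r.ric t ω).trace ∂P := by
  have hSm : Measurable[r.postAlg t] (r.ric t) :=
    (measurable_ricS pb.posDef_Q pb.posDef_R).comp (r.measurable_θbar_post ht)
  have ho : Measurable fun p : Param n m × (Fin n ⊕ Fin m → ℝ) => obs p.1 p.2 :=
    measurable_obs measurable_fst measurable_snd
  have hym : Measurable[r.postAlg t] fun ω => obs (r.θ ω) (r.z t ω) :=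
    ho.comp (((r.measurable_θ_pre t).mono (r.preAlg_le_postAlg t) le_rfl).prodMk
      (r.measurable_z_post hσ ht))
  have hF : Measurable fun p : (Matrix (Fin n) (Fin n) ℝ × (Fin n → ℝ)) × (Fin n → ℝ) =>
      ENNReal.ofReal (qf p.1.1 (p.1.2 + p.2)) :=
    (measurable_qf (by fun_prop) (by fun_prop)).ennreal_ofReal
  have h := r.lintegral_noise_of_post ht (hSm.prodMk hym) hF
  have hx := r.measurable_x hσ (t := t + 1) (by omega)
  rw [← integral_const_mul, ← integral_add hi ((r.integrable_trace_ric hb hσ ht).const_mul _),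
    integral_eq_lintegral_of_nonneg_ae (ae_of_all _ fun ω => qf_nonneg (r.posSemidef_ric t) _)
      (measurable_qf (r.measurable_ric t) hx).aestronglyMeasurable,
    integral_eq_lintegral_of_nonneg_ae (ae_of_all _ fun ω =>
      add_nonneg (qf_nonneg (r.posSemidef_ric t) _)
        (mul_nonneg (sq_nonneg σ) (r.posSemidef_ric t).trace_nonneg))
      (hi.1.add ((r.integrable_trace_ric hb hσ ht).const_mul _).1)]
  congr 1
  simp only [r.x_succ' ht]
  rw [h]
  refine lintegral_congr fun ω => ?_
  simp only
  rw [lintegral_qf_add_noise (r.posSemidef_ric t), ENNReal.ofReal_add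
    (qf_nonneg (r.posSemidef_ric t) _)
    (mul_nonneg (sq_nonneg σ) (r.posSemidef_ric t).trace_nonneg)]

lemma measurable_numStarts (hσ : 0 < σ) (T : ℕ) :
    Measurable fun ω => numStarts Tmin (r.detSig ω) T := by
  classical
  refine Finset.measurable_sum _ fun t ht => ?_
  exact Measurable.ite (r.measurableSet_startSet hσ (Finset.mem_Icc.1 ht).1) measurable_const
    measurable_const

lemma numStarts_le_card (D : ℕ → ℝ) (T : ℕ) : numStarts Tmin D T ≤ T := by
  classical
  have := Finset.sum_le_card_nsmul (Finset.Icc 1 T)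
    (fun t => if StartsAt Tmin D t then (1 : ℝ) else 0) 1 fun t _ => by split_ifs <;> norm_num
  rw [Nat.card_Icc, Nat.add_sub_cancel, nsmul_eq_mul, mul_one] at this
  exact this

lemma integrable_trace_mul (hb : pb.Bounds Tmin α ρ s g) (hσ : 0 < σ) (c : ℝ) :
    Integrable (fun ω => (ricS pb.Q pb.R (r.θ ω)).trace *
      (c + numStarts Tmin (r.detSig ω) T)) P := by
  refine (r.integrable_trace_ricS_θ hb hσ).mul_bdd (c := |c| + T)
    (measurable_const.add (r.measurable_numStarts hσ T)).aestronglyMeasurable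
    (ae_of_all _ fun ω => ?_)
  refine (norm_add_le _ _).trans ?_
  rw [Real.norm_eq_abs, Real.norm_of_nonneg (numStarts_nonneg T)]
  gcongr
  exact numStarts_le_card _ T

/-- The cost of the episode starting at `t` if `ϑ` is the sampled parameter and the episode has
its maximal length. -/
noncomputable def episodeCost (pb : Problem n m)
    (p : ((ℤ × ℤ) × Param n m × Matrix (Fin n ⊕ Fin m) (Fin n ⊕ Fin m) ℝ) × Param n m) : ℝ≥0∞ :=
  ENNReal.ofReal (((p.1.1.2 : ℝ) + 1) * (ricS pb.Q pb.R p.2).trace)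

lemma measurable_episodeCost (pb : Problem n m) : Measurable (episodeCost pb) := by
  have h1 : Measurable fun k : ℤ => (k : ℝ) := measurable_from_top
  have h2 : Measurable fun p : ((ℤ × ℤ) × Param n m ×
    Matrix (Fin n ⊕ Fin m) (Fin n ⊕ Fin m) ℝ) × Param n m => (p.1.1.2 : ℝ) :=
    h1.comp (by fun_prop)
  exact ((h2.add_const 1).mul (measurable_matrix_trace
    ((measurable_ricS pb.posDef_Q pb.posDef_R).comp measurable_snd))).ennreal_ofReal

omit [IsProbabilityMeasure P] in
lemma clk_snd_add_one_nonneg {t : ℕ} (ht : 1 ≤ t) (ω : Ω) : (0 : ℝ) ≤ ((r.clk t ω).2 : ℝ) + 1 := by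
  have := (clock_bounds (Tmin := Tmin) (r.detSig ω) t ht).2.2
  have h2 : (0 : ℤ) ≤ (r.clk t ω).2 + 1 := by rw [clk]; omega
  exact_mod_cast h2

-- Charging each episode its maximal length gives weights known at its start. The actual length
-- depends on the sample through later states, and could not be used when θ is exchanged for the
-- sample.
omit [IsProbabilityMeasure P] in
lemma ofReal_sum_trace_le (hT : 1 ≤ T) (ω : Ω) :
    ENNReal.ofReal (∑ t ∈ Finset.Icc 1 T, (r.ric t ω).trace) ≤
      ∑ t ∈ Finset.Icc 1 T, (r.startSet t).indicator (fun ω =>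
        episodeCost pb ((r.clk t ω, r.θhat t ω, r.Sig t ω), r.θbar t ω)) ω := by
  classical
  have htr : ∀ t, 0 ≤ (r.ric t ω).trace := fun t => (r.posSemidef_ric t).trace_nonneg
  have h := sum_le_sum_starts (Tmin := Tmin) (D := r.detSig ω)
    (F := fun t => (r.ric t ω).trace) (fun t _ => htr t)
    (fun t _ h => by simp only [ric, r.θbar_succ_of_not_start h]) hT
  refine (ENNReal.ofReal_le_ofReal h).trans (le_of_eq ?_)
  rw [ENNReal.ofReal_sum_of_nonneg]
  · refine Finset.sum_congr rfl fun s _ => ?_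
    by_cases hs : StartsAt Tmin (r.detSig ω) s
    · rw [if_pos hs, Set.indicator_of_mem (by exact hs)]; rfl
    · rw [if_neg hs, Set.indicator_of_notMem (by exact hs), ENNReal.ofReal_zero]
  · intro s hs
    split_ifs
    · exact mul_nonneg (r.clk_snd_add_one_nonneg (Finset.mem_Icc.1 hs).1 ω) (htr s)
    · exact le_rfl

-- With the same θ in every episode only the weights T_{k-1} + 1 remain to be added; they sum to t_k
-- + T_min + K, and the last start is at most T.
omit [IsProbabilityMeasure P] in
lemma sum_episodeCost_le (hT : 1 ≤ T) (ω : Ω) :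
    ∑ t ∈ Finset.Icc 1 T, (r.startSet t).indicator (fun ω =>
        episodeCost pb ((r.clk t ω, r.θhat t ω, r.Sig t ω), r.θ ω)) ω ≤
      ENNReal.ofReal ((ricS pb.Q pb.R (r.θ ω)).trace *
        ((T + Tmin) + numStarts Tmin (r.detSig ω) T)) := by
  classical
  have htθ : 0 ≤ (ricS pb.Q pb.R (r.θ ω)).trace := (posSemidef_ricS _).trace_nonneg
  have e : ∀ s ∈ Finset.Icc 1 T, (r.startSet s).indicator (fun ω =>
        episodeCost pb ((r.clk s ω, r.θhat s ω, r.Sig s ω), r.θ ω)) ω =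
      ENNReal.ofReal (((if StartsAt Tmin (r.detSig ω) s then
        ((clock Tmin (r.detSig ω) s).2 : ℝ) else 0) +
        if StartsAt Tmin (r.detSig ω) s then 1 else 0) *
          (ricS pb.Q pb.R (r.θ ω)).trace) := fun s _ => by
    by_cases hs : StartsAt Tmin (r.detSig ω) s
    · rw [if_pos hs, if_pos hs, Set.indicator_of_mem (by exact hs)]; rfl
    · rw [if_neg hs, if_neg hs, Set.indicator_of_notMem (by exact hs)]; simp
  rw [Finset.sum_congr rfl e, ← ENNReal.ofReal_sum_of_nonneg, ← Finset.sum_mul,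
    Finset.sum_add_distrib, sum_prevLength hT, mul_comm]
  · refine ENNReal.ofReal_le_ofReal (mul_le_mul_of_nonneg_left ?_ htθ)
    have h1 := (clock_bounds (Tmin := Tmin) (r.detSig ω) T hT).2.1
    have h2 : ((clock Tmin (r.detSig ω) T).1 : ℝ) ≤ T := by exact_mod_cast h1
    rw [numStarts]
    linarith
  · intro s hs
    refine mul_nonneg ?_ htθ
    have := r.clk_snd_add_one_nonneg (Finset.mem_Icc.1 hs).1 ω
    split_ifs
    · exact this
    · simp

/-- Between the two pathwise estimates, each sampled parameter is replaced by θ on the event that an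
episode starts; weight and event are functions of the history there. -/
lemma lintegral_sum_trace_le (hσ : 0 < σ) (hT : 1 ≤ T) :
    ∫⁻ ω, ENNReal.ofReal (∑ t ∈ Finset.Icc 1 T, (r.ric t ω).trace) ∂P ≤
      ∫⁻ ω, ENNReal.ofReal ((ricS pb.Q pb.R (r.θ ω)).trace *
        ((T + Tmin) + numStarts Tmin (r.detSig ω) T)) ∂P := by
  have hset : ∀ s ∈ Finset.Icc 1 T, MeasurableSet (r.startSet s) := fun s hs =>
    r.measurableSet_startSet hσ (Finset.mem_Icc.1 hs).1
  have hm : ∀ s ∈ Finset.Icc 1 T, ∀ ϑ : Ω → Param n m, Measurable ϑ → Measurable fun ω =>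
      episodeCost pb ((r.clk s ω, r.θhat s ω, r.Sig s ω), ϑ ω) := fun s hs ϑ hϑ => by
    have h1 := (Finset.mem_Icc.1 hs).1
    exact (measurable_episodeCost pb).comp (((r.measurable_clk hσ h1).prodMk
      ((r.measurable_θhat hσ h1).prodMk (r.measurable_Sig hσ h1))).prodMk hϑ)
  refine (lintegral_mono (r.ofReal_sum_trace_le hT)).trans
    (le_trans (le_of_eq ?_) (lintegral_mono (r.sum_episodeCost_le hT)))
  rw [lintegral_finsetSum' _ fun s hs =>
      ((hm s hs _ (r.measurable_θbar s)).indicator (hset s hs)).aemeasurable,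
    lintegral_finsetSum' _ fun s hs =>
      ((hm s hs _ r.measurable_θ).indicator (hset s hs)).aemeasurable]
  refine Finset.sum_congr rfl fun s hs => ?_
  rw [lintegral_indicator (hset s hs), lintegral_indicator (hset s hs)]
  exact r.lintegral_start_θbar hσ (Finset.mem_Icc.1 hs).1 (measurable_episodeCost pb)

/-- Posterior sampling lets the true parameter replace the sampled ones in the sum of the
stationary costs, up to the number of episodes. -/
lemma sum_integral_trace_le (hb : pb.Bounds Tmin α ρ s g) (hσ : 0 < σ) (hT : 1 ≤ T) :
    ∑ t ∈ Finset.Icc 1 T, ∫ ω, (r.ric t ω).trace ∂P ≤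
      ∫ ω, (ricS pb.Q pb.R (r.θ ω)).trace *
        ((T + Tmin) + numStarts Tmin (r.detSig ω) T) ∂P := by
  have h1 : ∀ ω, 0 ≤ ∑ t ∈ Finset.Icc 1 T, (r.ric t ω).trace := fun ω =>
    Finset.sum_nonneg fun t _ => (r.posSemidef_ric t).trace_nonneg
  have h2 : ∀ ω, 0 ≤ (ricS pb.Q pb.R (r.θ ω)).trace *
      ((T + Tmin) + numStarts Tmin (r.detSig ω) T) := fun ω =>
    mul_nonneg (posSemidef_ricS _).trace_nonneg (by
      have := numStarts_nonneg (Tmin := Tmin) (D := r.detSig ω) T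
      positivity)
  have hi := r.integrable_trace_mul (T := T) hb hσ (T + Tmin)
  rw [← integral_finsetSum _ fun t ht => r.integrable_trace_ric hb hσ (Finset.mem_Icc.1 ht).1,
    integral_eq_lintegral_of_nonneg_ae (ae_of_all _ h1)
      (Finset.measurable_sum _ fun t _ =>
        measurable_matrix_trace (r.measurable_ric t)).aestronglyMeasurable,
    integral_eq_lintegral_of_nonneg_ae (ae_of_all _ h2) hi.1]
  refine ENNReal.toReal_mono ?_ (r.lintegral_sum_trace_le hσ hT)
  exact ((hasFiniteIntegral_iff_ofReal (ae_of_all _ h2)).1 hi.2).ne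

end Run

end Expectation

/-! ### The regret bound. -/

section RegretBound

variable {n m : ℕ} {pb : Problem n m} {σ : ℝ} {Tmin : ℕ} {Ω : Type*} [mΩ : MeasurableSpace Ω]
  {P : Measure Ω} [IsProbabilityMeasure P] (r : Run pb σ Tmin P) {α ρ s g : ℝ}

namespace Run

variable {T : ℕ}

lemma integrable_qf_x (hb : pb.Bounds Tmin α ρ s g) (hσ : 0 < σ) (hn : 1 ≤ n) (hT : 1 ≤ T)
    {t k : ℕ} (ht : 1 ≤ t) (hk : 1 ≤ k) (hkT : k ≤ T + 1) :
    Integrable (fun ω => qf (r.ric t ω) (r.x k ω)) P :=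
  r.integrable_qf_ric hb hσ hn hT ht (r.measurable_x hσ hk) (c := 1) fun ω hω => by
    rw [one_mul]; exact r.norm_x_le_stateBound hb hσ hn hω hk hkT

lemma integrable_qf_obs (hb : pb.Bounds Tmin α ρ s g) (hσ : 0 < σ) (hn : 1 ≤ n) (hT : 1 ≤ T)
    {t : ℕ} (ht : 1 ≤ t) (htT : t ≤ T) {ϑ : Ω → Param n m} (hϑ : Measurable ϑ)
    (hs : ∀ ω, r.InSupp ω → ϑ ω ∈ pb.supp) :
    Integrable (fun ω => qf (r.ric t ω) (obs (ϑ ω) (r.z t ω))) P :=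
  r.integrable_qf_ric hb hσ hn hT ht (measurable_obs hϑ (r.measurable_z hσ ht)) (c := α)
    fun ω hω => r.norm_obs_le hb hω ht (r.norm_x_le_stateBound hb hσ hn hω ht (by omega)) (hs ω hω)

lemma excess_ae_eq (hb : pb.Bounds Tmin α ρ s g) (hσ : 0 < σ) :
    r.excess T =ᵐ[P] fun ω => ∑ t ∈ Finset.Icc 1 T, (qf (r.ric t ω) (r.x t ω) -
      qf (r.ric t ω) (obs (r.θbar t ω) (r.z t ω))) -
        T * σ ^ 2 * (ricS pb.Q pb.R (r.θ ω)).trace := by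
  filter_upwards [r.ae_inSupp hσ] with ω hω
  rw [excess, hb.optCost_eq σ _ hω.1, ← mul_assoc]
  congr 1
  exact Finset.sum_congr rfl fun t ht => r.cost_eq hb hω (Finset.mem_Icc.1 ht).1

lemma integrable_sum_cost (hb : pb.Bounds Tmin α ρ s g) (hσ : 0 < σ) (hn : 1 ≤ n) (hT : 1 ≤ T) :
    Integrable (fun ω => ∑ t ∈ Finset.Icc 1 T, (qf (r.ric t ω) (r.x t ω) -
      qf (r.ric t ω) (obs (r.θbar t ω) (r.z t ω)))) P := by
  refine integrable_finsetSum _ fun t ht => ?_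
  rw [Finset.mem_Icc] at ht
  exact (r.integrable_qf_x hb hσ hn hT ht.1 ht.1 (by omega)).sub
    (r.integrable_qf_obs hb hσ hn hT ht.1 ht.2 (r.measurable_θbar t) fun ω hω => hω.2 t ht.1)

lemma integrable_excess (hb : pb.Bounds Tmin α ρ s g) (hσ : 0 < σ) (hn : 1 ≤ n) (hT : 1 ≤ T) :
    Integrable (r.excess T) P :=
  ((r.integrable_sum_cost hb hσ hn hT).sub
    ((r.integrable_trace_ricS_θ hb hσ).const_mul _)).congr (r.excess_ae_eq hb hσ).symm

/-- The decomposition of the regret in expectation. Of the weight T + T_min + K in the sampling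
term, the part T cancels against T J(θ), so T_min + K remains next to drift and prediction error. -/
lemma regret_le (hb : pb.Bounds Tmin α ρ s g) (hσ : 0 < σ) (hn : 1 ≤ n) (hT : 1 ≤ T)
    {H : Ω → ℝ} (hH : Integrable H P)
    (hle : ∀ᵐ ω ∂P,
      ∑ t ∈ Finset.Icc 1 T, (qf (r.ric t ω) (r.x t ω) - qf (r.ric t ω) (r.x (t + 1) ω)) +
      ∑ t ∈ Finset.Icc 1 T, (qf (r.ric t ω) (obs (r.θ ω) (r.z t ω)) -
        qf (r.ric t ω) (obs (r.θbar t ω) (r.z t ω))) +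
      σ ^ 2 * ((ricS pb.Q pb.R (r.θ ω)).trace * (Tmin + numStarts Tmin (r.detSig ω) T)) ≤ H ω) :
    r.regret T ≤ ∫ ω, H ω ∂P := by
  have i1 : ∀ t ∈ Finset.Icc 1 T, Integrable (fun ω => qf (r.ric t ω) (r.x t ω)) P :=
    fun t ht => by
      rw [Finset.mem_Icc] at ht
      exact r.integrable_qf_x hb hσ hn hT ht.1 ht.1 (by omega)
  have i2 : ∀ t ∈ Finset.Icc 1 T, Integrable (fun ω => qf (r.ric t ω) (r.x (t + 1) ω)) P :=
    fun t ht => by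
      rw [Finset.mem_Icc] at ht
      exact r.integrable_qf_x hb hσ hn hT ht.1 (by omega) (by omega)
  have i3 : ∀ t ∈ Finset.Icc 1 T,
      Integrable (fun ω => qf (r.ric t ω) (obs (r.θ ω) (r.z t ω))) P := fun t ht => by
    rw [Finset.mem_Icc] at ht
    exact r.integrable_qf_obs hb hσ hn hT ht.1 ht.2 r.measurable_θ fun ω hω => hω.1
  have i4 : ∀ t ∈ Finset.Icc 1 T,
      Integrable (fun ω => qf (r.ric t ω) (obs (r.θbar t ω) (r.z t ω))) P := fun t ht => by
    rw [Finset.mem_Icc] at ht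
    exact r.integrable_qf_obs hb hσ hn hT ht.1 ht.2 (r.measurable_θbar t)
      fun ω hω => hω.2 t ht.1
  have iθ := r.integrable_trace_ricS_θ hb hσ
  have iK := r.integrable_trace_mul (T := T) hb hσ Tmin
  have i14 : ∀ t ∈ Finset.Icc 1 T, Integrable (fun ω => qf (r.ric t ω) (r.x t ω) -
      qf (r.ric t ω) (obs (r.θbar t ω) (r.z t ω))) P :=
    fun t ht => (i1 t ht).sub (i4 t ht)
  have i12 : ∀ t ∈ Finset.Icc 1 T, Integrable (fun ω => qf (r.ric t ω) (r.x t ω) -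
      qf (r.ric t ω) (r.x (t + 1) ω)) P :=
    fun t ht => (i1 t ht).sub (i2 t ht)
  have i34 : ∀ t ∈ Finset.Icc 1 T, Integrable (fun ω => qf (r.ric t ω) (obs (r.θ ω) (r.z t ω)) -
      qf (r.ric t ω) (obs (r.θbar t ω) (r.z t ω))) P :=
    fun t ht => (i3 t ht).sub (i4 t ht)
  have s12 : Integrable (fun ω => ∑ t ∈ Finset.Icc 1 T, (qf (r.ric t ω) (r.x t ω) -
      qf (r.ric t ω) (r.x (t + 1) ω))) P :=
    integrable_finsetSum _ i12
  have s34 : Integrable (fun ω => ∑ t ∈ Finset.Icc 1 T, (qf (r.ric t ω) (obs (r.θ ω) (r.z t ω)) -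
      qf (r.ric t ω) (obs (r.θbar t ω) (r.z t ω)))) P :=
    integrable_finsetSum _ i34
  have s1234 : Integrable (fun ω => ∑ t ∈ Finset.Icc 1 T, (qf (r.ric t ω) (r.x t ω) -
      qf (r.ric t ω) (r.x (t + 1) ω)) +
      ∑ t ∈ Finset.Icc 1 T, (qf (r.ric t ω) (obs (r.θ ω) (r.z t ω)) -
      qf (r.ric t ω) (obs (r.θbar t ω) (r.z t ω)))) P := s12.add s34
  have hreg : r.regret T = ∑ t ∈ Finset.Icc 1 T, (∫ ω, qf (r.ric t ω) (r.x t ω) ∂P -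
      ∫ ω, qf (r.ric t ω) (obs (r.θbar t ω) (r.z t ω)) ∂P) -
        T * σ ^ 2 * ∫ ω, (ricS pb.Q pb.R (r.θ ω)).trace ∂P := by
    rw [regret, integral_congr_ae (r.excess_ae_eq hb hσ),
      integral_sub (r.integrable_sum_cost hb hσ hn hT) (iθ.const_mul _), integral_const_mul,
      integral_finsetSum _ i14]
    congr 1
    exact Finset.sum_congr rfl fun t ht => integral_sub (i1 t ht) (i4 t ht)
  have hbr := integral_mono_ae (s1234.add (iK.const_mul (σ ^ 2))) hH hle
  have e1 : ∫ ω, (∑ t ∈ Finset.Icc 1 T,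
        (qf (r.ric t ω) (r.x t ω) - qf (r.ric t ω) (r.x (t + 1) ω)) +
      ∑ t ∈ Finset.Icc 1 T, (qf (r.ric t ω) (obs (r.θ ω) (r.z t ω)) -
        qf (r.ric t ω) (obs (r.θbar t ω) (r.z t ω))) +
      σ ^ 2 * ((ricS pb.Q pb.R (r.θ ω)).trace * (Tmin + numStarts Tmin (r.detSig ω) T))) ∂P =
      ∑ t ∈ Finset.Icc 1 T, (∫ ω, qf (r.ric t ω) (r.x t ω) ∂P -
        ∫ ω, qf (r.ric t ω) (r.x (t + 1) ω) ∂P) +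
      ∑ t ∈ Finset.Icc 1 T, (∫ ω, qf (r.ric t ω) (obs (r.θ ω) (r.z t ω)) ∂P -
        ∫ ω, qf (r.ric t ω) (obs (r.θbar t ω) (r.z t ω)) ∂P) +
      σ ^ 2 * ∫ ω, (ricS pb.Q pb.R (r.θ ω)).trace *
        (Tmin + numStarts Tmin (r.detSig ω) T) ∂P := by
    rw [integral_add s1234 (iK.const_mul _), integral_add s12 s34, integral_const_mul,
      integral_finsetSum _ i12, integral_finsetSum _ i34]
    congr 2
    · exact Finset.sum_congr rfl fun t ht => integral_sub (i1 t ht) (i2 t ht)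
    · exact Finset.sum_congr rfl fun t ht => integral_sub (i3 t ht) (i4 t ht)
  have hnext : ∑ t ∈ Finset.Icc 1 T, ∫ ω, qf (r.ric t ω) (r.x (t + 1) ω) ∂P =
      ∑ t ∈ Finset.Icc 1 T, ∫ ω, qf (r.ric t ω) (obs (r.θ ω) (r.z t ω)) ∂P +
        σ ^ 2 * ∑ t ∈ Finset.Icc 1 T, ∫ ω, (r.ric t ω).trace ∂P := by
    rw [Finset.mul_sum, ← Finset.sum_add_distrib]
    exact Finset.sum_congr rfl fun t ht =>
      r.integral_qf_ric_next hb hσ (Finset.mem_Icc.1 ht).1 (i3 t ht)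
  have htr := r.sum_integral_trace_le hb hσ hT
  have e2 : ∫ ω, (ricS pb.Q pb.R (r.θ ω)).trace *
        ((T + Tmin) + numStarts Tmin (r.detSig ω) T) ∂P =
      T * ∫ ω, (ricS pb.Q pb.R (r.θ ω)).trace ∂P +
        ∫ ω, (ricS pb.Q pb.R (r.θ ω)).trace * (Tmin + numStarts Tmin (r.detSig ω) T) ∂P := by
    rw [← integral_const_mul, ← integral_add (iθ.const_mul _) iK]
    refine integral_congr_ae (ae_of_all _ fun ω => ?_)
    simp only
    ring
  rw [e2] at htr
  have htr' := mul_le_mul_of_nonneg_left htr (sq_nonneg σ)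
  refine le_trans ?_ (e1.symm.le.trans hbr)
  rw [hreg, Finset.sum_sub_distrib, Finset.sum_sub_distrib, Finset.sum_sub_distrib]
  linarith

/-- The regret bound when the horizon exceeds the dimension of the state. -/
lemma regret_le_of_le (hb : pb.Bounds Tmin α ρ s g) (hσ : 0 < σ) (hn : 1 ≤ n) (hnT : n ≤ T) :
    r.regret T ≤ (400 * mainConst Tmin α ρ s g ‖pb.cov‖ + 32 * s * α * stateConst α ρ *
      (5 + ((gaussParam pb.mean pb.cov).real pb.supp)⁻¹)) *
        (σ ^ 2 * ((n : ℝ) + m) * √(n * T)) * (1 + Real.log T) ^ 3 := by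
  have hT : 1 ≤ T := hn.trans hnT
  have hT' : (1 : ℝ) ≤ T := by exact_mod_cast hT
  obtain ⟨N, hN0, hNc, hN1, hN⟩ := exists_norming_set n (by omega)
  obtain ⟨iξ, bξ⟩ := r.integrable_noiseLevel hσ hn hT
  obtain ⟨iZ, bZ⟩ := r.integrable_log_devPot hσ hn hN0 hNc hN1 hT
  have hs := hb.ric_nonneg
  have hα := hb.one_le
  have hC := hb.stateConst_nonneg
  have hL : 1 ≤ 1 + Real.log T := by linarith [Real.log_nonneg hT']
  have hA : 0 ≤ mainConst Tmin α ρ s g ‖pb.cov‖ := by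
    unfold mainConst infoConst; positivity
  -- The pathwise bound is linear in (1 + ξ)² and in the largest deviation. The second moment of the
  -- noise level brings two logarithmic factors, which together with the log determinant give the
  -- exponent 3.
  have j1 := (iξ.const_mul (mainConst Tmin α ρ s g ‖pb.cov‖ *
    (σ ^ 2 * ((n + m : ℝ) * √(n * T) * (1 + Real.log T)))))
  have j2 := iZ.const_mul (8 * s * α * stateConst α ρ * (σ ^ 2 * √(n * T)) * 4)
  have hreg := r.regret_le hb hσ hn hT (j1.add j2) (by
    filter_upwards [r.ae_inSupp hσ] with ω hω
    refine (r.pathwise_gap_le hb hσ hω hn hnT (r.noiseLevel_nonneg hT ω)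
      (fun t h1 h2 => r.norm_w_le hσ hn h1 h2 ω) hN
      (by have := Real.log_nonneg (r.one_le_devPot hN0 hT ω); positivity :
        0 ≤ 4 * Real.log (r.devPot N T ω))
      (fun t h1 h2 v hv => r.dev_θ_le hN0 h1 h2 hv ω)
      (fun t h1 h2 hst v hv => r.dev_θbar_le hN0 h1 h2 hv hst)).trans (le_of_eq ?_)
    simp only [Pi.add_apply]
    ring)
  simp only [Pi.add_apply] at hreg
  rw [integral_add j1 j2, integral_const_mul, integral_const_mul] at hreg
  refine hreg.trans ?_
  set M := ((gaussParam pb.mean pb.cov).real pb.supp)⁻¹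
  have hM : 0 ≤ M := inv_nonneg.2 measureReal_nonneg
  set L := 1 + Real.log T
  set A := mainConst Tmin α ρ s g ‖pb.cov‖
  calc _ ≤ A * (σ ^ 2 * ((n + m : ℝ) * √(n * T) * L)) * (400 * L ^ 2) +
        8 * s * α * stateConst α ρ * (σ ^ 2 * √(n * T)) * 4 * ((5 + M) * ((n + m) * L)) := by
        gcongr
    _ = 400 * A * (σ ^ 2 * ((n : ℝ) + m) * √(n * T)) * L ^ 3 +
        32 * s * α * stateConst α ρ * (5 + M) * (σ ^ 2 * ((n : ℝ) + m) * √(n * T)) * L := by ring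
    _ ≤ 400 * A * (σ ^ 2 * ((n : ℝ) + m) * √(n * T)) * L ^ 3 +
        32 * s * α * stateConst α ρ * (5 + M) * (σ ^ 2 * ((n : ℝ) + m) * √(n * T)) * L ^ 3 := by
        gcongr
        exact le_self_pow₀ hL (by norm_num)
    _ = _ := by ring

/-- The regret bound for short horizons. -/
lemma regret_le_of_ge (hb : pb.Bounds Tmin α ρ s g) (hσ : 0 < σ) (hn : 1 ≤ n) (hT : 1 ≤ T)
    (hnT : T ≤ n) :
    r.regret T ≤ 400 * s * stateConst α ρ ^ 2 *
        (σ ^ 2 * ((n : ℝ) + m) * √(n * T)) * (1 + Real.log T) ^ 3 := by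
  have hT' : (1 : ℝ) ≤ T := by exact_mod_cast hT
  have hnT' : (T : ℝ) ≤ n := by exact_mod_cast hnT
  have hs := hb.ric_nonneg
  have hC := hb.stateConst_nonneg
  have hL : 1 ≤ 1 + Real.log T := by linarith [Real.log_nonneg hT']
  obtain ⟨iξ, bξ⟩ := r.integrable_noiseLevel hσ hn hT
  have j1 := iξ.const_mul (T * (s * (stateConst α ρ ^ 2 * σ ^ 2 * n)))
  have hle : r.regret T ≤ ∫ ω, T * (s * (stateConst α ρ ^ 2 * σ ^ 2 * n)) *
      (1 + r.noiseLevel T ω) ^ 2 ∂P := by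
    refine integral_mono_ae (r.integrable_excess hb hσ hn hT) j1 ?_
    filter_upwards [r.ae_inSupp hσ, r.excess_ae_eq (T := T) hb hσ] with ω hω he
    rw [he]
    have h1 : 0 ≤ T * σ ^ 2 * (ricS pb.Q pb.R (r.θ ω)).trace :=
      mul_nonneg (by positivity) (posSemidef_ricS _).trace_nonneg
    have h2 : ∑ t ∈ Finset.Icc 1 T, (qf (r.ric t ω) (r.x t ω) -
        qf (r.ric t ω) (obs (r.θbar t ω) (r.z t ω))) ≤
        T * (s * (stateConst α ρ ^ 2 * σ ^ 2 * n * r.noiseLevel T ω)) := by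
      have := Finset.sum_le_card_nsmul (Finset.Icc 1 T)
        (fun t => qf (r.ric t ω) (r.x t ω) - qf (r.ric t ω) (obs (r.θbar t ω) (r.z t ω)))
        (s * (stateConst α ρ ^ 2 * σ ^ 2 * n * r.noiseLevel T ω)) fun t ht => by
          rw [Finset.mem_Icc] at ht
          have h3 := hb.qf_ric_le (hω.2 t ht.1)
            (r.norm_x_le_stateBound (T := T) hb hσ hn hω ht.1 (by omega))
          rw [r.stateBound_sq hT] at h3
          have h4 := qf_nonneg (r.posSemidef_ric (ω := ω) t) (obs (r.θbar t ω) (r.z t ω))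
          change qf (r.ric t ω) _ ≤ _ at h3
          linarith
      rwa [Nat.card_Icc, Nat.add_sub_cancel, nsmul_eq_mul] at this
    have h5 : r.noiseLevel T ω ≤ (1 + r.noiseLevel T ω) ^ 2 := by
      nlinarith [r.noiseLevel_nonneg hT ω]
    calc _ ≤ T * (s * (stateConst α ρ ^ 2 * σ ^ 2 * n * r.noiseLevel T ω)) := by linarith
      _ ≤ T * (s * (stateConst α ρ ^ 2 * σ ^ 2 * n * (1 + r.noiseLevel T ω) ^ 2)) := by gcongr
      _ = _ := by ring
  refine hle.trans ?_
  rw [integral_const_mul]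
  -- For T ≤ n the crude bound T · n for the total cost is already of the claimed order, since √(nT)
  -- ≤ n.
  have hnn : (n : ℝ) * T ≤ (n + m) * √(n * T) := by
    have h1 : √((n : ℝ) * T) ≤ n := by
      rw [Real.sqrt_le_left (by positivity)]
      nlinarith
    have hm : (0 : ℝ) ≤ m := by positivity
    calc (n : ℝ) * T = √(n * T) * √(n * T) := (Real.mul_self_sqrt (by positivity)).symm
      _ ≤ n * √(n * T) := by gcongr
      _ ≤ _ := by gcongr; linarith
  calc _ ≤ T * (s * (stateConst α ρ ^ 2 * σ ^ 2 * n)) * (400 * (1 + Real.log T) ^ 2) := by gcongr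
    _ = 400 * s * stateConst α ρ ^ 2 * σ ^ 2 * (n * T) * (1 + Real.log T) ^ 2 := by ring
    _ ≤ 400 * s * stateConst α ρ ^ 2 * σ ^ 2 * ((n + m) * √(n * T)) * (1 + Real.log T) ^ 3 := by
      gcongr
      norm_num
    _ = _ := by ring

omit [IsProbabilityMeasure P] in
/-- Without state components there is no cost. -/
lemma excess_ae_eq_zero (hb : pb.Bounds Tmin α ρ s g) (hn : n = 0) :
    r.excess T =ᵐ[P] 0 := by
  subst hn
  filter_upwards [r.ae_θ_mem] with ω hω
  have h1 : ∀ t ∈ Finset.Icc 1 T, cost pb.Q pb.R (r.x t ω) (r.u t ω) = 0 := fun t ht => by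
    have hu : r.u t ω = 0 := by
      rw [r.u_eq t (Finset.mem_Icc.1 ht).1]
      ext i
      simp [mulVec, dotProduct]
    rw [cost, hu, mulVec_zero, dotProduct_zero, add_zero, dotProduct, Finset.univ_eq_empty,
      Finset.sum_empty]
  rw [excess, Finset.sum_congr rfl h1, hb.optCost_eq σ _ hω]
  simp [Matrix.trace]

end Run

/-- The constant in the regret bound. -/
noncomputable def regretConst (sc : Scalars) : ℝ :=
  400 * mainConst sc.Tmin sc.α sc.r sc.ricBound sc.gainBound sc.covNorm +
    32 * sc.ricBound * sc.α * stateConst sc.α sc.r * (5 + sc.mass⁻¹) +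
    400 * sc.ricBound * stateConst sc.α sc.r ^ 2

lemma Problem.bounds (pb : Problem n m) {δ ε : ℝ} (hδ : 0 < δ) (hδ1 : δ < 1)
    (h : pb.SpectralRadiusLE δ) (hε : 0 < ε) (hε1 : ε < 1 - δ) (hα : 1 ≤ α)
    (hpb : pb.PowerBound (ε + δ) α) (hmin : tMinStar (ε + δ) α ≤ Tmin) :
    pb.Bounds Tmin α (ε + δ) (sSup ((fun φ => ‖ricS pb.Q pb.R φ‖) '' pb.supp))
      (sSup ((fun φ => ‖gain pb.Q pb.R φ‖) '' pb.supp)) where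
  one_le := hα
  pos := by linarith
  lt_one := by linarith
  powerBound := hpb
  contract := mul_pow_le_one_of_tMinStar_le hα (by linarith) (by linarith) hmin
  ric_nonneg := Real.sSup_nonneg (by rintro _ ⟨φ, -, rfl⟩; exact norm_nonneg _)
  ric_le φ hφ := le_csSup (Problem.bddAbove_norm_ricS hδ hδ1 h) ⟨φ, hφ, rfl⟩
  gain_nonneg := Real.sSup_nonneg (by rintro _ ⟨φ, -, rfl⟩; exact norm_nonneg _)
  gain_le φ hφ := le_csSup (Problem.bddAbove_norm_gain hδ hδ1 h) ⟨φ, hφ, rfl⟩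
  bellman φ hφ x := Problem.qf_ricS_eq hδ hδ1 h hφ x
  optCost_eq σ φ hφ := optCost_eq pb.posDef_Q pb.posDef_R (Problem.exists_isRiccati hδ hδ1 h hφ)

end RegretBound

end LQ

/-! ### The theorem. -/

theorem theorem1 :
    -- the constant `α`, hence the minimum episode length `T*_min`, exists
    (∀ (n m : ℕ) (pb : LQ.Problem n m) (δ ε : ℝ), 0 < δ → δ < 1 → pb.SpectralRadiusLE δ →
      0 < ε → ε < 1 - δ → ∃ α : ℝ, 1 ≤ α ∧ pb.PowerBound (ε + δ) α) ∧
    -- the regret bound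
    ∃ (C : LQ.Scalars → ℝ) (p : LQ.Scalars → ℕ),
      ∀ (n m : ℕ) (pb : LQ.Problem n m) (δ ε α : ℝ), 0 < δ → δ < 1 → pb.SpectralRadiusLE δ →
        0 < ε → ε < 1 - δ → 1 ≤ α → pb.PowerBound (ε + δ) α →
      ∀ Tmin : ℕ, LQ.tMinStar (ε + δ) α ≤ Tmin →
      ∀ σ : ℝ, 0 < σ →
      ∀ {Ω : Type*} [MeasurableSpace Ω] (P : Measure Ω) [IsProbabilityMeasure P]
        (run : LQ.Run pb σ Tmin P) (T : ℕ), 1 ≤ T →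
        Integrable (run.excess T) P ∧
        run.regret T ≤ C (pb.scalars (ε + δ) α Tmin) *
          (σ ^ 2 * ((n : ℝ) + m) * √((n : ℝ) * T)) *
          (1 + Real.log T) ^ p (pb.scalars (ε + δ) α Tmin) := by
  refine ⟨fun n m pb δ ε hδ hδ1 h hε _ => LQ.Problem.exists_powerBound hδ hδ1 h hε,
    LQ.regretConst, fun _ => 3, ?_⟩
  intro n m pb δ ε α hδ hδ1 h hε hε1 hα hpb Tmin hmin σ hσ Ω _ P _ run T hT
  have hb := pb.bounds hδ hδ1 h hε hε1 hα hpb hmin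
  -- Dimension 0 is separate because the norming set requires n > 0 and the noise level divides by
  -- n; there the excess vanishes.
  rcases Nat.eq_zero_or_pos n with hn | hn
  · have h0 := run.excess_ae_eq_zero (T := T) hb hn
    refine ⟨(integrable_zero _ _ _).congr h0.symm, ?_⟩
    have hn' : (n : ℝ) = 0 := by exact_mod_cast hn
    rw [LQ.Run.regret, integral_congr_ae h0, hn']
    simp
  · refine ⟨run.integrable_excess hb hσ hn hT, ?_⟩
    have hs := hb.ric_nonneg
    have hg := hb.gain_nonneg
    have hC := hb.stateConst_nonneg
    have hL : 0 ≤ Real.log T := Real.log_nonneg (by exact_mod_cast hT)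
    have hM : 0 ≤ ((LQ.gaussParam pb.mean pb.cov).real pb.supp)⁻¹ :=
      inv_nonneg.2 measureReal_nonneg
    have hα0 : 0 ≤ α := by linarith
    have hA : 0 ≤ LQ.mainConst Tmin α (ε + δ)
        (sSup ((fun φ => ‖LQ.ricS pb.Q pb.R φ‖) '' pb.supp))
        (sSup ((fun φ => ‖LQ.gain pb.Q pb.R φ‖) '' pb.supp)) ‖pb.cov‖ := by
      unfold LQ.mainConst LQ.infoConst; positivity
    -- `regretConst` is the sum of the constants for long and for short horizons; both are
    -- nonnegative, so it dominates each of them.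
    rcases le_total n T with hnT | hnT
    · refine (run.regret_le_of_le hb hσ hn hnT).trans ?_
      simp only [LQ.regretConst, LQ.Problem.scalars]
      simp only [mul_assoc _ _ (_ ^ 3)]
      exact mul_le_mul_of_nonneg_right (le_add_of_nonneg_right (by positivity)) (by positivity)
    · refine (run.regret_le_of_ge hb hσ hn hT hnT).trans ?_
      simp only [LQ.regretConst, LQ.Problem.scalars]
      simp only [mul_assoc _ _ (_ ^ 3)]
      exact mul_le_mul_of_nonneg_right (le_add_of_nonneg_left (by positivity)) (by positivity)
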